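/- Let $G\in\{B,C,D\}$ and, for $N\ge 1$, let $G(N)$ be $SO(2N+1)$, $Sp(2N)$, $SO(2N)$ respectively. Let $\widehat G(N)$ be the set of highest weights of irreducible representations of $G(N)$: integer tuples $\lambda_1\ge\dots\ge\lambda_N$ with $\lambda_N\ge 0$ for $G=B,C$, and with $\lambda_{N-1}\ge|\lambda_N|$ for $G=D$ (no condition on $\lambda_1$ if $N=1$). Let $\chi_\lambda^{G(N)}(u_1,\dots,u_N)$ be the irreducible character with highest weight $\lambda$, regarded as a Laurent polynomial in one eigenvalue $u_i$ from each pair $u_i,u_i^{-1}$ and given by the Weyl character formula. For a probability measure $\rho$ on $\widehat G(N)$ put $$\mathcal S_{\rho}^{G(N)}(u_1,\dots,u_N)=\sum_{\lambda\in\widehat G(N)}\rho(\lambda)\,\frac{\chi_\lambda^{G(N)}(u_1,\dots,u_N)}{\chi_\lambda^{G(N)}(1,\dots,1)} .$$ Set $c_B=\tfrac12$, $c_C=1$, $c_D=0$, and for $\lambda\in\widehat G(N)$ let $$\widehat m^G[\lambda]=\frac1{2N}\sum_{i=1}^N\left(\delta\Big(\frac{\lambda_i+N-i+c_G}{2N}\Big)+\delta\Big(-\frac{\lambda_i+N-i+c_G}{2N}\Big)\right).$$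 For each $N$ let $\rho(N)$ be a probability measure on $\widehat G(N)$ such that the sum defining $\mathcal S^{G(N)}_{\rho(N)}$ converges uniformly (regardless of the order of summation) in an open complex neighborhood of $(1,\dots,1)$. Let $Q$ be analytic in a neighborhood of $1\in\mathbb C$ and suppose that for every $k$ $$\lim_{N\to\infty}\frac1N\ln\mathcal S_{\rho(N)}^{G(N)}(u_1,\dots,u_k,1^{N-k})=Q(u_1)+\dots+Q(u_k)$$ uniformly in an open complex neighborhood $U_k$ of $(1,\dots,1)\in\mathbb C^k$. Here, for all large $N$, the sum defining $\mathcal S^{G(N)}_{\rho(N)}(u_1,\dots,u_k,1^{N-k})$ converges on $U_k$, and $\ln$ denotes an analytic branch of its logarithm on $U_k$ which vanishes at $(1,\dots,1)$. Then there is a function $\widehat Q$, analytic in a neighborhood of $1$, with $\widehat Q\big(\tfrac{u+u^{-1}}2\big)=Q(u)$ for all $u$ near $1$, and there is a probability measure $\mathbf m$ on $\mathbb R$ with finite moments of all orders such that, if $\lambda$ is distributed according to $\rho(N)$, then the random measures $\widehat m^G[\lambda]$ converge to $\mathbf m$ as $N\to\infty$ in probability, in the sense of moments: for all $n=0,1,2,\dots$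 and $\varepsilon>0$, $$\lim_{N\to\infty}\rho(N)\left\{\lambda:\ \left|\int_{\mathbb R}x^n\,\widehat m^G[\lambda](dx)-\int_{\mathbb R}x^n\,\mathbf m(dx)\right|\ge\varepsilon\right\}=0 .$$ The odd moments of $\mathbf m$ are zero, and for $k=0,1,2,\dots$ $$\int_{\mathbb R}x^{2k}\,\mathbf m(dx)=2^{-2k}\sum_{\ell=0}^{2k}\frac{(2k)!}{\ell!\,(\ell+1)!\,(2k-\ell)!}\,\frac{\partial^\ell}{\partial z^\ell}\Big((z^2-1)^k\,\widehat Q'(z)^{2k-\ell}\Big)\Big|_{z=1}.$$ -/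

import Mathlib

open MeasureTheory Filter Topology

/-- The three series of classical groups other than the unitary groups:
`B` is `SO(2N+1)`, `C` is `Sp(2N)`, `D` is `SO(2N)`. -/
inductive Series
  | B
  | C
  | D

namespace Series

/-- Highest weights of the irreducible representations of `G(N)`: weakly decreasing `N`-tuples
`l` of integers, nonnegative for the series `B` and `C`, and with `l_{N-1} ≥ |l_N|` for the series
`D` (together with monotonicity this is the same as `l_i ≥ |l_j|` for all `i < j`). -/
def IsSignature (G : Series) {N : ℕ} (l : Fin N → ℤ) : Prop :=
  match G with
  | B => Antitone l ∧ ∀ i, 0 ≤ l i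
  | C => Antitone l ∧ ∀ i, 0 ≤ l i
  | D => Antitone l ∧ ∀ i j, i < j → |l j| ≤ l i

/-- The set `Ĝ(N)` of signatures of `G(N)`. -/
def Sig (G : Series) (N : ℕ) : Type := {l : Fin N → ℤ // G.IsSignature l}

/-- Every subset of the countable set `Ĝ(N)` is measurable. -/
instance (G : Series) (N : ℕ) : MeasurableSpace (G.Sig N) := ⊤

/-- The integer `l_j + N - j` (for `j = 1, …, N`); the Lean index `j : Fin N` starts at `0`. -/
def expo {N : ℕ} (l : Fin N → ℤ) (j : Fin N) : ℤ := l j + (N : ℤ) - ((j : ℕ) + 1 : ℤ)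

/-- The product of `(u_i + u_i⁻¹) - (u_j + u_j⁻¹)` over `i < j`. -/
noncomputable def vand {N : ℕ} (u : Fin N → ℂ) : ℂ :=
  ∏ i, ∏ j ∈ Finset.Ioi i, ((u i + (u i)⁻¹) - (u j + (u j)⁻¹))

/-- The denominator in the Weyl character formula.

For the series `B` the usual denominator `∏ (u_i^{1/2} - u_i^{-1/2}) * vand u` and the usual
numerator are both multiplied by `∏ u_i^{1/2}`, which removes the half-integer powers.

For the series `D` the factor `2` makes the quotient equal to the character (with value `1` for the
trivial representation); it cancels in all normalized characters. -/
noncomputable def weylDen (G : Series) {N : ℕ} (u : Fin N → ℂ) : ℂ :=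
  match G with
  | B => (∏ i, (u i - 1)) * vand u
  | C => (∏ i, (u i - (u i)⁻¹)) * vand u
  | D => 2 * vand u

/-- The numerator in the Weyl character formula. With `m_j = l_j + N - j` the matrix entries are
`u_i^{1/2} (u_i^{m_j + 1/2} - u_i^{-(m_j + 1/2)})` for `B` (see `weylDen`),
`u_i^{m_j + 1} - u_i^{-(m_j + 1)}` for `C`, and `u_i^{m_j} ± u_i^{-m_j}` for `D`. -/
noncomputable def weylNum (G : Series) {N : ℕ} (l : Fin N → ℤ) (u : Fin N → ℂ) : ℂ :=
  match G with
  | B => (Matrix.of fun i j => u i ^ (expo l j + 1) - u i ^ (-expo l j)).det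
  | C => (Matrix.of fun i j => u i ^ (expo l j + 1) - u i ^ (-(expo l j + 1))).det
  | D => (Matrix.of fun i j => u i ^ expo l j + u i ^ (-expo l j)).det
      + (Matrix.of fun i j => u i ^ expo l j - u i ^ (-expo l j)).det

/-- The points with nonzero coordinates at which the Weyl denominator does not vanish. -/
def regularSet (G : Series) (N : ℕ) : Set (Fin N → ℂ) :=
  {u | (∀ i, u i ≠ 0) ∧ G.weylDen u ≠ 0}

/-- The character of the irreducible representation of `G(N)` with highest weight `l`, as a
Laurent polynomial function of one eigenvalue from each pair `u_i, u_i⁻¹`: the continuous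
extension of the quotient in the Weyl character formula from the regular points, a dense
subset of the set of all points with nonzero coordinates. -/
noncomputable def character (G : Series) {N : ℕ} (l : G.Sig N) : (Fin N → ℂ) → ℂ :=
  extendFrom (G.regularSet N) fun u => G.weylNum l.1 u / G.weylDen u

/-- The summand `ρ(l) χ_l(u) / χ_l(1, …, 1)` of the character generating function of `ρ`. -/
noncomputable def charTerm (G : Series) {N : ℕ} (ρ : Measure (G.Sig N)) (l : G.Sig N)
    (u : Fin N → ℂ) : ℂ :=
  (ρ.real {l} : ℂ) * (G.character l u / G.character l fun _ => 1)

/-- The character generating function of a probability measure `ρ` on `Ĝ(N)`. -/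
noncomputable def charGenFun (G : Series) {N : ℕ} (ρ : Measure (G.Sig N)) (u : Fin N → ℂ) : ℂ :=
  ∑' l : G.Sig N, G.charTerm ρ l u

/-- The point `(u_1, …, u_k, 1, …, 1)` with `N` coordinates (used for `N ≥ k`). -/
def padOnes {k : ℕ} (N : ℕ) (u : Fin k → ℂ) : Fin N → ℂ :=
  fun i => if h : (i : ℕ) < k then u ⟨i, h⟩ else 1

/-- The shift of the coordinates `l_i + N - i`. -/
noncomputable def shift (G : Series) : ℝ :=
  match G with
  | B => 1 / 2
  | C => 1
  | D => 0

/-- The position `(l_i + N - i + shift) / (2N)` of the `i`-th atom. -/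
noncomputable def atom (G : Series) {N : ℕ} (l : Fin N → ℤ) (i : Fin N) : ℝ :=
  ((expo l i : ℝ) + G.shift) / (2 * N)

/-- The symmetrized counting measure of a signature. -/
noncomputable def symMeasure (G : Series) {N : ℕ} (l : G.Sig N) : Measure ℝ :=
  ENNReal.ofReal (1 / (2 * N)) •
    ∑ i, (Measure.dirac (G.atom l.1 i) + Measure.dirac (-G.atom l.1 i))

end Series

/-! The moments are read off with differential operators that have the characters as eigenfunctions.
In the variables z_i = (u_i + u_i⁻¹)/2 the symmetric part of a character is, up to a constant, det
(P_{m_j}(z_i)) divided by the Vandermonde product V of the z_i, where m_j = l_j + N - j and P_m is a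
Chebyshev-type polynomial (`basePoly`). For each series one operator H = (z² - 1)∂² + (az + b)∂ + c
satisfies H P_m = (m + c_G)² P_m (`exists_basePoly_ode`), so V⁻¹ (∑ H_i^k) V multiplies this
symmetric part by the power sum p_k = ∑ (m_j + c_G)^(2k). For the series D the character has a
second part, a multiple of ∏ (u_i - u_i⁻¹). It vanishes once some u_i is 1 and changes sign under
u_i ↦ u_i⁻¹, so it can be removed. Applying the operator once and twice to the generating function
and evaluating at z = 1 gives the expectations of p_k and p_k².

Since V vanishes at z = 1, the conjugated operator has to be rewritten without V. This is done by
`vandermonde_mul_sum_ddSum`: V ∑ (ddSum i)^m g_i = (m + 1) ∑ (∂_i^m V) g_i for equivariant families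
g, a consequence of Lagrange interpolation. The result is `radialOp`, built from multiplications,
derivatives and divided differences. Write the generating function as F = exp (N · `logSum`).
Conjugation by F turns ∂_i into ∂_i + N ℓ_i with ℓ_i = ∂_i `logSum`, and the hypothesis on finitely
many variables, together with symmetry, makes every coefficient of ℓ_i converge to that of Q̂'(1 +
X_i), uniformly in i (`LogLimit.conv_logSum`).

It remains to count powers of N. Each conjugated derivative, each sum of divided differences and the
outer sum over i contribute one factor N, and N⁻¹ · `ddSum i` tends to the operator h ↦ (h -
h(0))/X. Hence N^(-(2k+1)) times the operator sends a sequence of series tending to the constant c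
to one tending to c M, where M is 2^(2k) times the claimed moment (`null_radialOp`,
`limitMoment_eq`). Applied twice this gives M², so the variance of p_k / N^(2k+1) tends to 0, and
Chebyshev's inequality yields convergence in probability (`tendsto_measure_of_moments`).

All of this takes place in formal power series in z_i - 1, and analytic facts enter through Taylor
coefficients. The map u ↦ (u + u⁻¹)/2 is branched at 1, so Q̂ comes from invariance of Q under
inversion (`exists_analytic_joukowski`), and convergence of coefficients is moved from u to z by
`tendsto_coeff_of_comp_jouMap`. The limit measure is a weak limit of symmetrized measures along one
sequence of signatures for which all moments converge (`exists_measure_of_tendsto_moments`). -/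

set_option linter.unusedSectionVars false

/-! ### Divided differences of formal power series. -/

namespace SymSeries

open MvPowerSeries Finset

variable {σ : Type*} [Fintype σ] [DecidableEq σ]

theorem coeff_X_mul_ite (i : σ) (g : MvPowerSeries σ ℂ) (α : σ →₀ ℕ) :
    coeff α (X i * g) = if α i = 0 then 0 else coeff (α - Finsupp.single i 1) g := by
  have h := coeff_monomial_mul α (Finsupp.single i 1) g (1 : ℂ)
  rw [X, h]
  by_cases h0 : α i = 0
  · simp [h0, Finsupp.single_le_iff]
  · have : Finsupp.single i 1 ≤ α := by
      rw [Finsupp.single_le_iff]; omega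
    simp [h0, this]

theorem coeff_rename_perm (e : Equiv.Perm σ) (g : MvPowerSeries σ ℂ) (α : σ →₀ ℕ) :
    coeff α (rename e g) = coeff (α.equivMapDomain e.symm) g := by
  have h := coeff_embDomain_rename (R := ℂ) e.toEmbedding g (α.equivMapDomain e.symm)
  have h2 : (α.equivMapDomain e.symm).embDomain e.toEmbedding = α := by
    ext x
    obtain ⟨y, rfl⟩ := e.surjective x
    have := Finsupp.embDomain_apply_self e.toEmbedding (α.equivMapDomain e.symm) y
    simpa using this
  rw [h2] at h
  exact h

/-- The multi-index `α` with the entries at `i` and `j` replaced by `p` and `q`. -/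
noncomputable def upd (α : σ →₀ ℕ) (i j : σ) (p q : ℕ) : σ →₀ ℕ :=
  (α.update i p).update j q

theorem upd_apply (α : σ →₀ ℕ) (i j : σ) (p q : ℕ) (l : σ) :
    upd α i j p q l = if l = j then q else if l = i then p else α l := by
  simp only [upd, Finsupp.coe_update, Function.update_apply]

/-- The divided difference `(g - g ∘ (i j)) / (X i - X j)`. -/
noncomputable def dd (i j : σ) (g : MvPowerSeries σ ℂ) : MvPowerSeries σ ℂ := fun α =>
  ∑ q ∈ range (α j + 1),
    (coeff (upd α i j (α i + α j + 1 - q) q) g - coeff (upd α i j q (α i + α j + 1 - q)) g)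

theorem coeff_dd (i j : σ) (g : MvPowerSeries σ ℂ) (α : σ →₀ ℕ) :
    coeff α (dd i j g) = ∑ q ∈ range (α j + 1),
      (coeff (upd α i j (α i + α j + 1 - q) q) g
        - coeff (upd α i j q (α i + α j + 1 - q)) g) := rfl

/-- Multiplication by X i - X j moves only along the line of exponents with α i + α j fixed. On that
line the coefficients of `dd` are partial sums of an antisymmetric sequence, so the product
telescopes. -/
theorem X_sub_X_mul_dd {i j : σ} (hij : i ≠ j) (g : MvPowerSeries σ ℂ) :
    (X i - X j) * dd i j g = g - rename (Equiv.swap i j) g := by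
  ext α
  rw [sub_mul, map_sub, map_sub, coeff_X_mul_ite, coeff_X_mul_ite, coeff_rename_perm]
  -- coefficients on the antidiagonal line through `α`
  set c : ℕ → ℕ → ℂ := fun p q => coeff (upd α i j p q) g with hc
  have hu : ∀ a b p q, upd (upd α i j a b) i j p q = upd α i j p q := by
    intro a b p q; ext l; simp only [upd_apply]; split_ifs <;> simp_all
  have hi1 : α i ≠ 0 → α - Finsupp.single i 1 = upd α i j (α i - 1) (α j) := by
    intro _; ext l; simp only [upd_apply, Finsupp.tsub_apply, Finsupp.single_apply]
    grind
  have hj1 : α j ≠ 0 → α - Finsupp.single j 1 = upd α i j (α i) (α j - 1) := by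
    intro _; ext l; simp only [upd_apply, Finsupp.tsub_apply, Finsupp.single_apply]
    grind
  have e1 : α.equivMapDomain (Equiv.swap i j).symm = upd α i j (α j) (α i) := by
    ext l
    simp only [Finsupp.equivMapDomain_apply, upd_apply, Equiv.symm_swap]
    rcases eq_or_ne l j with rfl | hj
    · simp
    rcases eq_or_ne l i with rfl | hi
    · simp [hij]
    · simp [hj, hi, Equiv.swap_apply_of_ne_of_ne]
  have e2 : α = upd α i j (α i) (α j) := by
    ext l; simp only [upd_apply]; split_ifs <;> simp_all
  rw [e1]
  have key : ∀ p q, coeff (upd α i j p q) (dd i j g)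
      = ∑ r ∈ range (q + 1), (c (p + q + 1 - r) r - c r (p + q + 1 - r)) := by
    intro p q
    rw [coeff_dd]
    simp [upd_apply, hij, hu, hc]
  have hα : coeff α g = c (α i) (α j) := by rw [hc]; simp only; rw [← e2]
  have hα' : coeff (upd α i j (α j) (α i)) g = c (α j) (α i) := rfl
  rw [hα, hα']
  -- The sum over a whole antidiagonal vanishes by antisymmetry. This settles the boundary case α i
  -- = 0, where the X i term contributes nothing.
  have anti : ∀ n : ℕ, ∑ r ∈ range (n + 1), (c (n - r) r - c r (n - r)) = 0 := by
    intro n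
    rw [sum_sub_distrib, sub_eq_zero, ← sum_range_reflect]
    refine sum_congr rfl fun r hr => ?_
    have : r ≤ n := by simpa [Nat.lt_succ_iff] using hr
    congr 1 <;> omega
  generalize hA : α i = a at *
  generalize hB : α j = b at *
  by_cases ha : a = 0 <;> by_cases hb : b = 0
  · subst ha hb; simp
  · rw [if_pos ha, if_neg hb, hj1 hb, key]
    obtain ⟨b, rfl⟩ : ∃ b', b = b' + 1 := ⟨b - 1, by omega⟩
    subst ha
    have := anti (b + 1)
    rw [sum_range_succ] at this
    simp only [Nat.add_sub_cancel, zero_add, Nat.sub_self] at this ⊢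
    linear_combination -this
  · rw [if_neg ha, if_pos hb, hi1 ha, key]
    subst hb
    obtain ⟨a, rfl⟩ : ∃ a', a = a' + 1 := ⟨a - 1, by omega⟩
    simp
  · rw [if_neg ha, if_neg hb, hi1 ha, hj1 hb, key, key]
    obtain ⟨a, rfl⟩ : ∃ a', a = a' + 1 := ⟨a - 1, by omega⟩
    obtain ⟨b, rfl⟩ : ∃ b', b = b' + 1 := ⟨b - 1, by omega⟩
    rw [sum_range_succ _ (b + 1)]
    have e : a + 1 - 1 + (b + 1) + 1 = a + 1 + (b + 1 - 1) + 1 := by omega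
    rw [e]
    simp only [Nat.add_sub_cancel]
    have e3 : a + 1 + b + 1 - (b + 1) = a + 1 := by omega
    rw [e3]
    ring

theorem dd_add (i j : σ) (g h : MvPowerSeries σ ℂ) : dd i j (g + h) = dd i j g + dd i j h := by
  ext α
  simp only [coeff_dd, map_add, ← sum_add_distrib]
  exact sum_congr rfl fun _ _ => by ring

theorem dd_smul (i j : σ) (c : ℂ) (g : MvPowerSeries σ ℂ) : dd i j (c • g) = c • dd i j g := by
  ext α
  simp only [coeff_dd, map_smul, smul_eq_mul, mul_sum, mul_sub]

/-- The sum of all divided differences at the index `i`. -/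
noncomputable def ddSum (i : σ) : MvPowerSeries σ ℂ →ₗ[ℂ] MvPowerSeries σ ℂ where
  toFun g := ∑ j ∈ univ.erase i, dd i j g
  map_add' g h := by simp [dd_add, sum_add_distrib]
  map_smul' c g := by simp only [dd_smul, smul_sum, RingHom.id_apply]

theorem ddSum_apply (i : σ) (g : MvPowerSeries σ ℂ) :
    ddSum i g = ∑ j ∈ univ.erase i, dd i j g := rfl

/-- Invariance under all permutations of the variables. -/
def IsSymm (f : MvPowerSeries σ ℂ) : Prop := ∀ e : Equiv.Perm σ, rename e f = f

/-- A family of power series permuted by the permutations of the variables. -/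
def IsEquivariant (g : σ → MvPowerSeries σ ℂ) : Prop :=
  ∀ (e : Equiv.Perm σ) (i : σ), rename e (g i) = g (e i)

theorem X_sub_X_ne_zero {i j : σ} (hij : i ≠ j) : (X i - X j : MvPowerSeries σ ℂ) ≠ 0 := by
  intro h
  have := congrArg (coeff (Finsupp.single i 1)) h
  simp [coeff_index_single_X, hij] at this

/-- Divided differences are linear over symmetric series. This is what later allows the generating
function to be pulled out of the operators. -/
theorem dd_symm_mul {i j : σ} (hij : i ≠ j) {f : MvPowerSeries σ ℂ} (hf : IsSymm f)
    (g : MvPowerSeries σ ℂ) : dd i j (f * g) = f * dd i j g := by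
  apply mul_left_cancel₀ (X_sub_X_ne_zero hij)
  rw [X_sub_X_mul_dd hij, mul_left_comm, X_sub_X_mul_dd hij, map_mul, hf]
  ring

theorem ddSum_symm_mul (i : σ) {f : MvPowerSeries σ ℂ} (hf : IsSymm f)
    (g : MvPowerSeries σ ℂ) : ddSum i (f * g) = f * ddSum i g := by
  rw [ddSum_apply, ddSum_apply, mul_sum]
  exact sum_congr rfl fun j hj => dd_symm_mul (ne_of_mem_erase hj).symm hf g

theorem IsEquivariant.mul_dd {g : σ → MvPowerSeries σ ℂ} (hg : IsEquivariant g) {i j : σ}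
    (hij : i ≠ j) : (X i - X j) * dd i j (g i) = g i - g j := by
  rw [X_sub_X_mul_dd hij, hg]; simp

/-- For equivariant g the swap of i and j takes g i to g j, so `dd i j (g i)` is (g i - g j)/(X i -
X j). Since equivariance is preserved, the same description holds for all iterates. -/
theorem IsEquivariant.ddSum {g : σ → MvPowerSeries σ ℂ} (hg : IsEquivariant g) :
    IsEquivariant fun i => ddSum i (g i) := by
  intro e i
  have key : ∀ j, i ≠ j → rename e (dd i j (g i)) = dd (e i) (e j) (g (e i)) := by
    intro j hij
    have hij' : e i ≠ e j := fun h => hij (e.injective h)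
    apply mul_left_cancel₀ (X_sub_X_ne_zero hij')
    rw [hg.mul_dd hij']
    have := congrArg (rename e) (hg.mul_dd hij)
    rw [map_mul, map_sub, map_sub, rename_X, rename_X, hg, hg] at this
    exact this
  simp only [ddSum_apply, map_sum]
  refine sum_bij (fun j _ => e j) ?_ ?_ ?_ ?_
  · intro j hj; simpa using ne_of_mem_erase hj
  · intro j _ k _ h; exact e.injective h
  · intro b hb
    refine ⟨e.symm b, ?_, by simp⟩
    have := ne_of_mem_erase hb
    simp only [mem_erase, mem_univ, and_true]
    rintro rfl; simp at this
  · intro j hj; exact key j (ne_of_mem_erase hj).symm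

theorem pderiv_rename (e : Equiv.Perm σ) (i : σ) (f : MvPowerSeries σ ℂ) :
    rename e (pderiv ℂ i f) = pderiv ℂ (e i) (rename e f) := by
  ext α
  rw [coeff_rename_perm, coeff_pderiv, coeff_pderiv, coeff_rename_perm]
  have : (α + Finsupp.single (e i) 1).equivMapDomain e.symm
      = α.equivMapDomain e.symm + Finsupp.single i 1 := by
    ext l; simp [Finsupp.equivMapDomain_apply, Finsupp.single_apply]
  rw [this]
  simp [Finsupp.equivMapDomain_apply]

end SymSeries

/-! ### Iterated differences and derivatives of the nodal polynomial. -/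

namespace SymSeries

open Finset

section Field

open Polynomial

variable {σ : Type*} [Fintype σ] [DecidableEq σ] {F : Type*} [Field F]

theorem iterate_derivative_X_sub_C_mul_succ {R : Type*} [CommRing R] (a : R) (p : R[X]) (m : ℕ) :
    derivative^[m + 1] ((X - C a) * p)
      = (X - C a) * derivative^[m + 1] p + ((m : R[X]) + 1) * derivative^[m] p := by
  induction m with
  | zero => simp; ring
  | succ m ih =>
    rw [Function.iterate_succ_apply', ih]
    simp only [derivative_add, derivative_mul, derivative_sub, derivative_X, derivative_C,
      derivative_natCast, derivative_one, ← Function.iterate_succ_apply' (f := derivative)]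
    push_cast
    ring

/-- The ratio `R ^ (m) (x i) / R (x i)`, where `R = ∏ l ≠ i, (X - x l)`. -/
noncomputable def nodalRatio (x : σ → F) (m : ℕ) (i : σ) : F :=
  (derivative^[m] (Lagrange.nodal (univ.erase i) x)).eval (x i)
    / (Lagrange.nodal (univ.erase i) x).eval (x i)

theorem nodal_erase_eval_ne_zero {x : σ → F} (hx : Function.Injective x) (i : σ) :
    (Lagrange.nodal (univ.erase i) x).eval (x i) ≠ 0 := by
  rw [Lagrange.eval_nodal, prod_ne_zero_iff]
  intro l hl
  exact sub_ne_zero.2 fun h => (ne_of_mem_erase hl) (hx h).symm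

theorem eval_iterate_derivative_nodal (x : σ → F) (m : ℕ) (i : σ) :
    (derivative^[m + 1] (Lagrange.nodal univ x)).eval (x i)
      = (m + 1) * (derivative^[m] (Lagrange.nodal (univ.erase i) x)).eval (x i) := by
  rw [Lagrange.nodal_eq_mul_nodal_erase (mem_univ i), iterate_derivative_X_sub_C_mul_succ]
  simp

/-- Let P be the full nodal polynomial and R l the one with node l omitted. The derivative S =
P^(m+1) has degree below the number of nodes, so Lagrange interpolation writes it as a combination
of the R l with coefficients (m + 1) times the ratios. Differentiating this expansion and evaluating
at x j gives the recursion. -/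
theorem nodalRatio_succ [CharZero F] {x : σ → F} (hx : Function.Injective x) (m : ℕ) (j : σ) :
    ((m : F) + 2) * nodalRatio x (m + 1) j
      = (m + 1) * ∑ l ∈ univ.erase j, (nodalRatio x m j + nodalRatio x m l) / (x j - x l) := by
  set P := Lagrange.nodal univ x with hP
  set R : σ → F[X] := fun l => Lagrange.nodal (univ.erase l) x with hR
  have hR0 : ∀ l, (R l).eval (x l) ≠ 0 := nodal_erase_eval_ne_zero hx
  set S := derivative^[m + 1] P with hS
  have hdeg : S.degree < #(univ : Finset σ) := by
    have h1 : P.degree = #(univ : Finset σ) := Lagrange.degree_nodal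
    have hP0 : P ≠ 0 := Lagrange.nodal_ne_zero
    have : ∀ n, (derivative^[n + 1] P).degree < P.degree := by
      intro n
      induction n with
      | zero => exact degree_derivative_lt hP0
      | succ n ih =>
        rw [Function.iterate_succ_apply']
        exact lt_of_le_of_lt degree_derivative_le ih
    rw [← h1]; exact this m
  have hSum : S = ∑ l, C (((m : F) + 1) * nodalRatio x m l) * R l := by
    apply Polynomial.eq_of_degrees_lt_of_eval_index_eq (s := univ) (v := x) hx.injOn hdeg
    · apply lt_of_le_of_lt (degree_sum_le _ _)
      rw [Finset.sup_lt_iff (WithBot.bot_lt_coe _)]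
      intro l _
      refine lt_of_le_of_lt ((degree_mul_le _ _).trans (add_le_of_nonpos_left degree_C_le)) ?_
      rw [hR]
      simp only [Lagrange.degree_nodal]
      exact_mod_cast card_erase_lt_of_mem (mem_univ l)
    · intro i _
      rw [eval_finsetSum, sum_eq_single i]
      · rw [hS, hP, eval_iterate_derivative_nodal, eval_mul, eval_C, nodalRatio, mul_assoc,
          div_mul_cancel₀ _ (hR0 i)]
      · intro l _ hl
        rw [eval_mul, hR]
        simp only
        rw [Lagrange.eval_nodal_at_node (mem_erase.2 ⟨hl.symm, mem_univ _⟩), mul_zero]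
      · simp
  have h1 : (derivative S).eval (x j) = (m + 2) * (nodalRatio x (m + 1) j * (R j).eval (x j)) := by
    rw [hS, ← Function.iterate_succ_apply' (f := derivative), hP, eval_iterate_derivative_nodal,
      nodalRatio, div_mul_cancel₀ _ (hR0 j)]
    push_cast; ring
  have h2 : ∀ l ∈ univ.erase j, (R l).derivative.eval (x j) = (R j).eval (x j) / (x j - x l) := by
    intro l hl
    have hlj := ne_of_mem_erase hl
    have hx' : x j - x l ≠ 0 := sub_ne_zero.2 fun h => hlj (hx h).symm
    rw [hR]
    simp only
    rw [Lagrange.eval_nodal_derivative_eval_node_eq (mem_erase.2 ⟨hlj.symm, mem_univ _⟩),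
      Lagrange.nodal_eq_mul_nodal_erase hl, erase_right_comm]
    simp only [eval_mul, eval_sub, eval_X, eval_C]
    field_simp
  have h3 : (R j).derivative.eval (x j)
      = ∑ l ∈ univ.erase j, (R j).eval (x j) / (x j - x l) := by
    rw [hR]
    simp only
    rw [Lagrange.derivative_nodal, eval_finsetSum]
    refine sum_congr rfl fun l hl => ?_
    have hlj := ne_of_mem_erase hl
    have hx' : x j - x l ≠ 0 := sub_ne_zero.2 fun h => hlj (hx h).symm
    rw [Lagrange.nodal_eq_mul_nodal_erase hl]
    simp only [eval_mul, eval_sub, eval_X, eval_C]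
    field_simp
  have h4 : (derivative S).eval (x j) = ((m : F) + 1) * (R j).eval (x j) *
      ∑ l ∈ univ.erase j, (nodalRatio x m j + nodalRatio x m l) / (x j - x l) := by
    rw [hSum, derivative_sum, eval_finsetSum, ← add_sum_erase _ _ (mem_univ j)]
    simp only [derivative_C_mul, eval_mul, eval_C]
    rw [h3, mul_sum, mul_sum, ← sum_add_distrib]
    refine sum_congr rfl fun l hl => ?_
    rw [h2 l hl]; ring
  apply mul_right_cancel₀ (hR0 j)
  rw [mul_assoc, ← h1, h4]; ring

theorem sum_offdiag_swap (f : σ → σ → F) :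
    ∑ i, ∑ j ∈ univ.erase i, f i j = ∑ i, ∑ j ∈ univ.erase i, f j i := by
  have h : ∀ g : σ → σ → F, ∑ i, ∑ j ∈ univ.erase i, g i j
      = ∑ i, ∑ j, if i = j then 0 else g i j := by
    intro g
    refine sum_congr rfl fun i _ => ?_
    rw [← add_sum_erase _ _ (mem_univ i), if_pos rfl, zero_add]
    exact sum_congr rfl fun j hj => by rw [if_neg (ne_of_mem_erase hj).symm]
  rw [h, h, sum_comm]
  exact sum_congr rfl fun i _ => sum_congr rfl fun j _ => by simp [eq_comm]

/-- Summation by parts: exchanging i and j moves one difference from A to the ratios, where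
`nodalRatio_succ` turns it into the next ratio with factor (n + 2)/(n + 1). After m steps these
factors multiply to m + 1. -/
theorem sum_iterated_difference [CharZero F] {x : σ → F} (hx : Function.Injective x)
    (A : ℕ → σ → F)
    (hA : ∀ m i, A (m + 1) i = ∑ j ∈ univ.erase i, (A m i - A m j) / (x i - x j)) (m : ℕ) :
    ∑ i, A m i = (m + 1) * ∑ i, A 0 i * nodalRatio x m i := by
  have step : ∀ (k n : ℕ), ((n : F) + 1) * ∑ i, A (k + 1) i * nodalRatio x n i
      = (n + 2) * ∑ i, A k i * nodalRatio x (n + 1) i := by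
    intro k n
    have e1 : ∑ i, A (k + 1) i * nodalRatio x n i = ∑ i, ∑ j ∈ univ.erase i,
        (A k i * nodalRatio x n i / (x i - x j) + A k i * nodalRatio x n j / (x i - x j)) := by
      simp only [sum_add_distrib]
      rw [sum_offdiag_swap fun i j => A k i * nodalRatio x n j / (x i - x j), ← sum_add_distrib]
      refine sum_congr rfl fun i _ => ?_
      rw [hA, sum_mul, ← sum_add_distrib]
      refine sum_congr rfl fun j hj => ?_
      have h1 : x i - x j ≠ 0 := sub_ne_zero.2 fun h => (ne_of_mem_erase hj) (hx h).symm
      have h2 : x j - x i ≠ 0 := sub_ne_zero.2 fun h => (ne_of_mem_erase hj) (hx h)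
      field_simp
      ring
    rw [e1, mul_sum, mul_sum]
    refine sum_congr rfl fun i _ => ?_
    have := nodalRatio_succ hx n i
    rw [mul_left_comm, this, mul_sum, mul_sum, mul_sum]
    exact sum_congr rfl fun j _ => by ring
  have main : ∀ (n k : ℕ), ((n : F) + 1) * ∑ i, A k i * nodalRatio x n i
      = (n + k + 1) * ∑ i, A 0 i * nodalRatio x (n + k) i := by
    intro n k
    induction k generalizing n with
    | zero => simp
    | succ k ih =>
      have := ih (n + 1)
      rw [step]
      push_cast at this ⊢
      rw [show (n : F) + 2 = n + 1 + 1 by ring, this, show n + 1 + k = n + (k + 1) by ring]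
      ring
  have h0 := main 0 m
  have : ∀ i, nodalRatio x 0 i = 1 := fun i => by
    rw [nodalRatio]; exact div_self (nodal_erase_eval_ne_zero hx i)
  simpa [this] using h0

end Field

/-! ### Derivatives of the Vandermonde product. -/

section Vandermonde

open MvPowerSeries

variable {N : ℕ}

/-- The Vandermonde product `∏ i < j, (X i - X j)`. -/
noncomputable def vandermonde (N : ℕ) : MvPowerSeries (Fin N) ℂ :=
  ∏ i, ∏ j ∈ Ioi i, (X i - X j)

theorem vandermonde_ne_zero : vandermonde N ≠ 0 := by
  refine prod_ne_zero_iff.2 fun i _ => prod_ne_zero_iff.2 fun j hj => X_sub_X_ne_zero ?_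
  exact ne_of_lt (mem_Ioi.1 hj)

theorem derivation_prod_eq_zero {A ι : Type*} [CommRing A] [Algebra ℂ A] (d : Derivation ℂ A A)
    (s : Finset ι) (f : ι → A) (h : ∀ i ∈ s, d (f i) = 0) : d (∏ i ∈ s, f i) = 0 := by
  classical
  induction s using Finset.induction_on with
  | empty => simp
  | insert a s ha ih =>
    rw [prod_insert ha, Derivation.leibniz, h a (mem_insert_self _ _),
      ih fun i hi => h i (mem_insert_of_mem hi)]
    simp

/-- As a function of X i alone the Vandermonde product is a constant multiple of the nodal
polynomial of the other variables, so its ∂_i-derivatives are governed by `nodalRatio`. -/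
theorem vandermonde_factor (i : Fin N) : ∃ c : MvPowerSeries (Fin N) ℂ, pderiv ℂ i c = 0 ∧
    vandermonde N = c * ∏ j ∈ univ.erase i, (X i - X j) := by
  have e : vandermonde N = ∏ a, ∏ b, if a < b then (X a - X b : MvPowerSeries (Fin N) ℂ) else 1 := by
    refine prod_congr rfl fun a _ => ?_
    rw [prod_ite, prod_const_one, mul_one]
    exact prod_congr (by ext; simp) fun _ _ => rfl
  have hcol : ∀ a ∈ univ.erase i, ∏ b, (if a < b then (X a - X b : MvPowerSeries (Fin N) ℂ) else 1)
      = (if a < i then (X a - X i) else 1) * ∏ b ∈ univ.erase i, if a < b then X a - X b else 1 :=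
    fun a _ => (mul_prod_erase _ _ (mem_univ i)).symm
  have hsgn : ∀ j ∈ univ.erase i, (if i < j then (X i - X j : MvPowerSeries (Fin N) ℂ) else 1)
      * (if j < i then (X j - X i) else 1) = (if i < j then 1 else -1) * (X i - X j) := by
    intro j hj
    have := ne_of_mem_erase hj
    rcases lt_or_gt_of_ne this with h | h
    · simp [h, not_lt_of_gt h]
    · simp [h, not_lt_of_gt h]
  refine ⟨(∏ j ∈ univ.erase i, (if i < j then 1 else -1)) * ∏ a ∈ univ.erase i,
    ∏ b ∈ univ.erase i, if a < b then X a - X b else 1, ?_, ?_⟩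
  · have h1 : pderiv ℂ i (∏ j ∈ univ.erase i, (if i < j then (1 : MvPowerSeries (Fin N) ℂ) else -1))
        = 0 := by
      apply derivation_prod_eq_zero
      intro j _; split_ifs <;> simp
    have h2 : pderiv ℂ i (∏ a ∈ univ.erase i, ∏ b ∈ univ.erase i,
        if a < b then (X a - X b : MvPowerSeries (Fin N) ℂ) else 1) = 0 := by
      apply derivation_prod_eq_zero
      intro a ha
      apply derivation_prod_eq_zero
      intro b hb
      split_ifs
      · rw [map_sub, pderiv_X_of_ne (ne_of_mem_erase ha), pderiv_X_of_ne (ne_of_mem_erase hb),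
          sub_zero]
      · simp
    rw [Derivation.leibniz, h1, h2]; simp
  · rw [e, ← mul_prod_erase _ _ (mem_univ i), ← mul_prod_erase _ _ (mem_univ i), if_neg (lt_irrefl _),
      one_mul, prod_congr rfl hcol, prod_mul_distrib, ← mul_assoc, ← prod_mul_distrib,
      prod_congr rfl hsgn, prod_mul_distrib]
    ring

theorem iterate_leibniz {A : Type*} [CommRing A] [Algebra ℂ A] (d : Derivation ℂ A A) (a b : A)
    (n : ℕ) : d^[n] (a * b) = ∑ m ∈ range (n + 1), (n.choose m : A) * (d^[m] a * d^[n - m] b) := by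
  induction n with
  | zero => simp
  | succ n ih =>
    rw [Function.iterate_succ_apply', ih, map_sum]
    have h1 : ∀ m ∈ range (n + 1), d ((n.choose m : A) * (d^[m] a * d^[n - m] b))
        = (n.choose m : A) * (d^[m + 1] a * d^[n - m] b)
          + (n.choose m : A) * (d^[m] a * d^[n + 1 - m] b) := by
      intro m hm
      have hm' : n + 1 - m = (n - m) + 1 := by
        have := mem_range.1 hm; omega
      rw [Derivation.leibniz, Derivation.leibniz, Derivation.map_natCast, hm',
        Function.iterate_succ_apply' (n := m), Function.iterate_succ_apply' (n := n - m)]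
      simp only [smul_eq_mul]; ring
    have h2 : ∑ m ∈ range (n + 1), (n.choose m : A) * (d^[m] a * d^[n + 1 - m] b)
        = ∑ m ∈ range (n + 1), (n.choose (m + 1) : A) * (d^[m + 1] a * d^[n - m] b)
          + a * d^[n + 1] b := by
      have := sum_range_succ (fun m => (n.choose m : A) * (d^[m] a * d^[n + 1 - m] b)) (n + 1)
      rw [Nat.choose_succ_self, Nat.cast_zero, zero_mul, add_zero] at this
      rw [← this, sum_range_succ']
      simp
    rw [sum_congr rfl h1, sum_add_distrib, h2, sum_range_succ' _ (n + 1), ← add_assoc,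
      ← sum_add_distrib]
    simp [Nat.choose_succ_succ, add_mul]

theorem iterate_pderiv_eval (d : Derivation ℂ (MvPowerSeries (Fin N) ℂ) (MvPowerSeries (Fin N) ℂ))
    (x : MvPowerSeries (Fin N) ℂ) (hx : d x = 1) (p : Polynomial (MvPowerSeries (Fin N) ℂ))
    (hp : ∀ n, d (p.coeff n) = 0) (m : ℕ) :
    d^[m] (p.eval x) = (Polynomial.derivative^[m] p).eval x := by
  induction m generalizing p with
  | zero => rfl
  | succ m ih =>
    rw [Function.iterate_succ_apply, Function.iterate_succ_apply]
    have h1 : d (p.eval x) = p.derivative.eval x := by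
      rw [Polynomial.derivative_eval, Polynomial.eval_eq_sum, Polynomial.sum_def, map_sum,
        Polynomial.sum_def]
      refine sum_congr rfl fun n _ => ?_
      rw [Derivation.leibniz, Derivation.leibniz_pow, hp, hx]
      simp only [smul_eq_mul, nsmul_eq_mul, mul_zero, mul_one, add_zero]; ring
    rw [h1, ih]
    intro n
    rw [Polynomial.coeff_derivative, Derivation.leibniz, hp]
    have : d ((n : MvPowerSeries (Fin N) ℂ) + 1) = 0 := by simp
    rw [this]; simp

theorem derivation_coeff_prod {A ι : Type*} [CommRing A] [Algebra ℂ A] (d : Derivation ℂ A A)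
    (s : Finset ι) (f : ι → Polynomial A) (h : ∀ i ∈ s, ∀ n, d ((f i).coeff n) = 0) (n : ℕ) :
    d ((∏ i ∈ s, f i).coeff n) = 0 := by
  classical
  induction s using Finset.induction_on generalizing n with
  | empty => rw [prod_empty, Polynomial.coeff_one]; split_ifs <;> simp
  | insert a s ha ih =>
    rw [prod_insert ha, Polynomial.coeff_mul, map_sum]
    refine sum_eq_zero fun p _ => ?_
    rw [Derivation.leibniz, h a (mem_insert_self _ _),
      ih fun i hi => h i (mem_insert_of_mem hi)]
    simp

/-- Iterated partial derivatives of the Vandermonde product in the fraction field. -/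
theorem iterate_pderiv_vandermonde (i : Fin N) (m : ℕ) :
    algebraMap _ (FractionRing (MvPowerSeries (Fin N) ℂ)) ((pderiv ℂ i)^[m] (vandermonde N))
      = algebraMap _ _ (vandermonde N)
        * nodalRatio (fun j : Fin N => algebraMap (MvPowerSeries (Fin N) ℂ)
            (FractionRing (MvPowerSeries (Fin N) ℂ)) (X j)) m i := by
  obtain ⟨c, hc, hV⟩ := vandermonde_factor i
  set R : Polynomial (MvPowerSeries (Fin N) ℂ) := Lagrange.nodal (univ.erase i) X with hR
  have hRe : R.eval (X i) = ∏ j ∈ univ.erase i, (X i - X j) := by rw [hR, Lagrange.eval_nodal]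
  have hco : ∀ n, pderiv ℂ i (R.coeff n) = 0 := by
    rw [hR, Lagrange.nodal_eq]
    refine derivation_coeff_prod _ _ _ fun j hj n => ?_
    rw [Polynomial.coeff_sub, Polynomial.coeff_X, Polynomial.coeff_C, map_sub]
    have := pderiv_X_of_ne (R := ℂ) (ne_of_mem_erase hj)
    split_ifs <;> simp [this]
  have h1 : (pderiv ℂ i)^[m] (vandermonde N) = c * (Polynomial.derivative^[m] R).eval (X i) := by
    rw [hV, ← hRe, ← iterate_pderiv_eval _ _ pderiv_X_self R hco]
    generalize R.eval (X i) = r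
    induction m with
    | zero => rfl
    | succ m ih =>
      rw [Function.iterate_succ_apply', ih, Derivation.leibniz, hc,
        ← Function.iterate_succ_apply' (f := pderiv ℂ i)]
      simp
  set φ := algebraMap (MvPowerSeries (Fin N) ℂ) (FractionRing (MvPowerSeries (Fin N) ℂ)) with hφ
  have hmap : ∀ n, (Polynomial.derivative^[n] (Lagrange.nodal (univ.erase i)
      fun j : Fin N => φ (X j))).eval (φ (X i)) = φ ((Polynomial.derivative^[n] R).eval (X i)) := by
    intro n
    have : (Lagrange.nodal (univ.erase i) fun j : Fin N => φ (X j)) = R.map φ := by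
      rw [hR, Lagrange.nodal_eq, Lagrange.nodal_eq, Polynomial.map_prod]
      simp
    rw [this, Polynomial.iterate_derivative_map, Polynomial.eval_map_apply]
  have h0 := hmap 0
  simp only [Function.iterate_zero, id] at h0
  have hne : φ (R.eval (X i)) ≠ 0 := by
    rw [hRe]
    intro h
    have := (IsFractionRing.injective (MvPowerSeries (Fin N) ℂ)
      (FractionRing (MvPowerSeries (Fin N) ℂ))) (h.trans (map_zero φ).symm)
    revert this
    exact prod_ne_zero_iff.2 fun j hj => X_sub_X_ne_zero (ne_of_mem_erase hj).symm
  rw [h1, nodalRatio, hmap, h0, hV, ← hRe, map_mul, map_mul]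
  field_simp

/-- In the fraction field the variables are distinct nodes and the iterates of `ddSum` are iterated
differences. Thus `sum_iterated_difference` applies, and the ratio of ∂_i^m V to V is `nodalRatio`.
The identity removes V from the conjugated operators. -/
theorem vandermonde_mul_sum_ddSum {g : Fin N → MvPowerSeries (Fin N) ℂ} (hg : IsEquivariant g)
    (m : ℕ) : vandermonde N * ∑ i, (ddSum i)^[m] (g i)
      = ((m : MvPowerSeries (Fin N) ℂ) + 1) * ∑ i, (pderiv ℂ i)^[m] (vandermonde N) * g i := by
  set φ := algebraMap (MvPowerSeries (Fin N) ℂ) (FractionRing (MvPowerSeries (Fin N) ℂ)) with hφ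
  have hinj : Function.Injective φ := IsFractionRing.injective _ _
  have : CharZero (FractionRing (MvPowerSeries (Fin N) ℂ)) :=
    charZero_of_injective_ringHom (φ.comp C).injective
  have hx : Function.Injective fun j : Fin N => φ (X j) := by
    intro a b hab
    by_contra h
    exact X_sub_X_ne_zero h (sub_eq_zero.2 (hinj hab))
  have heq : ∀ m, IsEquivariant fun i => (ddSum i)^[m] (g i) := by
    intro m
    induction m with
    | zero => exact hg
    | succ m ih => simpa only [Function.iterate_succ_apply'] using ih.ddSum
  have := sum_iterated_difference hx (fun m i => φ ((ddSum i)^[m] (g i))) (by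
    intro m i
    rw [Function.iterate_succ_apply', ddSum_apply, map_sum]
    refine sum_congr rfl fun j hj => ?_
    have hij := (ne_of_mem_erase hj).symm
    have h1 : φ (X i) - φ (X j) ≠ 0 := sub_ne_zero.2 fun h => hij (hx h)
    rw [eq_div_iff h1, ← map_sub, ← map_sub, ← map_mul, mul_comm, (heq m).mul_dd hij]) m
  apply hinj
  rw [map_mul, map_sum, this, map_mul, map_sum, map_add, map_natCast, map_one, mul_left_comm,
    mul_sum]
  congr 1
  refine sum_congr rfl fun i _ => ?_
  rw [map_mul, iterate_pderiv_vandermonde, ← hφ]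
  simp only [Function.iterate_zero, id]
  ring

end Vandermonde

end SymSeries

/-! ### Differential operators conjugated by the Vandermonde product and their eigenfunctions. -/

namespace SymSeries

open Finset MvPowerSeries

variable {N : ℕ}

/-- The value at `1 + X i` of a one-variable polynomial. -/
noncomputable def atVar (i : Fin N) : Polynomial ℂ →ₐ[ℂ] MvPowerSeries (Fin N) ℂ :=
  Polynomial.aeval (1 + X i)

theorem rename_atVar (e : Equiv.Perm (Fin N)) (i : Fin N) (p : Polynomial ℂ) :
    rename e (atVar i p) = atVar (e i) p := by
  rw [atVar, atVar, ← Polynomial.aeval_algHom_apply]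
  simp

theorem pderiv_atVar (i : Fin N) (p : Polynomial ℂ) :
    pderiv ℂ i (atVar i p) = atVar i p.derivative := by
  rw [atVar, Derivation.map_aeval]
  simp

theorem pderiv_atVar_of_ne {i l : Fin N} (h : l ≠ i) (p : Polynomial ℂ) :
    pderiv ℂ i (atVar l p) = 0 := by
  rw [atVar, Derivation.map_aeval]
  simp [pderiv_X_of_ne h]

/-- The differential operator `∑ j ≤ n, q j (1 + X i) ∂_i ^ j`. -/
noncomputable def diffOp (q : ℕ → Polynomial ℂ) (n : ℕ) (i : Fin N) (g : MvPowerSeries (Fin N) ℂ) :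
    MvPowerSeries (Fin N) ℂ :=
  ∑ j ∈ range (n + 1), atVar i (q j) * (pderiv ℂ i)^[j] g

/-- The operator on symmetric series that is conjugate to `∑ i, diffOp q n i` by the Vandermonde
product, with `∂_i` replaced by `D i`. -/
noncomputable def radialOp (D : Fin N → MvPowerSeries (Fin N) ℂ → MvPowerSeries (Fin N) ℂ)
    (q : ℕ → Polynomial ℂ) (n : ℕ) (f : MvPowerSeries (Fin N) ℂ) : MvPowerSeries (Fin N) ℂ :=
  ∑ j ∈ range (n + 1), ∑ m ∈ range (j + 1), ((j.choose m : ℂ) / (m + 1)) •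
    ∑ i, (ddSum i)^[m] (atVar i (q j) * (D i)^[j - m] f)

theorem isEquivariant_atVar_mul_pderiv {f : MvPowerSeries (Fin N) ℂ} (hf : IsSymm f)
    (p : Polynomial ℂ) (k : ℕ) :
    IsEquivariant fun i => atVar i p * (pderiv ℂ i)^[k] f := by
  intro e i
  have h : ∀ k, rename e ((pderiv ℂ i)^[k] f) = (pderiv ℂ (e i))^[k] f := by
    intro k
    induction k with
    | zero => exact hf e
    | succ k ih => rw [Function.iterate_succ_apply', pderiv_rename, ih,
        Function.iterate_succ_apply']
  simp only [map_mul, rename_atVar, h]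

/-- The Leibniz rule for ∂_i^j (V f) produces ∂_i^m V times an equivariant family.
`vandermonde_mul_sum_ddSum` replaces this by iterated divided differences, which explains the weight
1/(m + 1) in `radialOp`. -/
theorem vandermonde_mul_radialOp (q : ℕ → Polynomial ℂ) (n : ℕ) {f : MvPowerSeries (Fin N) ℂ}
    (hf : IsSymm f) : vandermonde N * radialOp (fun i => pderiv ℂ i) q n f
      = ∑ i, diffOp q n i (vandermonde N * f) := by
  simp only [radialOp, diffOp]
  rw [sum_comm, mul_sum]
  refine sum_congr rfl fun j _ => ?_
  simp only [iterate_leibniz, mul_sum]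
  rw [sum_comm]
  refine sum_congr rfl fun m _ => ?_
  rw [mul_smul_comm, vandermonde_mul_sum_ddSum (isEquivariant_atVar_mul_pderiv hf (q j) (j - m)),
    ← smul_mul_assoc]
  have h0 : ((m : ℂ) + 1) ≠ 0 := by exact_mod_cast Nat.succ_ne_zero m
  have h1 : ((j.choose m : ℂ) / (m + 1)) • ((m : MvPowerSeries (Fin N) ℂ) + 1)
      = (j.choose m : MvPowerSeries (Fin N) ℂ) := by
    have : (m : MvPowerSeries (Fin N) ℂ) + 1 = C ((m : ℂ) + 1) := by simp
    rw [this, smul_eq_C_mul, ← map_mul, div_mul_cancel₀ _ h0, map_natCast]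
  rw [h1, mul_sum]
  exact sum_congr rfl fun i _ => by ring

/-- The operator `(z² - 1) ∂² + (a z + b) ∂ + c` in the variable `z = 1 + X i`. -/
noncomputable def hypOp (a b c : ℂ) (i : Fin N) (g : MvPowerSeries (Fin N) ℂ) :
    MvPowerSeries (Fin N) ℂ :=
  atVar i (Polynomial.X ^ 2 - 1) * pderiv ℂ i (pderiv ℂ i g)
    + atVar i (Polynomial.C a * Polynomial.X + Polynomial.C b) * pderiv ℂ i g + c • g

theorem pderiv_diffOp (q : ℕ → Polynomial ℂ) (n : ℕ) : ∃ q' : ℕ → Polynomial ℂ,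
    q' (n + 1) = q n ∧ ∀ (N : ℕ) (i : Fin N) (g : MvPowerSeries (Fin N) ℂ),
      pderiv ℂ i (diffOp q n i g) = diffOp q' (n + 1) i g := by
  refine ⟨fun j => (if j ≤ n then (q j).derivative else 0) + (if j = 0 then 0 else q (j - 1)),
    by simp, fun N i g => ?_⟩
  simp only [diffOp, map_sum, map_add, add_mul, sum_add_distrib]
  rw [sum_range_succ _ (n + 1), sum_range_succ' (fun j => atVar i (if j = 0 then 0 else q (j - 1))
    * _) (n + 1)]
  have h1 : ∀ j ∈ range (n + 1), pderiv ℂ i (atVar i (q j) * (pderiv ℂ i)^[j] g)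
      = atVar i (if j ≤ n then (q j).derivative else 0) * (pderiv ℂ i)^[j] g
        + atVar i (if j + 1 = 0 then 0 else q (j + 1 - 1)) * (pderiv ℂ i)^[j + 1] g := by
    intro j hj
    rw [if_pos (Nat.lt_succ_iff.1 (mem_range.1 hj)), Derivation.leibniz, pderiv_atVar,
      Function.iterate_succ_apply']
    simp; ring
  rw [sum_congr rfl h1, sum_add_distrib]
  simp

theorem atVar_mul_diffOp (p : Polynomial ℂ) (q : ℕ → Polynomial ℂ) (n : ℕ) (i : Fin N)
    (g : MvPowerSeries (Fin N) ℂ) :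
    atVar i p * diffOp q n i g = diffOp (fun j => p * q j) n i g := by
  simp only [diffOp, mul_sum, map_mul, mul_assoc]

theorem diffOp_add_of_lt (q q' : ℕ → Polynomial ℂ) {n n' : ℕ} (h : n' < n) :
    ∃ q'' : ℕ → Polynomial ℂ, q'' n = q n ∧
      ∀ (N : ℕ) (i : Fin N) (g : MvPowerSeries (Fin N) ℂ),
        diffOp q n i g + diffOp q' n' i g = diffOp q'' n i g := by
  refine ⟨fun j => q j + if j ≤ n' then q' j else 0, by simp [h], fun N i g => ?_⟩
  simp only [diffOp, map_add, add_mul, sum_add_distrib]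
  congr 1
  have hs : range (n' + 1) ⊆ range (n + 1) := range_subset_range.2 (by omega)
  rw [← sum_subset hs]
  · refine sum_congr rfl fun j hj => ?_
    rw [if_pos (Nat.lt_succ_iff.1 (mem_range.1 hj))]
  · intro j _ hj
    rw [if_neg (by simpa using hj)]; simp

/-- The coefficients are independent of N, and only the leading one matters in the limit. The
numbers a, b, c affect lower orders alone, which is why the limit formula is the same for all three
series. -/
theorem exists_iterate_hypOp (a b c : ℂ) (k : ℕ) : ∃ q : ℕ → Polynomial ℂ,
    q (2 * k) = (Polynomial.X ^ 2 - 1) ^ k ∧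
      ∀ (N : ℕ) (i : Fin N) (g : MvPowerSeries (Fin N) ℂ),
        (hypOp a b c i)^[k] g = diffOp q (2 * k) i g := by
  induction k with
  | zero => exact ⟨fun _ => 1, by simp, fun N i g => by simp [diffOp]⟩
  | succ k ih =>
    obtain ⟨q, hq, hg⟩ := ih
    obtain ⟨q1, h1, e1⟩ := pderiv_diffOp q (2 * k)
    obtain ⟨q2, h2, e2⟩ := pderiv_diffOp q1 (2 * k + 1)
    obtain ⟨q3, h3, e3⟩ := diffOp_add_of_lt
      (fun j => (Polynomial.C a * Polynomial.X + Polynomial.C b) * q1 j)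
      (fun j => Polynomial.C c * q j) (show 2 * k < 2 * k + 1 by omega)
    obtain ⟨q4, h4, e4⟩ := diffOp_add_of_lt (fun j => (Polynomial.X ^ 2 - 1) * q2 j) q3
      (show 2 * k + 1 < 2 * k + 1 + 1 by omega)
    refine ⟨q4, ?_, fun N i g => ?_⟩
    · rw [show 2 * (k + 1) = 2 * k + 1 + 1 by ring, h4, h2, h1, hq]; ring
    · rw [Function.iterate_succ_apply', hg, hypOp, e1, e2, atVar_mul_diffOp, atVar_mul_diffOp,
        show 2 * (k + 1) = 2 * k + 1 + 1 by ring, ← e4, ← e3, ← atVar_mul_diffOp (Polynomial.C c),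
        add_assoc]
      congr 2
      rw [atVar, Polynomial.aeval_C, smul_eq_C_mul]; rfl

theorem hypOp_const_mul {a b c : ℂ} {i : Fin N} {r : MvPowerSeries (Fin N) ℂ}
    (hr : pderiv ℂ i r = 0) (g : MvPowerSeries (Fin N) ℂ) :
    hypOp a b c i (r * g) = r * hypOp a b c i g := by
  have key : ∀ g, pderiv ℂ i (r * g) = r * pderiv ℂ i g := fun g => by
    rw [Derivation.leibniz, hr]; simp
  simp only [hypOp, key, smul_eq_C_mul]
  ring

theorem hypOp_add (a b c : ℂ) (i : Fin N) (g h : MvPowerSeries (Fin N) ℂ) :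
    hypOp a b c i (g + h) = hypOp a b c i g + hypOp a b c i h := by
  simp only [hypOp, map_add, smul_add]; ring

theorem hypOp_sum (a b c : ℂ) (i : Fin N) {ι : Type*} (s : Finset ι)
    (g : ι → MvPowerSeries (Fin N) ℂ) :
    hypOp a b c i (∑ x ∈ s, g x) = ∑ x ∈ s, hypOp a b c i (g x) := by
  classical
  induction s using Finset.induction_on with
  | empty => simp [hypOp]
  | insert x s hx ih => rw [sum_insert hx, sum_insert hx, hypOp_add, ih]

theorem hypOp_smul (a b c t : ℂ) (i : Fin N) (g : MvPowerSeries (Fin N) ℂ) :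
    hypOp a b c i (t • g) = t • hypOp a b c i g := by
  rw [smul_eq_C_mul, smul_eq_C_mul, hypOp_const_mul (by simp)]

/-- Exactly one factor depends on X i, the one with index `t.symm i`. The others are constants for
the operator. -/
theorem iterate_hypOp_prod {a b c : ℂ} (P : Fin N → Polynomial ℂ) (e : Fin N → ℂ)
    (hP : ∀ j, (Polynomial.X ^ 2 - 1) * (P j).derivative.derivative
      + (Polynomial.C a * Polynomial.X + Polynomial.C b) * (P j).derivative
      + Polynomial.C c * P j = Polynomial.C (e j) * P j)
    (i : Fin N) (t : Equiv.Perm (Fin N)) (k : ℕ) :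
    (hypOp a b c i)^[k] (∏ l, atVar (t l) (P l))
      = e (t.symm i) ^ k • ∏ l, atVar (t l) (P l) := by
  have h1 : hypOp a b c i (∏ l, atVar (t l) (P l)) = e (t.symm i) • ∏ l, atVar (t l) (P l) := by
    rw [← prod_erase_mul _ _ (mem_univ (t.symm i)), Equiv.apply_symm_apply, hypOp_const_mul,
      ← mul_smul_comm]
    · congr 1
      have := congrArg (atVar i) (hP (t.symm i))
      simp only [map_add, map_mul] at this
      rw [hypOp, pderiv_atVar, pderiv_atVar, map_add, map_mul]
      have hC : ∀ r : ℂ, atVar i (Polynomial.C r) = C r := fun r => Polynomial.aeval_C _ _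
      rw [hC, hC, hC, hC] at this
      rw [hC, hC, smul_eq_C_mul, smul_eq_C_mul]
      exact this
    · refine derivation_prod_eq_zero _ _ _ fun l hl => pderiv_atVar_of_ne ?_ _
      intro h
      exact ne_of_mem_erase hl (by rw [← h]; simp)
  induction k with
  | zero => simp
  | succ k ih =>
    rw [Function.iterate_succ_apply', ih, hypOp_smul, h1, smul_smul, pow_succ]

/-- Determinants of eigenfunctions are eigenfunctions of the power sums of `hypOp`. -/
theorem sum_iterate_hypOp_det {a b c : ℂ} (P : Fin N → Polynomial ℂ) (e : Fin N → ℂ)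
    (hP : ∀ j, (Polynomial.X ^ 2 - 1) * (P j).derivative.derivative
      + (Polynomial.C a * Polynomial.X + Polynomial.C b) * (P j).derivative
      + Polynomial.C c * P j = Polynomial.C (e j) * P j) (k : ℕ) :
    ∑ i, (hypOp a b c i)^[k] (Matrix.of fun i j => atVar i (P j)).det
      = (∑ j, e j ^ k) • (Matrix.of fun i j => atVar i (P j)).det := by
  have hit : ∀ i (s : Finset (Equiv.Perm (Fin N))) (w : Equiv.Perm (Fin N) → ℂ)
      (g : Equiv.Perm (Fin N) → MvPowerSeries (Fin N) ℂ),
      (hypOp a b c i)^[k] (∑ t ∈ s, w t • g t) = ∑ t ∈ s, w t • (hypOp a b c i)^[k] (g t) := by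
    intro i s w g
    induction k with
    | zero => rfl
    | succ k ih =>
      rw [Function.iterate_succ_apply', ih, hypOp_sum]
      simp only [hypOp_smul, Function.iterate_succ_apply']
  have hdet : (Matrix.of fun i j => atVar i (P j)).det = ∑ t : Equiv.Perm (Fin N),
      (((Equiv.Perm.sign t : ℤ) : ℂ)) • ∏ l, atVar (t l) (P l) := by
    rw [Matrix.det_apply']
    refine sum_congr rfl fun t _ => ?_
    rw [smul_eq_C_mul, map_intCast]; rfl
  rw [hdet]
  simp only [hit, iterate_hypOp_prod P e hP]
  rw [sum_comm, smul_sum]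
  refine sum_congr rfl fun t _ => ?_
  rw [← smul_sum, ← sum_smul, Equiv.sum_comp t.symm fun j => e j ^ k, smul_comm]

/-- After multiplication by V the operator is the sum of the H_i^k acting on an alternant. Each
product in the expansion of the determinant is an eigenvector of this sum, with an eigenvalue that
does not depend on the permutation. -/
theorem radialOp_eigen {a b c : ℂ} {q : ℕ → Polynomial ℂ} {k : ℕ}
    (hq : ∀ (N : ℕ) (i : Fin N) (g : MvPowerSeries (Fin N) ℂ),
        (hypOp a b c i)^[k] g = diffOp q (2 * k) i g)
    (P : Fin N → Polynomial ℂ) (e : Fin N → ℂ)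
    (hP : ∀ j, (Polynomial.X ^ 2 - 1) * (P j).derivative.derivative
      + (Polynomial.C a * Polynomial.X + Polynomial.C b) * (P j).derivative
      + Polynomial.C c * P j = Polynomial.C (e j) * P j)
    {f : MvPowerSeries (Fin N) ℂ} (hf : IsSymm f) {s : ℂ}
    (hV : vandermonde N * f = s • (Matrix.of fun i j => atVar i (P j)).det) :
    radialOp (fun i => pderiv ℂ i) q (2 * k) f = (∑ j, e j ^ k) • f := by
  apply mul_left_cancel₀ (vandermonde_ne_zero (N := N))
  rw [vandermonde_mul_radialOp q _ hf, mul_smul_comm, hV]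
  simp only [← hq]
  have hit : ∀ i (g : MvPowerSeries (Fin N) ℂ),
      (hypOp a b c i)^[k] (s • g) = s • (hypOp a b c i)^[k] g := by
    intro i g
    clear hV hq
    induction k with
    | zero => rfl
    | succ k ih => rw [Function.iterate_succ_apply', ih, hypOp_smul, Function.iterate_succ_apply']
  simp only [hit]
  rw [← smul_sum, sum_iterate_hypOp_det P e hP, smul_comm]

/-- Conjugation by a symmetric F shifts each derivative by the logarithmic derivative of F and
leaves the divided differences unchanged. -/
theorem radialOp_symm_mul {F : MvPowerSeries (Fin N) ℂ} (hF : IsSymm F)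
    {ℓ : Fin N → MvPowerSeries (Fin N) ℂ} (hℓ : ∀ i, pderiv ℂ i F = F * ℓ i)
    (q : ℕ → Polynomial ℂ) (n : ℕ) (g : MvPowerSeries (Fin N) ℂ) :
    radialOp (fun i => pderiv ℂ i) q n (F * g)
      = F * radialOp (fun i g => pderiv ℂ i g + ℓ i * g) q n g := by
  have h1 : ∀ i k, (pderiv ℂ i)^[k] (F * g) = F * (fun g => pderiv ℂ i g + ℓ i * g)^[k] g := by
    intro i k
    induction k with
    | zero => rfl
    | succ k ih =>
      rw [Function.iterate_succ_apply', ih, Derivation.leibniz, hℓ, Function.iterate_succ_apply']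
      simp only [smul_eq_mul]; ring
  have h2 : ∀ i m g, (ddSum i)^[m] (F * g) = F * (ddSum i)^[m] g := by
    intro i m g
    induction m with
    | zero => rfl
    | succ m ih => rw [Function.iterate_succ_apply', ih, ddSum_symm_mul i hF,
        Function.iterate_succ_apply']
  simp only [radialOp, h1, mul_left_comm _ F, h2, mul_sum]
  refine sum_congr rfl fun j _ => sum_congr rfl fun m _ => ?_
  rw [mul_smul_comm, mul_sum]

end SymSeries

/-! ### Coefficientwise asymptotics as the number of variables grows. -/

namespace SymSeries

open Finset MvPowerSeries

section Iota

variable {N : ℕ}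

/-- The one-variable power series `h` in the variable `X i`. -/
noncomputable def iota (i : Fin N) : PowerSeries ℂ →ₐ[ℂ] MvPowerSeries (Fin N) ℂ :=
  rename (fun _ : Unit => i)

theorem coeff_iota_single (i : Fin N) (h : PowerSeries ℂ) (n : ℕ) :
    coeff (Finsupp.single i n) (iota i h) = PowerSeries.coeff n h := by
  have := coeff_embDomain_rename (R := ℂ) (⟨fun _ : Unit => i, fun _ _ _ => rfl⟩ : Unit ↪ Fin N) h
    (Finsupp.single () n)
  rw [Finsupp.embDomain_single] at this
  exact this

theorem coeff_iota_eq_zero {i l : Fin N} (hl : l ≠ i) (h : PowerSeries ℂ) {α : Fin N →₀ ℕ}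
    (hα : α l ≠ 0) : coeff α (iota i h) = 0 := by
  apply coeff_rename_eq_zero
  rintro ⟨β, rfl⟩
  apply hα
  rw [Finsupp.mapDomain_of_notMem_range]
  rintro ⟨_, h⟩; exact hl h.symm

theorem eq_single_of_forall {i : Fin N} {α : Fin N →₀ ℕ} (h : ∀ l, l ≠ i → α l = 0) :
    α = Finsupp.single i (α i) := by
  ext l
  rw [Finsupp.single_apply]
  split_ifs with hl
  · rw [hl]
  · exact h l (Ne.symm hl)

theorem iota_X (i : Fin N) : iota i PowerSeries.X = X i := by
  rw [iota, PowerSeries.X, rename_X]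

theorem atVar_eq_iota (i : Fin N) (p : Polynomial ℂ) :
    atVar i p = iota i (Polynomial.aeval (1 + PowerSeries.X) p) := by
  rw [atVar, ← Polynomial.aeval_algHom_apply, map_add, map_one, iota_X]

theorem degree_eq (α : Fin N →₀ ℕ) : α.degree = ∑ l, α l := Finsupp.degree_eq_sum α

theorem degree_upd {i j : Fin N} (hij : i ≠ j) (α : Fin N →₀ ℕ) {p q : ℕ}
    (h : p + q = α i + α j + 1) : (upd α i j p q).degree = α.degree + 1 := by
  have hj : j ∈ univ.erase i := mem_erase.2 ⟨hij.symm, mem_univ _⟩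
  have key : ∀ β : Fin N →₀ ℕ, β.degree = β i + (β j + ∑ l ∈ (univ.erase i).erase j, β l) := by
    intro β
    rw [degree_eq, ← add_sum_erase _ _ (mem_univ i), ← add_sum_erase _ _ hj]
  rw [key, key α]
  have : ∑ l ∈ (univ.erase i).erase j, upd α i j p q l = ∑ l ∈ (univ.erase i).erase j, α l := by
    refine sum_congr rfl fun l hl => ?_
    have h1 := ne_of_mem_erase hl
    have h2 := ne_of_mem_erase (mem_of_mem_erase hl)
    rw [upd_apply, if_neg h1, if_neg h2]
  rw [this]
  simp only [upd_apply, if_neg hij, if_true]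
  omega

/-- The bound does not involve N; a divided difference only costs one degree. The same uniformity is
essential in `norm_coeff_mul_le`. -/
theorem norm_coeff_dd_le {i j : Fin N} (hij : i ≠ j) (g : MvPowerSeries (Fin N) ℂ) {d : ℕ} {c : ℝ}
    (hg : ∀ α : Fin N →₀ ℕ, α.degree ≤ d + 1 → ‖coeff α g‖ ≤ c) {α : Fin N →₀ ℕ}
    (hα : α.degree ≤ d) : ‖coeff α (dd i j g)‖ ≤ (d + 1) * (2 * c) := by
  have hc : 0 ≤ c := (norm_nonneg _).trans (hg 0 (by simp))
  have hj : α j ≤ d := by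
    refine le_trans ?_ hα
    rw [degree_eq]; exact single_le_sum (f := fun l => α l) (fun _ _ => Nat.zero_le _) (mem_univ j)
  rw [coeff_dd]
  refine (norm_sum_le _ _).trans ((sum_le_card_nsmul _ _ (2 * c) fun q hq => ?_).trans ?_)
  · have hq' : q ≤ α j := Nat.lt_succ_iff.1 (mem_range.1 hq)
    refine (norm_sub_le _ _).trans ?_
    rw [two_mul]
    refine add_le_add (hg _ ?_) (hg _ ?_) <;> rw [degree_upd hij] <;> omega
  · rw [card_range, nsmul_eq_mul]
    gcongr
    exact_mod_cast Nat.succ_le_succ hj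

/-- A multi-index of degree at most d has ∏ (α l + 1) ≤ 2^d lower multi-indices, however many
variables there are. -/
theorem norm_coeff_mul_le (f g : MvPowerSeries (Fin N) ℂ) {d : ℕ} {a b : ℝ}
    (hf : ∀ α : Fin N →₀ ℕ, α.degree ≤ d → ‖coeff α f‖ ≤ a)
    (hg : ∀ α : Fin N →₀ ℕ, α.degree ≤ d → ‖coeff α g‖ ≤ b) {α : Fin N →₀ ℕ}
    (hα : α.degree ≤ d) : ‖coeff α (f * g)‖ ≤ 2 ^ d * (a * b) := by
  have ha : 0 ≤ a := (norm_nonneg _).trans (hf 0 (by simp))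
  have hb : 0 ≤ b := (norm_nonneg _).trans (hg 0 (by simp))
  rw [coeff_mul]
  refine (norm_sum_le _ _).trans ((sum_le_card_nsmul _ _ (a * b) fun p hp => ?_).trans ?_)
  · have := mem_antidiagonal.1 hp
    have hd : p.1.degree + p.2.degree = α.degree := by rw [← this, map_add]
    rw [norm_mul]
    gcongr
    · exact hf _ (by omega)
    · exact hg _ (by omega)
  · rw [nsmul_eq_mul]
    gcongr
    have h1 : #(antidiagonal α) ≤ #(Iic α) := by
      refine card_le_card_of_injOn Prod.fst (fun p hp => ?_) (fun p hp q hq h => ?_)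
      · have := mem_antidiagonal.1 hp
        rw [coe_Iic, Set.mem_Iic, ← this]; exact le_self_add
      · have h1 := mem_antidiagonal.1 hp
        have h2 := mem_antidiagonal.1 hq
        refine Prod.ext h ?_
        rw [← h1, h] at h2
        exact (add_left_cancel h2).symm
    have h2 : #(Iic α) ≤ 2 ^ d := by
      rw [Finsupp.card_Iic]
      refine le_trans ?_ (Nat.pow_le_pow_right (by norm_num) hα)
      rw [Finsupp.degree_apply, ← prod_pow_eq_pow_sum]
      refine prod_le_prod' fun l _ => ?_
      rw [Nat.card_Iic]; exact Nat.lt_two_pow_self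
    exact_mod_cast h1.trans h2

end Iota

/-- Families of power series in `N` variables with a distinguished variable. -/
abbrev Fam := ∀ N : ℕ, Fin N → MvPowerSeries (Fin N) ℂ

/-- All coefficients of bounded degree tend to zero uniformly. -/
def Null (g : Fam) : Prop := ∀ d : ℕ, ∀ ε : ℝ, 0 < ε → ∀ᶠ N in atTop, ∀ i, ∀ α : Fin N →₀ ℕ,
  α.degree ≤ d → ‖coeff α (g N i)‖ ≤ ε

/-- All coefficients of bounded degree are uniformly bounded. -/
def Bdd (g : Fam) : Prop := ∀ d : ℕ, ∃ c : ℝ, ∀ᶠ N in atTop, ∀ i, ∀ α : Fin N →₀ ℕ,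
  α.degree ≤ d → ‖coeff α (g N i)‖ ≤ c

theorem Null.bdd {g : Fam} (hg : Null g) : Bdd g := fun d => ⟨1, hg d 1 one_pos⟩

theorem Null.add {g h : Fam} (hg : Null g) (hh : Null h) : Null fun N i => g N i + h N i := by
  intro d ε hε
  filter_upwards [hg d (ε / 2) (half_pos hε), hh d (ε / 2) (half_pos hε)] with N h1 h2 i α hα
  rw [map_add]
  exact (norm_add_le _ _).trans (by linarith [h1 i α hα, h2 i α hα])

theorem Bdd.add {g h : Fam} (hg : Bdd g) (hh : Bdd h) : Bdd fun N i => g N i + h N i := by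
  intro d
  obtain ⟨a, ha⟩ := hg d
  obtain ⟨b, hb⟩ := hh d
  refine ⟨a + b, ?_⟩
  filter_upwards [ha, hb] with N h1 h2 i α hα
  rw [map_add]
  exact (norm_add_le _ _).trans (add_le_add (h1 i α hα) (h2 i α hα))

theorem Null.mul {g h : Fam} (hg : Null g) (hh : Bdd h) : Null fun N i => g N i * h N i := by
  intro d ε hε
  obtain ⟨b, hb⟩ := hh d
  have hb' : 0 < |b| + 1 := by positivity
  have he : 0 < ε / (2 ^ d * (|b| + 1)) := by positivity
  filter_upwards [hg d _ he, hb] with N h1 h2 i α hα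
  have h2' : ∀ α : Fin N →₀ ℕ, α.degree ≤ d → ‖coeff α (h N i)‖ ≤ |b| + 1 := fun α hα =>
    (h2 i α hα).trans (by linarith [le_abs_self b])
  refine (norm_coeff_mul_le _ _ (h1 i) h2' hα).trans (le_of_eq ?_)
  field_simp

theorem Null.smul_of_bounded {g : Fam} (hg : Null g) {c : ℕ → ℂ} {b : ℝ}
    (hc : ∀ᶠ N in atTop, ‖c N‖ ≤ b) : Null fun N i => c N • g N i := by
  intro d ε hε
  have hb' : 0 < |b| + 1 := by positivity
  filter_upwards [hg d (ε / (|b| + 1)) (by positivity), hc] with N h1 h2 i α hα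
  rw [map_smul, smul_eq_mul, norm_mul]
  calc ‖c N‖ * ‖coeff α (g N i)‖ ≤ (|b| + 1) * (ε / (|b| + 1)) := by
        gcongr
        · exact h2.trans (by linarith [le_abs_self b])
        · exact h1 i α hα
    _ = ε := by field_simp

theorem Null.const_smul {g : Fam} (hg : Null g) (c : ℂ) : Null fun N i => c • g N i :=
  hg.smul_of_bounded (Eventually.of_forall fun _ => le_refl ‖c‖)

theorem Bdd.null_smul {g : Fam} (hg : Bdd g) {c : ℕ → ℂ} (hc : Tendsto c atTop (𝓝 0)) :
    Null fun N i => c N • g N i := by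
  intro d ε hε
  obtain ⟨b, hb⟩ := hg d
  have hb' : 0 < |b| + 1 := by positivity
  have hc' : ∀ᶠ N in atTop, ‖c N‖ < ε / (|b| + 1) := by
    have := (tendsto_order.1 (tendsto_norm_zero.comp hc)).2 (ε / (|b| + 1)) (by positivity)
    exact this
  filter_upwards [hb, hc'] with N h1 h2 i α hα
  rw [map_smul, smul_eq_mul, norm_mul]
  calc ‖c N‖ * ‖coeff α (g N i)‖ ≤ (ε / (|b| + 1)) * (|b| + 1) := by
        gcongr
        exact (h1 i α hα).trans (by linarith [le_abs_self b])
    _ = ε := by field_simp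

theorem Null.congr {g h : Fam} (hg : Null g) (hgh : ∀ᶠ N in atTop, ∀ i, h N i = g N i) :
    Null h := by
  intro d ε hε
  filter_upwards [hg d ε hε, hgh] with N h1 h2 i α hα
  rw [h2]; exact h1 i α hα

theorem null_zero : Null fun _ _ => 0 := by
  intro d ε hε
  exact Eventually.of_forall fun N i α _ => by simpa using hε.le

theorem Null.sum {ι : Type*} (s : Finset ι) {g : ι → Fam} (hg : ∀ x ∈ s, Null (g x)) :
    Null fun N i => ∑ x ∈ s, g x N i := by
  classical
  induction s using Finset.induction_on with
  | empty => simpa using null_zero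
  | insert x s hx ih =>
    simp only [sum_insert hx]
    exact (hg x (mem_insert_self _ _)).add (ih fun y hy => hg y (mem_insert_of_mem hy))

theorem Bdd.pderiv {g : Fam} (hg : Bdd g) : Bdd fun N i => pderiv ℂ i (g N i) := by
  intro d
  obtain ⟨b, hb⟩ := hg (d + 1)
  refine ⟨|b| * (d + 1), ?_⟩
  filter_upwards [hb] with N h1 i α hα
  rw [coeff_pderiv, norm_mul]
  have h2 : α i ≤ d := by
    refine le_trans ?_ hα
    rw [degree_eq]; exact single_le_sum (f := fun l => α l) (fun _ _ => Nat.zero_le _) (mem_univ i)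
  gcongr
  · refine (h1 i _ ?_).trans (le_abs_self b)
    rw [map_add, Finsupp.degree_single]; omega
  · have : ‖((α i : ℂ) + 1)‖ = (α i : ℝ) + 1 := by
      rw [← Nat.cast_succ, Complex.norm_natCast]; push_cast; ring
    rw [this]; gcongr

theorem Null.ddSum {g : Fam} (hg : Null g) : Null fun N i => (N : ℂ)⁻¹ • ddSum i (g N i) := by
  intro d ε hε
  filter_upwards [hg (d + 1) (ε / (2 * (d + 1))) (by positivity), eventually_gt_atTop 0]
    with N h1 hN i α hα
  have hN' : (0 : ℝ) < N := by exact_mod_cast hN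
  rw [map_smul, smul_eq_mul, norm_mul, norm_inv, Complex.norm_natCast, ddSum_apply, map_sum]
  have h2 : ‖∑ j ∈ univ.erase i, coeff α (dd i j (g N i))‖ ≤ N * ε := by
    refine (norm_sum_le _ _).trans ((sum_le_card_nsmul _ _ ε fun j hj => ?_).trans ?_)
    · refine (norm_coeff_dd_le (ne_of_mem_erase hj).symm _ (h1 i) hα).trans (le_of_eq ?_)
      field_simp
    · rw [nsmul_eq_mul]
      gcongr
      exact (card_erase_le).trans (by simp)
  calc (N : ℝ)⁻¹ * _ ≤ (N : ℝ)⁻¹ * (N * ε) := by gcongr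
    _ = ε := by field_simp

theorem Null.average {g : Fam} (hg : Null g) : Null fun N _ => (N : ℂ)⁻¹ • ∑ l, g N l := by
  intro d ε hε
  filter_upwards [hg d ε hε, eventually_gt_atTop 0] with N h1 hN i α hα
  have hN' : (0 : ℝ) < N := by exact_mod_cast hN
  rw [map_smul, smul_eq_mul, norm_mul, norm_inv, Complex.norm_natCast, map_sum]
  have h2 : ‖∑ l, coeff α (g N l)‖ ≤ N * ε := by
    refine (norm_sum_le _ _).trans ((sum_le_card_nsmul _ _ ε fun j _ => h1 j α hα).trans ?_)
    simp
  calc (N : ℝ)⁻¹ * _ ≤ (N : ℝ)⁻¹ * (N * ε) := by gcongr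
    _ = ε := by field_simp

/-- Convergence of a family to a one-variable power series in the distinguished variable. -/
def Conv (g : Fam) (h : PowerSeries ℂ) : Prop := Null fun N i => g N i - iota i h

theorem norm_coeff_iota_le {N : ℕ} (i : Fin N) (h : PowerSeries ℂ) {d : ℕ} {α : Fin N →₀ ℕ}
    (hα : α.degree ≤ d) :
    ‖coeff α (iota i h)‖ ≤ ∑ n ∈ range (d + 1), ‖PowerSeries.coeff n h‖ := by
  by_cases hl : ∀ l, l ≠ i → α l = 0
  · rw [eq_single_of_forall hl, coeff_iota_single]
    have : α i ≤ d := by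
      refine le_trans ?_ hα
      rw [degree_eq]
      exact single_le_sum (f := fun l => α l) (fun _ _ => Nat.zero_le _) (mem_univ i)
    exact single_le_sum (f := fun n => ‖PowerSeries.coeff n h‖) (fun _ _ => norm_nonneg _)
      (mem_range.2 (by omega))
  · push Not at hl
    obtain ⟨l, h1, h2⟩ := hl
    rw [coeff_iota_eq_zero h1 h h2, norm_zero]
    exact sum_nonneg fun _ _ => norm_nonneg _

theorem bdd_iota (h : PowerSeries ℂ) : Bdd fun _ i => iota i h := fun d =>
  ⟨∑ n ∈ range (d + 1), ‖PowerSeries.coeff n h‖,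
    Eventually.of_forall fun _ i _ hα => norm_coeff_iota_le i h hα⟩

theorem Conv.bdd {g : Fam} {h : PowerSeries ℂ} (hg : Conv g h) : Bdd g := by
  have := (Null.bdd hg).add (bdd_iota h)
  simpa using this

theorem conv_iota (h : PowerSeries ℂ) : Conv (fun _ i => iota i h) h := by
  simpa [Conv] using null_zero

theorem Conv.add_null {g r : Fam} {h : PowerSeries ℂ} (hg : Conv g h) (hr : Null r) :
    Conv (fun N i => g N i + r N i) h := by
  have := Null.add hg hr
  refine this.congr (Eventually.of_forall fun N i => ?_)
  ring

theorem Conv.mul {g g' : Fam} {h h' : PowerSeries ℂ} (hg : Conv g h) (hg' : Conv g' h') :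
    Conv (fun N i => g N i * g' N i) (h * h') := by
  have h1 := (Null.mul hg hg'.bdd).add (Null.mul hg' (bdd_iota h))
  refine h1.congr (Eventually.of_forall fun N i => ?_)
  rw [map_mul]; ring

/-- The power series `(h - h 0) / X`. -/
noncomputable def shift (h : PowerSeries ℂ) : PowerSeries ℂ :=
  PowerSeries.mk fun n => PowerSeries.coeff (n + 1) h

theorem coeff_dd_iota {N : ℕ} {i j : Fin N} (hij : i ≠ j) (h : PowerSeries ℂ) (α : Fin N →₀ ℕ) :
    coeff α (dd i j (iota i h)) = coeff (upd α i j (α i + α j + 1) 0) (iota i h) := by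
  rw [coeff_dd, sum_eq_single_of_mem 0 (by simp)]
  · rw [coeff_iota_eq_zero hij.symm h (α := upd α i j 0 _)]
    · simp
    · rw [upd_apply, if_pos rfl]; omega
  · intro q hq hq0
    have hq' : q ≤ α j := Nat.lt_succ_iff.1 (mem_range.1 hq)
    rw [coeff_iota_eq_zero hij.symm h, coeff_iota_eq_zero hij.symm h, sub_zero]
    · rw [upd_apply, if_pos rfl]; omega
    · rw [upd_apply, if_pos rfl]; omega

/-- If α involves only the variable i, all N - 1 divided differences contribute the same coefficient
of h, and dividing by N leaves an error of order 1/N. If α involves another variable l, only the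
difference with j = l contributes, and division by N makes it negligible. -/
theorem null_ddSum_iota (h : PowerSeries ℂ) :
    Conv (fun N i => (N : ℂ)⁻¹ • ddSum i (iota i h)) (shift h) := by
  intro d ε hε
  set b := ∑ n ∈ range (d + 1 + 1), ‖PowerSeries.coeff n h‖ with hb
  have hb0 : 0 ≤ b := sum_nonneg fun _ _ => norm_nonneg _
  have hlim : ∀ᶠ N : ℕ in atTop, b / N < ε :=
    (tendsto_order.1 (tendsto_const_div_atTop_nhds_zero_nat b)).2 ε hε
  filter_upwards [hlim, eventually_gt_atTop 0] with N h1 hN i α hα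
  have hN' : (0 : ℝ) < N := by exact_mod_cast hN
  have hNc : (N : ℂ) ≠ 0 := by exact_mod_cast hN.ne'
  refine le_trans ?_ h1.le
  rw [map_sub, map_smul, smul_eq_mul, ddSum_apply, map_sum,
    sum_congr rfl fun j hj => coeff_dd_iota (ne_of_mem_erase hj).symm h α]
  by_cases hl : ∀ l, l ≠ i → α l = 0
  · have e : ∀ j ∈ univ.erase i, coeff (upd α i j (α i + α j + 1) 0) (iota i h)
        = PowerSeries.coeff (α i + 1) h := by
      intro j hj
      have hji := ne_of_mem_erase hj
      have : upd α i j (α i + α j + 1) 0 = Finsupp.single i (α i + 1) := by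
        ext l
        rw [upd_apply, Finsupp.single_apply]
        have := hl l
        have := hl j hji
        grind
      rw [this, coeff_iota_single]
    rw [sum_congr rfl e, sum_const, card_erase_of_mem (mem_univ i), card_univ, Fintype.card_fin]
    have e2 : coeff α (iota i (shift h)) = PowerSeries.coeff (α i + 1) h := by
      conv_lhs => rw [eq_single_of_forall hl]
      rw [coeff_iota_single, shift, PowerSeries.coeff_mk]
    rw [e2, nsmul_eq_mul, Nat.cast_sub hN]
    have : (N : ℂ)⁻¹ * (((N : ℂ) - (1 : ℕ)) * PowerSeries.coeff (α i + 1) h)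
        - PowerSeries.coeff (α i + 1) h = - (PowerSeries.coeff (α i + 1) h / N) := by
      field_simp; push_cast; ring
    rw [this, norm_neg, norm_div, Complex.norm_natCast]
    gcongr
    have hi : α i ≤ d := by
      refine le_trans ?_ hα
      rw [degree_eq]
      exact single_le_sum (f := fun l => α l) (fun _ _ => Nat.zero_le _) (mem_univ i)
    exact single_le_sum (f := fun n => ‖PowerSeries.coeff n h‖) (fun _ _ => norm_nonneg _)
      (mem_range.2 (by omega))
  · push Not at hl
    obtain ⟨l, hli, hl0⟩ := hl
    rw [coeff_iota_eq_zero hli _ hl0, sub_zero, sum_eq_single_of_mem l (by simp [hli]),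
      norm_mul, norm_inv, Complex.norm_natCast, ← div_eq_inv_mul]
    · gcongr
      apply norm_coeff_iota_le
      rw [degree_upd hli.symm] <;> omega
    · intro j _ hjl
      apply coeff_iota_eq_zero hli
      rw [upd_apply, if_neg hjl.symm, if_neg hli]; exact hl0

theorem Conv.ddSum {g : Fam} {h : PowerSeries ℂ} (hg : Conv g h) :
    Conv (fun N i => (N : ℂ)⁻¹ • ddSum i (g N i)) (shift h) := by
  refine ((null_ddSum_iota h).add_null (Null.ddSum hg)).congr (Eventually.of_forall fun N i => ?_)
  simp only [← smul_add, ← map_add]; simp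

/-- In the average of the series h(X l), a nonconstant coefficient receives a contribution from at
most one l, so only the constant term survives. -/
theorem Conv.average {g : Fam} {h : PowerSeries ℂ} (hg : Conv g h) :
    Null fun N _ => (N : ℂ)⁻¹ • ∑ l, g N l - C (PowerSeries.coeff 0 h) := by
  have key : Null fun N _ => (N : ℂ)⁻¹ • ∑ l, iota l h - C (PowerSeries.coeff 0 h) := by
    intro d ε hε
    set b := ∑ n ∈ range (d + 1), ‖PowerSeries.coeff n h‖ with hb
    have hb0 : 0 ≤ b := sum_nonneg fun _ _ => norm_nonneg _
    have hlim : ∀ᶠ N : ℕ in atTop, b / N < ε :=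
      (tendsto_order.1 (tendsto_const_div_atTop_nhds_zero_nat b)).2 ε hε
    filter_upwards [hlim, eventually_gt_atTop 0] with N h1 hN i α hα
    have hN' : (0 : ℝ) < N := by exact_mod_cast hN
    have hNc : (N : ℂ) ≠ 0 := by exact_mod_cast hN.ne'
    rw [map_sub, map_smul, smul_eq_mul, map_sum, coeff_C]
    by_cases h0 : α = 0
    · have e : ∀ l ∈ univ, coeff α (iota l h) = PowerSeries.coeff 0 h := by
        intro l _
        rw [h0, ← Finsupp.single_zero l, coeff_iota_single]
      rw [sum_congr rfl e, if_pos h0]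
      simp only [sum_const, card_univ, Fintype.card_fin, nsmul_eq_mul]
      rw [← mul_assoc, inv_mul_cancel₀ hNc]
      simpa using hε.le
    · rw [if_neg h0, sub_zero]
      obtain ⟨l, hl⟩ : ∃ l, α l ≠ 0 := by
        by_contra hcon
        push Not at hcon
        exact h0 (Finsupp.ext hcon)
      rw [sum_eq_single_of_mem l (mem_univ l) fun j _ hj => coeff_iota_eq_zero hj.symm _ hl,
        norm_mul, norm_inv, Complex.norm_natCast, ← div_eq_inv_mul]
      refine le_trans ?_ h1.le
      gcongr
      exact norm_coeff_iota_le l h hα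
  refine (key.add (Null.average hg)).congr (Eventually.of_forall fun N i => ?_)
  rw [sum_sub_distrib, smul_sub]; ring

theorem coeff_iterate_shift (m n : ℕ) (h : PowerSeries ℂ) :
    PowerSeries.coeff n (shift^[m] h) = PowerSeries.coeff (n + m) h := by
  induction m generalizing n with
  | zero => rfl
  | succ m ih =>
    rw [Function.iterate_succ_apply', shift, PowerSeries.coeff_mk, ih]
    congr 2; ring

theorem iota_C {N : ℕ} (i : Fin N) (c : ℂ) : iota i (PowerSeries.C c) = C c :=
  (iota i).commutes c

/-- The derivative carries a factor N⁻¹ and disappears. In the limit each step is multiplication by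
h. -/
theorem conv_iterate {ℓ : Fam} {h : PowerSeries ℂ} (hℓ : Conv ℓ h)
    {g : ∀ N, MvPowerSeries (Fin N) ℂ} {c : ℂ} (hg : Null fun N _ => g N - C c) (k : ℕ) :
    Conv (fun N i => (fun f => (N : ℂ)⁻¹ • pderiv ℂ i f + ℓ N i * f)^[k] (g N))
      (PowerSeries.C c * h ^ k) := by
  induction k with
  | zero =>
    refine hg.congr (Eventually.of_forall fun N i => ?_)
    simp [iota_C]
  | succ k ih =>
    simp only [Function.iterate_succ_apply']
    have h1 := hℓ.mul ih
    have h2 := ih.bdd.pderiv.null_smul tendsto_inv_atTop_nhds_zero_nat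
    have := h1.add_null h2
    rw [pow_succ', mul_left_comm]
    refine Null.congr this (Eventually.of_forall fun N i => ?_)
    ring

/-- The limit of the rescaled operators `radialOp`. -/
noncomputable def limitMoment (p : Polynomial ℂ) (n : ℕ) (h : PowerSeries ℂ) : ℂ :=
  ∑ m ∈ range (n + 1), ((n.choose m : ℂ) / (m + 1)) *
    PowerSeries.coeff m (Polynomial.aeval (1 + PowerSeries.X) p * h ^ (n - m))

/-- The terms of order j in the operator have size N^(j+1), so only j = n survives division by
N^(n+1). The limit of the output is again a constant series, so the lemma can be applied to its own
output; this yields the second moment. -/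
theorem null_radialOp {ℓ : Fam} {h : PowerSeries ℂ} (hℓ : Conv ℓ h) (q : ℕ → Polynomial ℂ) (n : ℕ)
    {g : ∀ N, MvPowerSeries (Fin N) ℂ} {c : ℂ} (hg : Null fun N _ => g N - C c) :
    Null fun N _ => (((N : ℂ) ^ (n + 1))⁻¹ •
      radialOp (fun i f => pderiv ℂ i f + ((N : ℂ) • ℓ N i) * f) q n (g N))
        - C (c * limitMoment (q n) n h) := by
  have hconv : ∀ j m, Conv (fun N i => (fun f => (N : ℂ)⁻¹ • ddSum i f)^[m] (atVar i (q j) *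
      (fun f => (N : ℂ)⁻¹ • pderiv ℂ i f + ℓ N i * f)^[j - m] (g N)))
      (shift^[m] (Polynomial.aeval (1 + PowerSeries.X) (q j) *
        (PowerSeries.C c * h ^ (j - m)))) := by
    intro j m
    have h0 : Conv (fun _ i => atVar i (q j)) (Polynomial.aeval (1 + PowerSeries.X) (q j)) := by
      simpa only [atVar_eq_iota] using conv_iota (Polynomial.aeval (1 + PowerSeries.X) (q j))
    have h1 := h0.mul (conv_iterate hℓ hg (j - m))
    generalize j - m = k at h1 ⊢
    induction m with
    | zero => exact h1
    | succ m ih => simpa only [Function.iterate_succ_apply'] using ih.ddSum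
  set G : ℕ → ℕ → Fam := fun j m N _ => (N : ℂ)⁻¹ • ∑ i, (fun f => (N : ℂ)⁻¹ • ddSum i f)^[m]
      (atVar i (q j) * (fun f => (N : ℂ)⁻¹ • pderiv ℂ i f + ℓ N i * f)^[j - m] (g N)) with hG
  have havg : ∀ j m, Null fun N i => G j m N i - C (c * PowerSeries.coeff m
      (Polynomial.aeval (1 + PowerSeries.X) (q j) * h ^ (j - m))) := by
    intro j m
    have := (hconv j m).average
    rw [coeff_iterate_shift, zero_add, mul_left_comm, PowerSeries.coeff_C_mul] at this
    exact this
  have hbdd : ∀ j m, Bdd (G j m) := by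
    intro j m
    have hC : Bdd fun N (i : Fin N) => iota i (PowerSeries.C (c * PowerSeries.coeff m
      (Polynomial.aeval (1 + PowerSeries.X) (q j) * h ^ (j - m)))) := bdd_iota _
    simpa [iota_C] using (havg j m).bdd.add hC
  have hlow : Null fun N i => ∑ j ∈ range n, ∑ m ∈ range (j + 1), ((j.choose m : ℂ) / (m + 1)) •
      (((N : ℂ) ^ (n - j))⁻¹ • G j m N i) := by
    refine Null.sum _ fun j hj => Null.sum _ fun m _ => Null.const_smul ?_ _
    refine (hbdd j m).null_smul ?_
    have hj' := mem_range.1 hj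
    have : Tendsto (fun N : ℕ => ((N : ℂ)⁻¹) ^ (n - j)) atTop (𝓝 (0 ^ (n - j))) :=
      (tendsto_inv_atTop_nhds_zero_nat (𝕜 := ℂ)).pow _
    rw [zero_pow (by omega)] at this
    simpa only [inv_pow] using this
  have htop : Null fun N i => ∑ m ∈ range (n + 1), ((n.choose m : ℂ) / (m + 1)) •
      (G n m N i - C (c * PowerSeries.coeff m
        (Polynomial.aeval (1 + PowerSeries.X) (q n) * h ^ (n - m)))) :=
    Null.sum _ fun m _ => (havg n m).const_smul _
  refine (hlow.add htop).congr ?_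
  filter_upwards [eventually_gt_atTop 0] with N hN i
  have hNc : (N : ℂ) ≠ 0 := by exact_mod_cast hN.ne'
  have e1 : ∀ i k (f : MvPowerSeries (Fin N) ℂ),
      (fun f => pderiv ℂ i f + ((N : ℂ) • ℓ N i) * f)^[k] f
        = (N : ℂ) ^ k • (fun f => (N : ℂ)⁻¹ • pderiv ℂ i f + ℓ N i * f)^[k] f := by
    intro i k f
    induction k with
    | zero => simp
    | succ k ih =>
      rw [Function.iterate_succ_apply', ih, Function.iterate_succ_apply', Derivation.map_smul,
        pow_succ]
      simp only [smul_mul_assoc, mul_smul_comm, smul_add, smul_smul]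
      congr 2
      field_simp
  have e2 : ∀ i m (f : MvPowerSeries (Fin N) ℂ) (t : ℂ), (ddSum i)^[m] (t • f)
        = (t * (N : ℂ) ^ m) • (fun f => (N : ℂ)⁻¹ • ddSum i f)^[m] f := by
    intro i m f t
    induction m with
    | zero => simp
    | succ m ih =>
      rw [Function.iterate_succ_apply', ih, Function.iterate_succ_apply', map_smul, pow_succ,
        smul_smul]
      congr 1
      field_simp
  -- The exponent j + 1 is made of m divided differences, j - m conjugated derivatives and one
  -- factor for the sum over i.
  have e3 : ∀ j m, m ≤ j → ∑ i, (ddSum i)^[m] (atVar i (q j) *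
      (fun f => pderiv ℂ i f + ((N : ℂ) • ℓ N i) * f)^[j - m] (g N))
        = (N : ℂ) ^ (j + 1) • G j m N i := by
    intro j m hm
    rw [hG]
    simp only
    rw [smul_smul, pow_succ, mul_assoc, mul_inv_cancel₀ hNc, mul_one, smul_sum]
    refine sum_congr rfl fun i _ => ?_
    rw [e1, mul_smul_comm, e2, ← pow_add, Nat.sub_add_cancel hm]
  have e4 : radialOp (fun i f => pderiv ℂ i f + ((N : ℂ) • ℓ N i) * f) q n (g N)
      = ∑ j ∈ range (n + 1), ∑ m ∈ range (j + 1), ((j.choose m : ℂ) / (m + 1)) •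
        ((N : ℂ) ^ (j + 1) • G j m N i) := by
    rw [radialOp]
    refine sum_congr rfl fun j _ => sum_congr rfl fun m hm => ?_
    rw [e3 j m (Nat.lt_succ_iff.1 (mem_range.1 hm))]
  rw [e4, smul_sum, sum_range_succ, add_sub_assoc]
  congr 1
  · refine sum_congr rfl fun j hj => ?_
    rw [smul_sum]
    refine sum_congr rfl fun m _ => ?_
    rw [smul_comm, smul_smul (((N : ℂ) ^ (n + 1))⁻¹)]
    congr 2
    have : n + 1 = (n - j) + (j + 1) := by have := mem_range.1 hj; omega
    rw [this, pow_add]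
    field_simp
  · rw [smul_sum, limitMoment, mul_sum, map_sum, ← sum_sub_distrib]
    refine sum_congr rfl fun m _ => ?_
    rw [smul_comm, smul_smul (((N : ℂ) ^ (n + 1))⁻¹), inv_mul_cancel₀ (pow_ne_zero _ hNc), one_smul,
      smul_sub, smul_eq_C_mul (C _), ← map_mul, mul_left_comm]

end SymSeries

/-! ### Formal Taylor series of smooth functions of several complex variables. -/

namespace SymSeries

open Finset

section Taylor

open scoped ContDiff

variable {ι : Type*} [Fintype ι] [DecidableEq ι]

/-- The partial derivative in the direction of the coordinate `i`. -/
noncomputable def pd (i : ι) (f : (ι → ℂ) → ℂ) : (ι → ℂ) → ℂ :=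
  fun x => fderiv ℂ f x (Pi.single i 1)

theorem smooth_pd {f : (ι → ℂ) → ℂ} {c : ι → ℂ} (hf : ContDiffAt ℂ ∞ f c) (i : ι) :
    ContDiffAt ℂ ∞ (pd i f) c :=
  (hf.fderiv_right (m := ∞) (by simp)).clm_apply contDiffAt_const

theorem pd_congr {f g : (ι → ℂ) → ℂ} {c : ι → ℂ} (h : f =ᶠ[𝓝 c] g) (i : ι) :
    pd i f =ᶠ[𝓝 c] pd i g := by
  filter_upwards [h.fderiv (𝕜 := ℂ)] with x hx
  rw [pd, pd, hx]

theorem pd_comm {f : (ι → ℂ) → ℂ} {c : ι → ℂ} (hf : ContDiffAt ℂ ∞ f c) (i j : ι) :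
    pd i (pd j f) =ᶠ[𝓝 c] pd j (pd i f) := by
  have h2 : ∀ᶠ x in 𝓝 c, ContDiffAt ℂ 2 f x :=
    (hf.of_le (m := 2) ENat.LEInfty.out).eventually (by simp)
  filter_upwards [h2] with x hx
  have hd : DifferentiableAt ℂ (fderiv ℂ f) x :=
    (hx.fderiv_right (m := 1) (by norm_num)).differentiableAt (by norm_num)
  have key : ∀ a b : ι, pd a (pd b f) x = fderiv ℂ (fderiv ℂ f) x (Pi.single a 1) (Pi.single b 1) := by
    intro a b
    unfold pd
    rw [fderiv_clm_apply hd (differentiableAt_const _)]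
    simp
  rw [key, key]
  exact (hx.isSymmSndFDerivAt (by simp)).eq _ _

/-- The iterated partial derivative along a list of coordinates. -/
noncomputable def pdList (l : List ι) (f : (ι → ℂ) → ℂ) : (ι → ℂ) → ℂ := l.foldr pd f

theorem pdList_cons (i : ι) (l : List ι) (f : (ι → ℂ) → ℂ) :
    pdList (i :: l) f = pd i (pdList l f) := rfl

theorem smooth_pdList {f : (ι → ℂ) → ℂ} {c : ι → ℂ} (hf : ContDiffAt ℂ ∞ f c) (l : List ι) :
    ContDiffAt ℂ ∞ (pdList l f) c := by
  induction l with
  | nil => exact hf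
  | cons i l ih => exact smooth_pd ih i

theorem pdList_congr {f g : (ι → ℂ) → ℂ} {c : ι → ℂ} (h : f =ᶠ[𝓝 c] g) (l : List ι) :
    pdList l f =ᶠ[𝓝 c] pdList l g := by
  induction l with
  | nil => exact h
  | cons i l ih => exact pd_congr ih i

theorem pdList_perm {f : (ι → ℂ) → ℂ} {c : ι → ℂ} (hf : ContDiffAt ℂ ∞ f c) {l l' : List ι}
    (h : l.Perm l') : pdList l f =ᶠ[𝓝 c] pdList l' f := by
  induction h with
  | nil => exact EventuallyEq.refl _ _
  | cons i _ ih => exact pd_congr ih i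
  | swap i j l => exact pd_comm (smooth_pdList hf l) j i
  | trans _ _ ih1 ih2 => exact ih1.trans ih2

theorem pdList_pd (i : ι) (l : List ι) (f : (ι → ℂ) → ℂ) :
    pdList l (pd i f) = pdList (l ++ [i]) f := by
  simp [pdList]

/-- The Taylor series of `f` at `c`. -/
noncomputable def taylor (c : ι → ℂ) (f : (ι → ℂ) → ℂ) : MvPowerSeries ι ℂ := fun α =>
  (∏ l, ((α l).factorial : ℂ))⁻¹ * pdList α.toMultiset.toList f c

theorem coeff_taylor (c : ι → ℂ) (f : (ι → ℂ) → ℂ) (α : ι →₀ ℕ) :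
    MvPowerSeries.coeff α (taylor c f)
      = (∏ l, ((α l).factorial : ℂ))⁻¹ * pdList α.toMultiset.toList f c := rfl

theorem coeff_zero_taylor (c : ι → ℂ) (f : (ι → ℂ) → ℂ) :
    MvPowerSeries.coeff 0 (taylor c f) = f c := by
  simp [coeff_taylor, pdList]

theorem taylor_congr {f g : (ι → ℂ) → ℂ} {c : ι → ℂ} (h : f =ᶠ[𝓝 c] g) :
    taylor c f = taylor c g := by
  ext α
  rw [coeff_taylor, coeff_taylor, (pdList_congr h _).eq_of_nhds]

/-- The coefficients are defined through an arbitrary ordering of the partial derivatives, and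
`pdList_perm` shows that the ordering is irrelevant. The further properties of `taylor` follow by
induction on the degree, each nonconstant coefficient being determined by a partial derivative. -/
theorem taylor_pd {f : (ι → ℂ) → ℂ} {c : ι → ℂ} (hf : ContDiffAt ℂ ∞ f c) (i : ι) :
    taylor c (pd i f) = MvPowerSeries.pderiv ℂ i (taylor c f) := by
  ext α
  rw [MvPowerSeries.coeff_pderiv, coeff_taylor, coeff_taylor, pdList_pd]
  have h1 : (α.toMultiset.toList ++ [i]).Perm (α + Finsupp.single i 1).toMultiset.toList := by
    rw [← Multiset.coe_eq_coe]
    simp [Multiset.coe_toList, ← Multiset.coe_add, Finsupp.toMultiset_single]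
  rw [(pdList_perm hf h1).eq_of_nhds]
  have h2 : ∏ l, (((α + Finsupp.single i 1 : ι →₀ ℕ) l).factorial : ℂ)
      = (α i + 1) * ∏ l, ((α l).factorial : ℂ) := by
    rw [← mul_prod_erase _ _ (mem_univ i), ← mul_prod_erase _ _ (mem_univ i), ← mul_assoc]
    congr 1
    · simp [Nat.factorial_succ]
    · refine prod_congr rfl fun l hl => ?_
      simp [(ne_of_mem_erase hl)]
  have h3 : ((α i : ℂ) + 1) ≠ 0 := Nat.cast_add_one_ne_zero _
  rw [h2, mul_inv]
  field_simp

theorem exists_eq_add_single {α : ι →₀ ℕ} (h : α ≠ 0) :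
    ∃ (i : ι) (β : ι →₀ ℕ), α = β + Finsupp.single i 1 ∧ β.degree + 1 = α.degree := by
  obtain ⟨i, hi⟩ := Finsupp.ne_iff.1 h
  have hle : Finsupp.single i 1 ≤ α := by
    rw [Finsupp.single_le_iff]; exact Nat.one_le_iff_ne_zero.2 hi
  refine ⟨i, α - Finsupp.single i 1, (tsub_add_cancel_of_le hle).symm, ?_⟩
  conv_rhs => rw [← tsub_add_cancel_of_le hle]
  rw [map_add, Finsupp.degree_single]

theorem coeff_add_single_eq {F G : MvPowerSeries ι ℂ} {i : ι} {β : ι →₀ ℕ}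
    (h : MvPowerSeries.coeff β (MvPowerSeries.pderiv ℂ i F)
      = MvPowerSeries.coeff β (MvPowerSeries.pderiv ℂ i G)) :
    MvPowerSeries.coeff (β + Finsupp.single i 1) F
      = MvPowerSeries.coeff (β + Finsupp.single i 1) G := by
  rw [MvPowerSeries.coeff_pderiv, MvPowerSeries.coeff_pderiv] at h
  have h3 : ((β i : ℂ) + 1) ≠ 0 := Nat.cast_add_one_ne_zero _
  exact mul_right_cancel₀ h3 h

theorem pd_add {f g : (ι → ℂ) → ℂ} {c : ι → ℂ} (hf : ContDiffAt ℂ ∞ f c) (hg : ContDiffAt ℂ ∞ g c)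
    (i : ι) : pd i (fun x => f x + g x) =ᶠ[𝓝 c] fun x => pd i f x + pd i g x := by
  have h1 : ∀ᶠ x in 𝓝 c, ContDiffAt ℂ 1 f x :=
    (hf.of_le ENat.LEInfty.out).eventually (by simp)
  have h2 : ∀ᶠ x in 𝓝 c, ContDiffAt ℂ 1 g x :=
    (hg.of_le ENat.LEInfty.out).eventually (by simp)
  filter_upwards [h1, h2] with x h1 h2
  unfold pd
  rw [fderiv_fun_add (h1.differentiableAt one_ne_zero) (h2.differentiableAt one_ne_zero)]
  rfl

theorem pd_mul {f g : (ι → ℂ) → ℂ} {c : ι → ℂ} (hf : ContDiffAt ℂ ∞ f c) (hg : ContDiffAt ℂ ∞ g c)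
    (i : ι) : pd i (fun x => f x * g x) =ᶠ[𝓝 c] fun x => f x * pd i g x + pd i f x * g x := by
  have h1 : ∀ᶠ x in 𝓝 c, ContDiffAt ℂ 1 f x :=
    (hf.of_le ENat.LEInfty.out).eventually (by simp)
  have h2 : ∀ᶠ x in 𝓝 c, ContDiffAt ℂ 1 g x :=
    (hg.of_le ENat.LEInfty.out).eventually (by simp)
  filter_upwards [h1, h2] with x h1 h2
  unfold pd
  rw [fderiv_fun_mul (h1.differentiableAt one_ne_zero) (h2.differentiableAt one_ne_zero)]
  simp [mul_comm]

theorem taylor_add {f g : (ι → ℂ) → ℂ} {c : ι → ℂ} (hf : ContDiffAt ℂ ∞ f c)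
    (hg : ContDiffAt ℂ ∞ g c) : taylor c (fun x => f x + g x) = taylor c f + taylor c g := by
  have key : ∀ (n : ℕ) (α : ι →₀ ℕ), α.degree = n → ∀ f g : (ι → ℂ) → ℂ, ContDiffAt ℂ ∞ f c →
      ContDiffAt ℂ ∞ g c → MvPowerSeries.coeff α (taylor c fun x => f x + g x)
        = MvPowerSeries.coeff α (taylor c f + taylor c g) := by
    intro n
    induction n with
    | zero =>
      intro α hα f g hf hg
      rw [(Finsupp.degree_eq_zero_iff _).1 hα, map_add]
      simp only [coeff_zero_taylor]
    | succ n ih =>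
      intro α hα f g hf hg
      have h0 : α ≠ 0 := by rintro rfl; simp at hα
      obtain ⟨i, β, rfl, hβ⟩ := exists_eq_add_single h0
      apply coeff_add_single_eq
      rw [← taylor_pd (hf.add hg), taylor_congr (pd_add hf hg i), map_add, ← taylor_pd hf,
        ← taylor_pd hg]
      exact ih β (by omega) _ _ (smooth_pd hf i) (smooth_pd hg i)
  ext α
  exact key _ α rfl f g hf hg

theorem taylor_mul {f g : (ι → ℂ) → ℂ} {c : ι → ℂ} (hf : ContDiffAt ℂ ∞ f c)
    (hg : ContDiffAt ℂ ∞ g c) : taylor c (fun x => f x * g x) = taylor c f * taylor c g := by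
  have key : ∀ (n : ℕ) (α : ι →₀ ℕ), α.degree = n → ∀ f g : (ι → ℂ) → ℂ, ContDiffAt ℂ ∞ f c →
      ContDiffAt ℂ ∞ g c → MvPowerSeries.coeff α (taylor c fun x => f x * g x)
        = MvPowerSeries.coeff α (taylor c f * taylor c g) := by
    intro n
    induction n with
    | zero =>
      intro α hα f g hf hg
      rw [(Finsupp.degree_eq_zero_iff _).1 hα, coeff_zero_taylor,
        MvPowerSeries.coeff_zero_eq_constantCoeff_apply, map_mul,
        ← MvPowerSeries.coeff_zero_eq_constantCoeff_apply,
        ← MvPowerSeries.coeff_zero_eq_constantCoeff_apply, coeff_zero_taylor, coeff_zero_taylor]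
    | succ n ih =>
      intro α hα f g hf hg
      have h0 : α ≠ 0 := by rintro rfl; simp at hα
      obtain ⟨i, β, rfl, hβ⟩ := exists_eq_add_single h0
      apply coeff_add_single_eq
      rw [← taylor_pd (hf.mul hg), taylor_congr (pd_mul hf hg i),
        taylor_add (hf.mul (smooth_pd hg i)) ((smooth_pd hf i).mul hg), Derivation.leibniz, map_add,
        map_add, ih β (by omega) _ _ hf (smooth_pd hg i), ih β (by omega) _ _ (smooth_pd hf i) hg,
        taylor_pd hf, taylor_pd hg, smul_eq_mul, smul_eq_mul,
        mul_comm (taylor c g) (MvPowerSeries.pderiv ℂ i (taylor c f))]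
  ext α
  exact key _ α rfl f g hf hg

theorem pd_const (i : ι) (a : ℂ) : pd i (fun _ : ι → ℂ => a) = fun _ => 0 := by
  funext x; simp [pd]

theorem taylor_const (c : ι → ℂ) (a : ℂ) :
    taylor c (fun _ => a) = MvPowerSeries.C a := by
  have h0 : taylor c (fun _ : ι → ℂ => (0 : ℂ)) = 0 := by
    have hz : ∀ l : List ι, pdList l (fun _ : ι → ℂ => (0 : ℂ)) = fun _ => 0 := by
      intro l
      induction l with
      | nil => rfl
      | cons i l ih => rw [pdList_cons, ih, pd_const]
    ext α
    rw [coeff_taylor, hz]; simp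
  apply MvPowerSeries.pderiv.ext
  · intro i
    rw [← taylor_pd contDiffAt_const, pd_const, h0]; simp
  · rw [← MvPowerSeries.coeff_zero_eq_constantCoeff_apply, coeff_zero_taylor]; simp

theorem pd_coord (i l : ι) :
    pd i (fun x : ι → ℂ => x l) = fun _ => if l = i then 1 else 0 := by
  funext x
  unfold pd
  rw [(hasFDerivAt_apply l x).fderiv]
  simp [Pi.single_apply]

theorem taylor_coord (c : ι → ℂ) (l : ι) :
    taylor c (fun x => x l) = MvPowerSeries.X l + MvPowerSeries.C (c l) := by
  apply MvPowerSeries.pderiv.ext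
  · intro i
    rw [← taylor_pd (by fun_prop), pd_coord, taylor_const]
    rcases eq_or_ne l i with rfl | h
    · simp
    · simp [h, MvPowerSeries.pderiv_X_of_ne h]
  · rw [← MvPowerSeries.coeff_zero_eq_constantCoeff_apply, coeff_zero_taylor]; simp

theorem smooth_eval (c : ι → ℂ) (p : MvPolynomial ι ℂ) :
    ContDiffAt ℂ ∞ (fun x => MvPolynomial.eval x p) c := by
  induction p using MvPolynomial.induction_on with
  | C a => simpa using contDiffAt_const
  | add p q hp hq => simpa using hp.add hq
  | mul_X p i hp => simpa using hp.mul (contDiff_apply ℂ ℂ i).contDiffAt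

theorem taylor_eval (c : ι → ℂ) (p : MvPolynomial ι ℂ) :
    taylor c (fun x => MvPolynomial.eval x p)
      = MvPolynomial.aeval (fun i => MvPowerSeries.X i + MvPowerSeries.C (c i)) p := by
  induction p using MvPolynomial.induction_on with
  | C a =>
    simp only [MvPolynomial.eval_C, MvPolynomial.aeval_C]
    exact taylor_const c a
  | add p q hp hq =>
    rw [map_add, ← hp, ← hq, ← taylor_add (smooth_eval c p) (smooth_eval c q)]; simp
  | mul_X p i hp =>
    rw [map_mul, MvPolynomial.aeval_X, ← hp, ← taylor_coord, ← taylor_mul (smooth_eval c p)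
      (contDiff_apply ℂ ℂ i).contDiffAt]
    simp

end Taylor

end SymSeries

/-! ### Cauchy estimates, the Weierstrass theorem and convergence of Taylor coefficients. -/

namespace SymSeries

open Finset

section Weierstrass

open scoped ContDiff

open Metric

variable {E F : Type} [NormedAddCommGroup E] [NormedSpace ℂ E] [NormedAddCommGroup F]
  [NormedSpace ℂ F]

/-- Cauchy's estimate on the complex line through x in direction v. The factor 2 arises because the
circle has half the radius, so that the closed disc stays in the open ball. -/
theorem norm_fderiv_le_of_bounded_ball {f : E → F} {x : E} {r M : ℝ} (hr : 0 < r)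
    (hf : DifferentiableOn ℂ f (ball x r)) (hM : ∀ y ∈ ball x r, ‖f y‖ ≤ M) :
    ‖fderiv ℂ f x‖ ≤ 2 * M / r := by
  have hM0 : 0 ≤ M := (norm_nonneg _).trans (hM x (mem_ball_self hr))
  refine ContinuousLinearMap.opNorm_le_bound _ (by positivity) fun v => ?_
  rcases eq_or_ne v 0 with rfl | hv
  · simp
  have hv' : 0 < ‖v‖ := norm_pos_iff.2 hv
  have hR : 0 < r / 2 / ‖v‖ := by positivity
  set γ : ℂ → E := fun z => x + z • v with hγ
  have hmem : ∀ z ∈ closedBall (0 : ℂ) (r / 2 / ‖v‖), γ z ∈ ball x r := by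
    intro z hz
    rw [mem_closedBall_zero_iff] at hz
    rw [hγ, mem_ball, dist_eq_norm]
    simp only [add_sub_cancel_left, norm_smul]
    calc ‖z‖ * ‖v‖ ≤ r / 2 / ‖v‖ * ‖v‖ := by gcongr
      _ = r / 2 := by field_simp
      _ < r := by linarith
  have hγd : ∀ z, HasDerivAt γ v z := fun z => by
    have := ((hasDerivAt_id z).smul_const v).const_add x
    rw [one_smul] at this
    exact this
  have hd : ∀ z ∈ closedBall (0 : ℂ) (r / 2 / ‖v‖), DifferentiableAt ℂ (f ∘ γ) z := fun z hz =>
    ((hf.differentiableAt (isOpen_ball.mem_nhds (hmem z hz))).comp z (hγd z).differentiableAt)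
  have h1 := Complex.norm_deriv_le_of_forall_mem_sphere_norm_le (f := f ∘ γ) (c := 0) (C := M) hR
    (DifferentiableOn.diffContOnCl fun z hz =>
      (hd z (closure_ball_subset_closedBall hz)).differentiableWithinAt)
    fun z hz => hM _ (hmem z (sphere_subset_closedBall hz))
  have h2 : deriv (f ∘ γ) 0 = fderiv ℂ f x v := by
    have h0 : γ 0 = x := by simp [hγ]
    have := (hf.differentiableAt (isOpen_ball.mem_nhds (mem_ball_self hr))).hasFDerivAt
    rw [← h0] at this
    have := (this.comp_hasDerivAt 0 (hγd 0)).deriv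
    rw [h0] at this; exact this
  rw [h2] at h1
  refine h1.trans (le_of_eq ?_)
  field_simp

/-- The Weierstrass theorem: uniform limits of holomorphic functions are smooth. -/
theorem contDiffAt_of_tendstoUniformlyOn_nat {ι : Type*} {p : Filter ι} [p.NeBot] (k : ℕ) :
    ∀ {F : Type} [NormedAddCommGroup F] [NormedSpace ℂ F] [CompleteSpace F]
      {f : ι → E → F} {g : E → F} {c : E} {r : ℝ}, 0 < r →
      (∀ n, ∀ x ∈ ball c r, ContDiffAt ℂ ∞ (f n) x) → TendstoUniformlyOn f g p (ball c r) →
      ContDiffAt ℂ k g c := by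
  induction k with
  | zero =>
    intro F _ _ _ f g c r hr hf hg
    rw [Nat.cast_zero, contDiffAt_zero]
    exact ⟨_, ball_mem_nhds c hr, hg.continuousOn (Frequently.of_forall fun n x hx =>
      (hf n x hx).continuousAt.continuousWithinAt)⟩
  | succ k ih =>
    intro F _ _ _ f g c r hr hf hg
    have hr2 : 0 < r / 2 := half_pos hr
    have hsub : ∀ x ∈ ball c (r / 2), ball x (r / 2) ⊆ ball c r := fun x hx =>
      ball_subset_ball' (by rw [mem_ball] at hx; linarith)
    have hdiff : ∀ n, DifferentiableOn ℂ (f n) (ball c r) := fun n x hx =>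
      ((hf n x hx).differentiableAt (by simp)).differentiableWithinAt
    have hcau : UniformCauchySeqOn (fun n => fderiv ℂ (f n)) p (ball c (r / 2)) := by
      intro u hu
      obtain ⟨ε, hε, hu⟩ := mem_uniformity_dist.1 hu
      -- Cauchy's estimate on balls of radius r/2 turns this accuracy into ε/2 for the derivatives.
      have := hg.uniformCauchySeqOn _ (dist_mem_uniformity (show 0 < ε * (r / 2) / 4 by positivity))
      filter_upwards [this] with m hm x hx
      apply hu
      rw [dist_eq_norm, ← fderiv_sub
        ((hf m.1 x (hsub x hx (mem_ball_self hr2))).differentiableAt (by simp))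
        ((hf m.2 x (hsub x hx (mem_ball_self hr2))).differentiableAt (by simp))]
      refine lt_of_le_of_lt (norm_fderiv_le_of_bounded_ball (M := ε * (r / 2) / 4) hr2
        (((hdiff m.1).sub (hdiff m.2)).mono (hsub x hx)) fun y hy => ?_) ?_
      · have := hm y (hsub x hx hy)
        rw [dist_eq_norm] at this
        exact this.le
      · have : 2 * (ε * (r / 2) / 4) / (r / 2) = ε / 2 := by field_simp; ring
        rw [this]; linarith
    have hlim : ∀ x, ∃ y, x ∈ ball c (r / 2) → Tendsto (fun n => fderiv ℂ (f n) x) p (𝓝 y) := by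
      intro x
      by_cases hx : x ∈ ball c (r / 2)
      · obtain ⟨y, hy⟩ := CompleteSpace.complete (hcau.cauchy_map hx)
        exact ⟨y, fun _ => hy⟩
      · exact ⟨0, fun h => absurd h hx⟩
    choose g' hg' using hlim
    have hunif := hcau.tendstoUniformlyOn_of_tendsto hg'
    push_cast
    rw [contDiffAt_succ_iff_hasFDerivAt]
    refine ⟨g', ⟨_, ball_mem_nhds c hr2, fun x hx => ?_⟩, ih hr2 (fun n x hx => ?_) hunif⟩
    · refine hasFDerivAt_of_tendstoUniformlyOn isOpen_ball hunif (fun n y hy => ?_)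
        (fun y hy => hg.tendsto_at (ball_subset_ball (by linarith) hy)) hx
      exact ((hf n y (ball_subset_ball (by linarith) hy)).differentiableAt (by simp)).hasFDerivAt
    · exact (hf n x (ball_subset_ball (by linarith) hx)).fderiv_right (by simp)

theorem contDiffAt_of_tendstoUniformlyOn [CompleteSpace F] {ι : Type*} {p : Filter ι} [p.NeBot]
    {f : ι → E → F} {g : E → F} {c : E} {r : ℝ}
    (hf : ∀ n, ∀ x ∈ ball c r, ContDiffAt ℂ ∞ (f n) x) (hg : TendstoUniformlyOn f g p (ball c r))
    {x : E} (hx : x ∈ ball c r) : ContDiffAt ℂ ∞ g x := by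
  rw [contDiffAt_infty]
  intro k
  have hr : 0 < r - dist x c := by rw [mem_ball] at hx; linarith
  have hsub : ball x (r - dist x c) ⊆ ball c r := ball_subset_ball' (by linarith)
  exact contDiffAt_of_tendstoUniformlyOn_nat k hr (fun n y hy => hf n y (hsub hy)) (hg.mono hsub)

end Weierstrass

section Coefficients

open scoped ContDiff

open Metric

variable {ι : Type} [Fintype ι] [DecidableEq ι]

theorem norm_single_one (i : ι) : ‖(Pi.single i 1 : ι → ℂ)‖ = 1 := by
  rw [Pi.norm_single]; simp

/-- Every derivative costs half of the radius. The constant depends on l and r but not on the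
function, so uniform convergence of functions gives convergence of coefficients. -/
theorem exists_norm_pdList_le (l : List ι) {r : ℝ} (hr : 0 < r) : ∃ K : ℝ, 0 ≤ K ∧
    ∀ (c : ι → ℂ) (f : (ι → ℂ) → ℂ) (M : ℝ), (∀ x ∈ ball c r, ContDiffAt ℂ ∞ f x) →
      (∀ x ∈ ball c r, ‖f x‖ ≤ M) → ∀ x ∈ ball c (r / 2 ^ l.length), ‖pdList l f x‖ ≤ K * M := by
  induction l with
  | nil => exact ⟨1, zero_le_one, fun c f M _ hM x hx => by
    simpa [pdList] using hM x (by simpa using hx)⟩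
  | cons i l ih =>
    obtain ⟨K, hK, h⟩ := ih
    have hr' : 0 < r / 2 ^ (l.length + 1) := by positivity
    refine ⟨2 * K / (r / 2 ^ (l.length + 1)), by positivity, fun c f M hf hM x hx => ?_⟩
    rw [List.length_cons] at hx
    have hsub : ball x (r / 2 ^ (l.length + 1)) ⊆ ball c (r / 2 ^ l.length) := by
      apply ball_subset_ball'
      rw [mem_ball] at hx
      have : r / 2 ^ l.length = r / 2 ^ (l.length + 1) + r / 2 ^ (l.length + 1) := by
        rw [pow_succ]; field_simp; ring
      linarith
    have hsub2 : ball c (r / 2 ^ l.length) ⊆ ball c r :=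
      ball_subset_ball (div_le_self hr.le (one_le_pow₀ (by norm_num)))
    have hb := norm_fderiv_le_of_bounded_ball (f := pdList l f) (x := x) (M := K * M) hr'
      (fun y hy => ((smooth_pdList (hf y (hsub2 (hsub hy))) l).differentiableAt
        (by simp)).differentiableWithinAt) fun y hy => h c f M hf hM y (hsub hy)
    rw [pdList_cons, pd]
    refine (ContinuousLinearMap.le_opNorm _ _).trans ?_
    rw [norm_single_one, mul_one]
    refine hb.trans (le_of_eq ?_)
    ring

theorem exists_norm_coeff_taylor_le (α : ι →₀ ℕ) {r : ℝ} (hr : 0 < r) : ∃ K : ℝ, 0 ≤ K ∧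
    ∀ (c : ι → ℂ) (f : (ι → ℂ) → ℂ) (M : ℝ), (∀ x ∈ ball c r, ContDiffAt ℂ ∞ f x) →
      (∀ x ∈ ball c r, ‖f x‖ ≤ M) → ‖MvPowerSeries.coeff α (taylor c f)‖ ≤ K * M := by
  obtain ⟨K, hK, h⟩ := exists_norm_pdList_le α.toMultiset.toList hr
  refine ⟨‖(∏ l, ((α l).factorial : ℂ))⁻¹‖ * K, by positivity, fun c f M hf hM => ?_⟩
  rw [coeff_taylor, norm_mul, mul_assoc]
  gcongr
  exact h c f M hf hM c (mem_ball_self (by positivity))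

theorem taylor_neg {f : (ι → ℂ) → ℂ} {c : ι → ℂ} (hf : ContDiffAt ℂ ∞ f c) :
    taylor c (fun x => -f x) = -taylor c f := by
  have h := taylor_mul (contDiffAt_const (c := (-1 : ℂ))) hf
  rw [taylor_const] at h
  simpa using h

theorem taylor_sub {f g : (ι → ℂ) → ℂ} {c : ι → ℂ} (hf : ContDiffAt ℂ ∞ f c)
    (hg : ContDiffAt ℂ ∞ g c) : taylor c (fun x => f x - g x) = taylor c f - taylor c g := by
  have := taylor_add hf hg.neg
  rw [taylor_neg hg] at this
  simpa only [sub_eq_add_neg] using this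

theorem taylor_const_mul {f : (ι → ℂ) → ℂ} {c : ι → ℂ} (hf : ContDiffAt ℂ ∞ f c) (a : ℂ) :
    taylor c (fun x => a * f x) = a • taylor c f := by
  rw [taylor_mul contDiffAt_const hf, taylor_const, MvPowerSeries.smul_eq_C_mul]

theorem taylor_sum {κ : Type*} {c : ι → ℂ} (s : Finset κ) {f : κ → (ι → ℂ) → ℂ}
    (hf : ∀ k ∈ s, ContDiffAt ℂ ∞ (f k) c) :
    taylor c (fun x => ∑ k ∈ s, f k x) = ∑ k ∈ s, taylor c (f k) := by
  classical
  induction s using Finset.induction_on with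
  | empty => simpa using taylor_const c (0 : ℂ)
  | insert k s hk ih =>
    simp only [sum_insert hk]
    rw [taylor_add (hf k (mem_insert_self _ _))
      (ContDiffAt.sum fun j hj => hf j (mem_insert_of_mem hj)),
      ih fun j hj => hf j (mem_insert_of_mem hj)]

theorem tendsto_coeff_taylor {κ : Type*} {p : Filter κ} [p.NeBot] {f : κ → (ι → ℂ) → ℂ}
    {g : (ι → ℂ) → ℂ} {c : ι → ℂ} {r : ℝ} (hr : 0 < r)
    (hf : ∀ᶠ n in p, ∀ x ∈ ball c r, ContDiffAt ℂ ∞ (f n) x)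
    (hgs : ∀ x ∈ ball c r, ContDiffAt ℂ ∞ g x)
    (hg : TendstoUniformlyOn f g p (ball c r)) (α : ι →₀ ℕ) :
    Tendsto (fun n => MvPowerSeries.coeff α (taylor c (f n))) p
      (𝓝 (MvPowerSeries.coeff α (taylor c g))) := by
  obtain ⟨K, hK, h⟩ := exists_norm_coeff_taylor_le α hr
  rw [Metric.tendsto_nhds]
  intro ε hε
  have h2 := Metric.tendstoUniformlyOn_iff.1 hg (ε / (K + 1)) (by positivity)
  filter_upwards [h2, hf] with n hn hfn
  have hc := mem_ball_self hr (x := c)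
  rw [dist_eq_norm, ← map_sub, ← taylor_sub (hfn c hc) (hgs c hc)]
  have := h c (fun x => f n x - g x) (ε / (K + 1)) (fun x hx => (hfn x hx).sub (hgs x hx))
    fun x hx => by
      have := hn x hx
      rw [dist_comm, dist_eq_norm] at this
      exact this.le
  refine lt_of_le_of_lt this ?_
  rw [mul_div_assoc', div_lt_iff₀ (by positivity)]
  nlinarith

/-- Taylor coefficients of a uniformly convergent series can be summed term by term. -/
theorem hasSum_coeff_taylor {κ : Type*} {f : κ → (ι → ℂ) → ℂ} {g : (ι → ℂ) → ℂ} {c : ι → ℂ} {r : ℝ}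
    (hr : 0 < r) (hf : ∀ n, ∀ x ∈ ball c r, ContDiffAt ℂ ∞ (f n) x)
    (hg : TendstoUniformlyOn (fun (s : Finset κ) x => ∑ k ∈ s, f k x) g atTop (ball c r)) :
    (∀ x ∈ ball c r, ContDiffAt ℂ ∞ g x) ∧ ∀ α, HasSum
      (fun k => MvPowerSeries.coeff α (taylor c (f k))) (MvPowerSeries.coeff α (taylor c g)) := by
  have hs : ∀ s : Finset κ, ∀ x ∈ ball c r, ContDiffAt ℂ ∞ (fun x => ∑ k ∈ s, f k x) x :=
    fun s x hx => ContDiffAt.sum fun k _ => hf k x hx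
  have hgs : ∀ x ∈ ball c r, ContDiffAt ℂ ∞ g x := fun x hx =>
    contDiffAt_of_tendstoUniformlyOn hs hg hx
  refine ⟨hgs, fun α => ?_⟩
  have := tendsto_coeff_taylor hr (Eventually.of_forall hs) hgs hg α
  refine this.congr fun s => ?_
  rw [taylor_sum s fun k _ => hf k c (mem_ball_self hr), map_sum]

end Coefficients

/-! ### Taylor coefficients of restrictions to coordinate subspaces. -/

section Restrict

open scoped ContDiff

variable {ι κ : Type} [Fintype ι] [DecidableEq ι] [Fintype κ] [DecidableEq κ]

/-- The linear map extending a vector by zero along `e`. -/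
noncomputable def extendL (e : κ → ι) : (κ → ℂ) →L[ℂ] (ι → ℂ) :=
  LinearMap.toContinuousLinearMap
    { toFun := fun x j => ∑ k, if e k = j then x k else 0
      map_add' := fun x y => by
        funext j
        simp only [Pi.add_apply, ← sum_add_distrib]
        exact sum_congr rfl fun k _ => by split_ifs <;> simp
      map_smul' := fun a x => by
        funext j
        simp only [Pi.smul_apply, smul_eq_mul, RingHom.id_apply, mul_sum]
        exact sum_congr rfl fun k _ => by split_ifs <;> simp }

theorem extendL_apply (e : κ → ι) (x : κ → ℂ) (j : ι) :
    extendL e x j = ∑ k, if e k = j then x k else 0 := rfl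

theorem extendL_single (e : κ → ι) (k : κ) :
    extendL e (Pi.single k 1) = Pi.single (e k) 1 := by
  funext j
  rw [extendL_apply, sum_eq_single k]
  · simp [Pi.single_apply, eq_comm]
  · intro l _ hl; simp [hl]
  · simp

theorem extendL_apply_image {e : κ → ι} (he : Function.Injective e) (x : κ → ℂ) (k : κ) :
    extendL e x (e k) = x k := by
  rw [extendL_apply, sum_eq_single k]
  · simp
  · intro l _ hl; rw [if_neg fun h => hl (he h)]
  · simp

theorem extendL_apply_of_notMem {e : κ → ι} (x : κ → ℂ) {j : ι} (hj : ∀ k, e k ≠ j) :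
    extendL e x j = 0 := by
  rw [extendL_apply]
  exact sum_eq_zero fun k _ => if_neg (hj k)

theorem pd_comp_extendL {f : (ι → ℂ) → ℂ} (hf : ContDiffAt ℂ ∞ f 0) (e : κ → ι) (k : κ) :
    pd k (fun x => f (extendL e x)) =ᶠ[𝓝 0] fun x => pd (e k) f (extendL e x) := by
  have h1 : ∀ᶠ x in 𝓝 (0 : ι → ℂ), ContDiffAt ℂ 1 f x :=
    (hf.of_le ENat.LEInfty.out).eventually (by simp)
  have hc : Tendsto (extendL e) (𝓝 0) (𝓝 (0 : ι → ℂ)) := by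
    have := (extendL e).continuous.tendsto 0
    rwa [map_zero] at this
  filter_upwards [hc.eventually h1] with x hx
  unfold pd
  have := (hx.differentiableAt one_ne_zero).hasFDerivAt.comp x (extendL e).hasFDerivAt
  rw [show (fun x => f (extendL e x)) = f ∘ extendL e from rfl, this.fderiv]
  simp [extendL_single]

/-- Coefficients that involve only some of the variables can be computed with the other variables
set to 0. This is how hypotheses on (u_1, …, u_k, 1, …, 1) control series in all N variables; a
permutation as `e` gives symmetry. -/
theorem coeff_taylor_extendL (e : κ → ι) (he : Function.Injective e) (α : κ →₀ ℕ)
    {f : (ι → ℂ) → ℂ} (hf : ContDiffAt ℂ ∞ f 0) :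
    MvPowerSeries.coeff (α.mapDomain e) (taylor 0 f)
      = MvPowerSeries.coeff α (taylor 0 fun x => f (extendL e x)) := by
  have hcomp : ∀ {f : (ι → ℂ) → ℂ}, ContDiffAt ℂ ∞ f 0 →
      ContDiffAt ℂ ∞ (fun x => f (extendL e x)) 0 := by
    intro f hf
    have h0 : extendL e (0 : κ → ℂ) = 0 := map_zero _
    rw [← h0] at hf
    exact ContDiffAt.comp (0 : κ → ℂ) hf (extendL e).contDiff.contDiffAt
  have key : ∀ (n : ℕ) (α : κ →₀ ℕ), α.degree = n → ∀ f : (ι → ℂ) → ℂ, ContDiffAt ℂ ∞ f 0 →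
      MvPowerSeries.coeff (α.mapDomain e) (taylor 0 f)
        = MvPowerSeries.coeff α (taylor 0 fun x => f (extendL e x)) := by
    intro n
    induction n with
    | zero =>
      intro α hα f hf
      rw [(Finsupp.degree_eq_zero_iff _).1 hα, Finsupp.mapDomain_zero, coeff_zero_taylor,
        coeff_zero_taylor, map_zero]
    | succ n ih =>
      intro α hα f hf
      have h0 : α ≠ 0 := by rintro rfl; simp at hα
      obtain ⟨i, β, rfl, hβ⟩ := exists_eq_add_single h0
      have h3 : ((β i : ℂ) + 1) ≠ 0 := Nat.cast_add_one_ne_zero _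
      apply mul_right_cancel₀ h3
      rw [← MvPowerSeries.coeff_pderiv, ← taylor_pd (hcomp hf), taylor_congr (pd_comp_extendL hf e i),
        ← ih β (by omega) _ (smooth_pd hf (e i)), taylor_pd hf, MvPowerSeries.coeff_pderiv,
        Finsupp.mapDomain_add, Finsupp.mapDomain_single, Finsupp.mapDomain_apply he]
  exact key _ α rfl f hf

theorem isSymm_taylor {f : (ι → ℂ) → ℂ} (hf : ContDiffAt ℂ ∞ f 0)
    (hs : ∀ (e : Equiv.Perm ι) x, f (fun i => x (e i)) = f x) : IsSymm (taylor 0 f) := by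
  intro e
  ext α
  rw [coeff_rename_perm, Finsupp.equivMapDomain_eq_mapDomain,
    coeff_taylor_extendL _ e.symm.injective α hf]
  congr 2
  funext x
  rw [← hs e x]
  congr 1
  funext j
  have := extendL_apply_image e.symm.injective x (e j)
  rwa [Equiv.symm_apply_apply] at this

end Restrict

end SymSeries

/-! ### One-variable Taylor series and the closed form of the limit. -/

namespace SymSeries

open Finset

section OneVariable

open scoped ContDiff

/-- The Taylor series at `c` of a function of one variable. -/
noncomputable def taylorOne (c : ℂ) (h : ℂ → ℂ) : PowerSeries ℂ :=
  PowerSeries.mk fun n => iteratedDeriv n h c / (n.factorial : ℂ)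

theorem smooth_comp_coord {N : ℕ} {h : ℂ → ℂ} {c : Fin N → ℂ} {i : Fin N}
    (hh : ContDiffAt ℂ ∞ h (c i)) : ContDiffAt ℂ ∞ (fun x : Fin N → ℂ => h (x i)) c :=
  hh.comp c (contDiff_apply ℂ ℂ i).contDiffAt

theorem pd_comp_coord {N : ℕ} {h : ℂ → ℂ} {c : Fin N → ℂ} {i : Fin N}
    (hh : ContDiffAt ℂ ∞ h (c i)) (l : Fin N) :
    pd l (fun x : Fin N → ℂ => h (x i)) =ᶠ[𝓝 c]
      fun x => if i = l then deriv h (x i) else 0 := by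
  have h1 : ∀ᶠ x in 𝓝 (c i), ContDiffAt ℂ 1 h x :=
    (hh.of_le ENat.LEInfty.out).eventually (by simp)
  have hc : Tendsto (fun x : Fin N → ℂ => x i) (𝓝 c) (𝓝 (c i)) := (continuous_apply i).tendsto c
  filter_upwards [hc.eventually h1] with x hx
  unfold pd
  have := (hx.differentiableAt one_ne_zero).hasDerivAt.comp_hasFDerivAt x
    (hasFDerivAt_apply (𝕜 := ℂ) i x)
  rw [show (fun x : Fin N → ℂ => h (x i)) = h ∘ fun x => x i from rfl, this.fderiv]
  simp [Pi.single_apply]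

theorem smooth_deriv {h : ℂ → ℂ} {c : ℂ} (hh : ContDiffAt ℂ ∞ h c) :
    ContDiffAt ℂ ∞ (deriv h) c :=
  (hh.fderiv_right (m := ∞) (by simp)).clm_apply (contDiffAt_const (c := (1 : ℂ)))

theorem taylor_comp_coord {N : ℕ} (i : Fin N) (c : Fin N → ℂ) {h : ℂ → ℂ}
    (hh : ContDiffAt ℂ ∞ h (c i)) :
    taylor c (fun x => h (x i)) = iota i (taylorOne (c i) h) := by
  have hstep : ∀ {h : ℂ → ℂ}, ContDiffAt ℂ ∞ h (c i) → ∀ l,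
      MvPowerSeries.pderiv ℂ l (taylor c fun x => h (x i))
        = if i = l then taylor c (fun x => deriv h (x i)) else 0 := by
    intro h hh l
    rw [← taylor_pd (smooth_comp_coord hh), taylor_congr (pd_comp_coord hh l)]
    split_ifs with hil
    · rfl
    · simpa using taylor_const c 0
  ext α
  by_cases hl : ∀ l, l ≠ i → α l = 0
  · rw [eq_single_of_forall hl, coeff_iota_single, taylorOne, PowerSeries.coeff_mk]
    generalize α i = n
    clear hl α
    induction n generalizing h with
    | zero => simp [coeff_zero_taylor]
    | succ n ih =>
      have h3 : ((n : ℂ) + 1) ≠ 0 := Nat.cast_add_one_ne_zero _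
      have h1 := ih (smooth_deriv hh)
      have h2 := MvPowerSeries.coeff_pderiv (i := i) (taylor c fun x => h (x i))
        (Finsupp.single i n)
      rw [hstep hh, if_pos rfl, h1, ← Finsupp.single_add, Finsupp.single_eq_same] at h2
      rw [iteratedDeriv_succ', Nat.factorial_succ]
      apply mul_right_cancel₀ h3
      rw [← h2]
      push_cast
      field_simp
  · push Not at hl
    obtain ⟨l, hli, hl0⟩ := hl
    rw [coeff_iota_eq_zero hli _ hl0]
    have hle : Finsupp.single l 1 ≤ α := by
      rw [Finsupp.single_le_iff]; exact Nat.one_le_iff_ne_zero.2 hl0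
    have h2 := MvPowerSeries.coeff_pderiv (i := l) (taylor c fun x => h (x i))
      (α - Finsupp.single l 1)
    rw [hstep hh, if_neg hli.symm, tsub_add_cancel_of_le hle, map_zero] at h2
    exact (mul_eq_zero.1 h2.symm).resolve_right (Nat.cast_add_one_ne_zero _)

theorem iota_injective {N : ℕ} (i : Fin N) : Function.Injective (iota i) := by
  intro f g h
  ext n
  rw [← coeff_iota_single i, h, coeff_iota_single]

theorem taylorOne_mul {c : ℂ} {f g : ℂ → ℂ} (hf : ContDiffAt ℂ ∞ f c) (hg : ContDiffAt ℂ ∞ g c) :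
    taylorOne c (fun z => f z * g z) = taylorOne c f * taylorOne c g := by
  apply iota_injective (0 : Fin 1)
  rw [map_mul, ← taylor_comp_coord (0 : Fin 1) (fun _ => c) hf,
    ← taylor_comp_coord (0 : Fin 1) (fun _ => c) hg,
    ← taylor_comp_coord (0 : Fin 1) (fun _ => c) (hf.mul hg),
    taylor_mul (smooth_comp_coord hf) (smooth_comp_coord hg)]

theorem taylorOne_one (c : ℂ) : taylorOne c (fun _ => 1) = 1 := by
  apply iota_injective (0 : Fin 1)
  rw [← taylor_comp_coord (0 : Fin 1) (fun _ => c) contDiffAt_const, taylor_const, map_one, map_one]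

theorem taylorOne_pow {c : ℂ} {f : ℂ → ℂ} (hf : ContDiffAt ℂ ∞ f c) (n : ℕ) :
    taylorOne c (fun z => f z ^ n) = taylorOne c f ^ n := by
  induction n with
  | zero => simpa using taylorOne_one c
  | succ n ih =>
    simp only [pow_succ]
    rw [taylorOne_mul (hf.pow n) hf, ih]

theorem smooth_polynomial_eval (p : Polynomial ℂ) (c : ℂ) :
    ContDiffAt ℂ ∞ (fun z => p.eval z) c := by
  simpa using (Polynomial.contDiff_aeval (𝕜 := ℂ) p ∞).contDiffAt

theorem taylorOne_polynomial (p : Polynomial ℂ) :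
    taylorOne 1 (fun z => p.eval z) = Polynomial.aeval (1 + PowerSeries.X) p := by
  apply iota_injective (0 : Fin 1)
  rw [← taylor_comp_coord (0 : Fin 1) (fun _ => 1) (smooth_polynomial_eval p _), ← atVar_eq_iota]
  have : (fun x : Fin 1 → ℂ => p.eval (x 0))
      = fun x => MvPolynomial.eval x (Polynomial.aeval (MvPolynomial.X 0) p) := by
    funext x
    rw [← MvPolynomial.coe_aeval_eq_eval, RingHom.coe_coe, ← Polynomial.aeval_algHom_apply]
    simp [Polynomial.aeval_def, Polynomial.eval₂_eq_eval_map]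
  rw [this, taylor_eval, ← Polynomial.aeval_algHom_apply, MvPolynomial.aeval_X, atVar]
  simp [add_comm]

theorem limitMoment_eq (k : ℕ) {h : ℂ → ℂ} (hh : ContDiffAt ℂ ∞ h 1) :
    limitMoment ((Polynomial.X ^ 2 - 1) ^ k) (2 * k) (taylorOne 1 h)
      = ∑ l ∈ range (2 * k + 1),
            ((2 * k).factorial : ℂ) /
                ((l.factorial : ℂ) * ((l + 1).factorial : ℂ) * ((2 * k - l).factorial : ℂ)) *
              iteratedDeriv l (fun z => (z ^ 2 - 1) ^ k * h z ^ (2 * k - l)) 1 := by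
  rw [limitMoment]
  refine sum_congr rfl fun m hm => ?_
  have hm' : m ≤ 2 * k := Nat.lt_succ_iff.1 (mem_range.1 hm)
  rw [← taylorOne_polynomial, ← taylorOne_pow hh,
    ← taylorOne_mul (smooth_polynomial_eval _ _) (hh.pow _), taylorOne, PowerSeries.coeff_mk]
  have e : (fun z => Polynomial.eval z ((Polynomial.X ^ 2 - 1) ^ k) * h z ^ (2 * k - m))
      = fun z => (z ^ 2 - 1) ^ k * h z ^ (2 * k - m) := by
    funext z; simp
  have hc : ((2 * k).choose m : ℂ) * (m.factorial * (2 * k - m).factorial) = (2 * k).factorial := by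
    rw [← mul_assoc]; exact_mod_cast Nat.choose_mul_factorial_mul_factorial hm'
  have h1 : (m.factorial : ℂ) ≠ 0 := Nat.cast_ne_zero.2 (Nat.factorial_ne_zero _)
  have h2 : ((2 * k - m).factorial : ℂ) ≠ 0 := Nat.cast_ne_zero.2 (Nat.factorial_ne_zero _)
  have h3 : ((m : ℂ) + 1) ≠ 0 := Nat.cast_add_one_ne_zero _
  rw [e, ← hc, Nat.factorial_succ]
  push_cast
  field_simp

end OneVariable

/-! ### The Joukowski change of variables near its branch point. -/

section ChangeOfVariables

open scoped ContDiff

/-- The function `(u + u⁻¹) / 2 - 1`. -/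
noncomputable def jou (u : ℂ) : ℂ := (u + u⁻¹) / 2 - 1

theorem jou_one : jou 1 = 0 := by simp [jou]

theorem hasDerivAt_jou {u : ℂ} (hu : u ≠ 0) : HasDerivAt jou ((1 - (u ^ 2)⁻¹) / 2) u := by
  have := (((hasDerivAt_id u).add (hasDerivAt_inv hu)).div_const 2).sub_const 1
  exact this.congr_deriv (by ring)

theorem smooth_jou {u : ℂ} (hu : u ≠ 0) : ContDiffAt ℂ ∞ jou u := by
  unfold jou
  exact ((contDiffAt_id.add (contDiffAt_inv ℂ hu)).div_const 2).sub contDiffAt_const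

variable {d : ℕ}

/-- The map `jou` applied to all coordinates. -/
noncomputable def jouMap (u : Fin d → ℂ) : Fin d → ℂ := fun i => jou (u i)

theorem jouMap_one : jouMap (fun _ : Fin d => (1 : ℂ)) = 0 := by
  funext i; exact jou_one

theorem smooth_jouMap : ContDiffAt ℂ ∞ (jouMap (d := d)) (fun _ => 1) := by
  rw [contDiffAt_pi]
  intro i
  exact (smooth_jou one_ne_zero).comp (fun _ : Fin d => (1 : ℂ)) (contDiff_apply ℂ ℂ i).contDiffAt

theorem smooth_comp_jouMap {g : (Fin d → ℂ) → ℂ} (hg : ContDiffAt ℂ ∞ g 0) :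
    ContDiffAt ℂ ∞ (fun u => g (jouMap u)) (fun _ => 1) := by
  rw [← jouMap_one (d := d)] at hg
  exact hg.comp _ smooth_jouMap

theorem eventually_coord_ne (i : Fin d) {a : ℂ} (ha : a ≠ 1) :
    ∀ᶠ u in 𝓝 (fun _ : Fin d => (1 : ℂ)), u i ≠ a :=
  (continuous_apply i).continuousAt.eventually_ne ha.symm

/-- The derivative of `jou` is (u - 1)(u + 1)/(2u²), with a simple zero at 1. The chain rule is
multiplied out so that only factors regular at 1 remain. -/
theorem pd_comp_jouMap {g : (Fin d → ℂ) → ℂ} (hg : ContDiffAt ℂ ∞ g 0) (i : Fin d) :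
    (fun u : Fin d → ℂ => (u i - 1) * pd i g (jouMap u)) =ᶠ[𝓝 (fun _ => 1)]
      fun u => 2 * u i ^ 2 / (u i + 1) * pd i (fun u => g (jouMap u)) u := by
  have h1 : ∀ᶠ x in 𝓝 (0 : Fin d → ℂ), ContDiffAt ℂ 1 g x :=
    (hg.of_le ENat.LEInfty.out).eventually (by simp)
  rw [← jouMap_one] at h1
  have h0 : ∀ᶠ u in 𝓝 (fun _ : Fin d => (1 : ℂ)), ∀ l, u l ≠ 0 :=
    eventually_all.2 fun l => eventually_coord_ne l zero_ne_one
  filter_upwards [smooth_jouMap.continuousAt.eventually h1, h0,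
    eventually_coord_ne i (a := -1) (by norm_num)] with u hu hu0 hui
  have hd : HasFDerivAt (jouMap (d := d)) (ContinuousLinearMap.pi fun l =>
      ((1 - (u l ^ 2)⁻¹) / 2) • ContinuousLinearMap.proj (R := ℂ) (φ := fun _ : Fin d => ℂ) l) u := by
    rw [hasFDerivAt_pi]
    intro l
    exact (hasDerivAt_jou (hu0 l)).comp_hasFDerivAt u (hasFDerivAt_apply (𝕜 := ℂ) l u)
  have hv : (ContinuousLinearMap.pi fun l => ((1 - (u l ^ 2)⁻¹) / 2) •
      ContinuousLinearMap.proj (R := ℂ) (φ := fun _ : Fin d => ℂ) l) (Pi.single i 1)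
        = ((1 - (u i ^ 2)⁻¹) / 2) • (Pi.single i 1 : Fin d → ℂ) := by
    funext l
    rcases eq_or_ne l i with rfl | h
    · simp
    · simp [h]
  have := (hu.differentiableAt one_ne_zero).hasFDerivAt.comp u hd
  unfold pd
  rw [show (fun u => g (jouMap u)) = g ∘ jouMap from rfl, this.fderiv,
    ContinuousLinearMap.comp_apply, hv, map_smul, smul_eq_mul]
  have h2 : u i + 1 ≠ 0 := fun h => hui (eq_neg_of_add_eq_zero_left h)
  have h3 := hu0 i
  field_simp
  ring

/-- The branched map cannot be inverted smoothly at 1, so the proof is by induction on the degree.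
By `pd_comp_jouMap` the coefficients of (u_i - 1) · (∂_i g)(jou u) tend to 0, and the factor u_i - 1
is the formal variable X i, which only shifts coefficients. Hence ∂_i g satisfies the same
hypothesis as g. -/
theorem tendsto_coeff_of_comp_jouMap (g : ℕ → (Fin d → ℂ) → ℂ)
    (hg : ∀ᶠ N in atTop, ContDiffAt ℂ ∞ (g N) 0)
    (h : ∀ α, Tendsto (fun N => MvPowerSeries.coeff α
      (taylor (fun _ => 1) fun u => g N (jouMap u))) atTop (𝓝 0)) (α : Fin d →₀ ℕ) :
    Tendsto (fun N => MvPowerSeries.coeff α (taylor 0 (g N))) atTop (𝓝 0) := by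
  have key : ∀ (n : ℕ) (α : Fin d →₀ ℕ), α.degree = n → ∀ g : ℕ → (Fin d → ℂ) → ℂ,
      (∀ᶠ N in atTop, ContDiffAt ℂ ∞ (g N) 0) →
      (∀ α, Tendsto (fun N => MvPowerSeries.coeff α
        (taylor (fun _ => 1) fun u => g N (jouMap u))) atTop (𝓝 0)) →
      Tendsto (fun N => MvPowerSeries.coeff α (taylor 0 (g N))) atTop (𝓝 0) := by
    intro n
    induction n with
    | zero =>
      intro α hα g hg h
      have := h 0
      rw [(Finsupp.degree_eq_zero_iff _).1 hα]
      simp only [coeff_zero_taylor, jouMap_one] at this ⊢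
      exact this
    | succ n ih =>
      intro α hα g hg h
      have h0 : α ≠ 0 := by rintro rfl; simp at hα
      obtain ⟨i, β, rfl, hβ⟩ := exists_eq_add_single h0
      have h3 : ((β i : ℂ) + 1) ≠ 0 := Nat.cast_add_one_ne_zero _
      have key2 : Tendsto (fun N => MvPowerSeries.coeff β (taylor 0 (pd i (g N)))) atTop
          (𝓝 0) := by
        refine ih β (by omega) _ (hg.mono fun N hN => smooth_pd hN i) fun γ => ?_
        set H : MvPowerSeries (Fin d) ℂ :=
          taylor (fun _ => 1) fun u : Fin d → ℂ => 2 * u i ^ 2 / (u i + 1) with hH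
        have hHs : ContDiffAt ℂ ∞ (fun u : Fin d → ℂ => 2 * u i ^ 2 / (u i + 1)) (fun _ => 1) := by
          refine ContDiffAt.div ?_ ?_ ?_
          · fun_prop
          · fun_prop
          · norm_num
        have hP : Tendsto (fun N => MvPowerSeries.coeff (γ + Finsupp.single i 1)
            (H * MvPowerSeries.pderiv ℂ i (taylor (fun _ => 1) fun u => g N (jouMap u))))
            atTop (𝓝 0) := by
          simp only [MvPowerSeries.coeff_mul]
          rw [← sum_const_zero (s := antidiagonal (γ + Finsupp.single i 1))]
          refine tendsto_finsetSum _ fun p _ => ?_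
          simp only [MvPowerSeries.coeff_pderiv]
          have := (h (p.2 + Finsupp.single i 1)).mul_const ((p.2 i : ℂ) + 1)
          simpa using this.const_mul (MvPowerSeries.coeff p.1 H)
        refine hP.congr' ?_
        filter_upwards [hg] with N hN
        have hs1 : ContDiffAt ℂ ∞ (fun u : Fin d → ℂ => u i - 1) (fun _ => 1) := by fun_prop
        have hs2 := smooth_comp_jouMap (smooth_pd hN i)
        have e := taylor_congr (pd_comp_jouMap hN i)
        rw [taylor_mul hs1 hs2, taylor_mul hHs (smooth_pd (smooth_comp_jouMap hN) i),
          taylor_pd (smooth_comp_jouMap hN), taylor_sub (contDiff_apply ℂ ℂ i).contDiffAt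
            contDiffAt_const, taylor_coord, taylor_const, add_sub_cancel_right] at e
        rw [← e, coeff_X_mul_ite, if_neg (by simp), add_tsub_cancel_right]
      have h4 := key2.mul_const ((β i : ℂ) + 1)⁻¹
      rw [zero_mul] at h4
      refine h4.congr' ?_
      filter_upwards [hg] with N hN
      rw [taylor_pd hN, MvPowerSeries.coeff_pderiv, mul_inv_cancel_right₀ h3]
  exact key _ α rfl g hg h

end ChangeOfVariables

/-! ### Functions invariant under inversion. -/

section EvenFunctions

/-- Take h(s) = q(√s) with the principal root. Across the negative axis √s may be replaced by
i√(-s), which does not change the value since q is even. So h is holomorphic off 0 and continuous at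
0, and the singularity is removable. -/
theorem exists_analytic_of_even {q : ℂ → ℂ} (hq : AnalyticAt ℂ q 0)
    (he : ∀ᶠ v in 𝓝 0, q (-v) = q v) :
    ∃ h : ℂ → ℂ, AnalyticAt ℂ h 0 ∧ ∀ᶠ v in 𝓝 0, h (v ^ 2) = q v := by
  set rt : ℂ → ℂ := fun s => s ^ ((2 : ℂ)⁻¹) with hrt
  have hsq : ∀ s, rt s ^ 2 = s := fun s => by
    rw [hrt]; exact_mod_cast Complex.cpow_nat_inv_pow s two_ne_zero
  have hrt0 : rt 0 = 0 := by rw [hrt]; simp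
  have hrtc : ContinuousAt rt 0 := by
    have := Complex.continuousAt_cpow_const_of_re_pos (z := 0) (w := (2 : ℂ)⁻¹) (Or.inl le_rfl)
      (by norm_num)
    exact this
  have hrtd : ∀ s ∈ Complex.slitPlane, DifferentiableAt ℂ rt s := fun s hs =>
    differentiableAt_id.cpow_const hs
  have hgood : ∀ᶠ v in 𝓝 (0 : ℂ), DifferentiableAt ℂ q v ∧ q (-v) = q v :=
    (hq.eventually_analyticAt.mono fun v hv => hv.differentiableAt).and he
  have hgood2 : ∀ᶠ v in 𝓝 (0 : ℂ), ∀ w, w ^ 2 = v ^ 2 → q w = q v := by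
    filter_upwards [he] with v hv w hw
    rcases sq_eq_sq_iff_eq_or_eq_neg.1 hw with rfl | rfl
    · rfl
    · exact hv
  have hrtc' : Tendsto rt (𝓝 0) (𝓝 0) := by
    have := hrtc.tendsto; rwa [hrt0] at this
  refine ⟨fun s => q (rt s), ?_, ?_⟩
  · apply Complex.analyticAt_of_differentiable_on_punctured_nhds_of_continuousAt
    · have h1 := hrtc'.eventually (hgood.and hgood2)
      have hI : Tendsto (fun s => Complex.I * rt (-s)) (𝓝 0) (𝓝 0) := by
        have h2 : Tendsto (fun s : ℂ => -s) (𝓝 0) (𝓝 0) := by simpa using tendsto_neg (0 : ℂ)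
        simpa using (hrtc'.comp h2).const_mul Complex.I
      have h2 := hI.eventually (hgood.and hgood2)
      rw [eventually_nhdsWithin_iff]
      filter_upwards [h1, h2, h1.eventually_nhds, h2.eventually_nhds] with s hs1 hs2 _ hs2' hs0
      by_cases hslit : s ∈ Complex.slitPlane
      · exact hs1.1.1.comp s (hrtd s hslit)
      · have hneg : -s ∈ Complex.slitPlane := by
          rw [Complex.mem_slitPlane_iff] at hslit ⊢
          push Not at hslit
          left
          rw [Complex.neg_re]
          rcases lt_or_eq_of_le hslit.1 with h | h
          · linarith
          · exact absurd (Complex.ext h hslit.2) hs0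
        have hd : DifferentiableAt ℂ (fun s => q (Complex.I * rt (-s))) s := by
          refine DifferentiableAt.comp (f := fun s => Complex.I * rt (-s)) s hs2.1.1 ?_
          exact (DifferentiableAt.comp s (hrtd _ hneg) differentiableAt_id.neg).const_mul _
        refine hd.congr_of_eventuallyEq ?_
        filter_upwards [hs2'] with t ht
        apply ht.2
        rw [hsq, mul_pow, hsq, Complex.I_sq]; ring
    · have : ContinuousAt q (rt 0) := by rw [hrt0]; exact hq.continuousAt
      exact ContinuousAt.comp this hrtc
  · filter_upwards [hgood2] with v hv
    exact hv _ (hsq _)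

/-- Under the Cayley transform u = (1 + v)/(1 - v) inversion becomes v ↦ -v, and v² = (z - 1)/(z +
1) for z = (u + u⁻¹)/2. The claim reduces to even functions. -/
theorem exists_analytic_joukowski {Q : ℂ → ℂ} (hQ : AnalyticAt ℂ Q 1)
    (he : ∀ᶠ u in 𝓝 1, Q u⁻¹ = Q u) :
    ∃ Qhat : ℂ → ℂ, AnalyticAt ℂ Qhat 1 ∧ ∀ᶠ u in 𝓝 (1 : ℂ), Qhat ((u + u⁻¹) / 2) = Q u := by
  have hφ : AnalyticAt ℂ (fun v : ℂ => (1 + v) / (1 - v)) 0 :=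
    (analyticAt_const.add analyticAt_id).div (analyticAt_const.sub analyticAt_id) (by simp)
  have hφ0 : (1 + (0 : ℂ)) / (1 - 0) = 1 := by simp
  have hq : AnalyticAt ℂ (fun v : ℂ => Q ((1 + v) / (1 - v))) 0 := by
    refine AnalyticAt.comp (g := Q) (f := fun v : ℂ => (1 + v) / (1 - v)) ?_ hφ
    rw [hφ0]; exact hQ
  obtain ⟨h, hh, hhq⟩ := exists_analytic_of_even hq (by
    have := hφ.continuousAt.tendsto
    rw [hφ0] at this
    filter_upwards [this.eventually he] with v hv
    rw [← hv, inv_div, sub_neg_eq_add, ← sub_eq_add_neg])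
  refine ⟨fun z => h ((z - 1) / (z + 1)), ?_, ?_⟩
  · refine AnalyticAt.comp (g := h) (f := fun z : ℂ => (z - 1) / (z + 1)) (by simpa using hh) ?_
    exact (analyticAt_id.sub analyticAt_const).div (analyticAt_id.add analyticAt_const)
      (by norm_num)
  · have hc : Tendsto (fun u : ℂ => (u - 1) / (u + 1)) (𝓝 1) (𝓝 0) := by
      have : ContinuousAt (fun u : ℂ => (u - 1) / (u + 1)) 1 :=
        ContinuousAt.div (by fun_prop) (by fun_prop) (by norm_num)
      simpa [ContinuousAt] using this
    filter_upwards [hc.eventually hhq, continuousAt_id.eventually_ne (zero_ne_one' ℂ).symm,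
      continuousAt_id.eventually_ne (show (1 : ℂ) ≠ -1 by norm_num)] with u hu hu0 hu1
    have hu0' : u ≠ 0 := hu0
    have hu2 : u + 1 ≠ 0 := fun h => hu1 (eq_neg_of_add_eq_zero_left h)
    have e1 : ((u + u⁻¹) / 2 - 1) / ((u + u⁻¹) / 2 + 1) = ((u - 1) / (u + 1)) ^ 2 := by
      have h3 : (u + u⁻¹) / 2 + 1 = (u + 1) ^ 2 / (2 * u) := by field_simp; ring
      have h4 : (u + u⁻¹) / 2 - 1 = (u - 1) ^ 2 / (2 * u) := by field_simp; ring
      rw [h3, h4]; field_simp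
    rw [e1, hu]
    congr 1
    have h5 : 1 - (u - 1) / (u + 1) = 2 / (u + 1) := by field_simp; ring
    have h6 : 1 + (u - 1) / (u + 1) = 2 * u / (u + 1) := by field_simp; ring
    rw [h5, h6]; field_simp

/-- The neighbourhood on which ℓ N is invariant may shrink with N. The identity theorem extends the
invariance to one fixed ball, on which the limit can be taken. -/
theorem eventually_inv_eq_of_tendsto {Q : ℂ → ℂ} {ℓ : ℕ → ℂ → ℂ} {r : ℝ} (hr : 0 < r)
    (hℓ : ∀ᶠ N in atTop, DifferentiableOn ℂ (ℓ N) (Metric.ball 1 r))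
    (hinv : ∀ᶠ N in atTop, ∀ᶠ u in 𝓝 1, ℓ N u⁻¹ = ℓ N u)
    (hlim : ∀ u ∈ Metric.ball (1 : ℂ) r, Tendsto (fun N => ℓ N u) atTop (𝓝 (Q u))) :
    ∀ᶠ u in 𝓝 1, Q u⁻¹ = Q u := by
  have hci : ContinuousAt (fun u : ℂ => u⁻¹) 1 := continuousAt_inv₀ one_ne_zero
  have h1 : ∀ᶠ u in 𝓝 (1 : ℂ), u⁻¹ ∈ Metric.ball (1 : ℂ) r ∧ u ∈ Metric.ball (1 : ℂ) r ∧ u ≠ 0 := by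
    refine Eventually.and ?_ (Eventually.and (Metric.ball_mem_nhds _ hr)
      (continuousAt_id.eventually_ne one_ne_zero))
    have := hci.tendsto
    rw [inv_one] at this
    exact this.eventually (Metric.ball_mem_nhds _ hr)
  obtain ⟨δ, hδ, hball⟩ := Metric.eventually_nhds_iff_ball.1 h1
  filter_upwards [Metric.ball_mem_nhds _ hδ] with u hu
  obtain ⟨hu1, hu2, _⟩ := hball u hu
  refine tendsto_nhds_unique (hlim _ hu1) ((hlim _ hu2).congr' ?_)
  filter_upwards [hℓ, hinv] with N hd hi
  have ha : AnalyticOnNhd ℂ (ℓ N) (Metric.ball 1 δ) := by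
    refine DifferentiableOn.analyticOnNhd (hd.mono fun x hx => (hball x hx).2.1) Metric.isOpen_ball
  have hb : AnalyticOnNhd ℂ (fun u => ℓ N u⁻¹) (Metric.ball 1 δ) := by
    refine DifferentiableOn.analyticOnNhd ?_ Metric.isOpen_ball
    intro x hx
    have h2 := hball x hx
    refine DifferentiableAt.differentiableWithinAt ?_
    exact (hd.differentiableAt (Metric.isOpen_ball.mem_nhds h2.1)).comp x
      (differentiableAt_inv h2.2.2)
  exact (ha.eqOn_of_preconnected_of_eventuallyEq hb (convex_ball 1 δ).isPreconnected
    (Metric.mem_ball_self hδ) (hi.mono fun x hx => hx.symm)) hu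

end EvenFunctions

end SymSeries

/-! ### Alternants and their quotients by the Vandermonde product. -/

namespace SymSeries

open Finset

section Alternants

variable {R : Type*} [CommRing R]

theorem exists_newton_expansion (x : ℕ → R) (p : Polynomial R) (n : ℕ) :
    ∃ (c : ℕ → R) (r : Polynomial R),
      p = ∑ k ∈ range n, Polynomial.C (c k) * ∏ l ∈ range k, (Polynomial.X - Polynomial.C (x l))
        + r * ∏ l ∈ range n, (Polynomial.X - Polynomial.C (x l)) := by
  induction n with
  | zero => exact ⟨fun _ => 0, p, by simp⟩
  | succ n ih =>
    obtain ⟨c, r, h⟩ := ih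
    obtain ⟨r', hr'⟩ := Polynomial.X_sub_C_dvd_sub_C_eval (p := r) (a := x n)
    refine ⟨fun k => if k = n then r.eval (x n) else c k, r', ?_⟩
    have e : ∑ k ∈ range n, Polynomial.C (if k = n then r.eval (x n) else c k)
          * ∏ l ∈ range k, (Polynomial.X - Polynomial.C (x l))
        = ∑ k ∈ range n, Polynomial.C (c k)
          * ∏ l ∈ range k, (Polynomial.X - Polynomial.C (x l)) :=
      sum_congr rfl fun k hk => by rw [if_neg (mem_range.1 hk).ne]
    rw [sum_range_succ, prod_range_succ, e]
    simp only [if_true]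
    have hr : r = Polynomial.C (r.eval (x n)) + (Polynomial.X - Polynomial.C (x n)) * r' := by
      rw [← hr']; ring
    conv_lhs => rw [h, hr]
    ring

/-- Newton interpolation at the nodes factors the matrix into a lower triangular matrix and a matrix
of coefficients; the remainder vanishes at every node. The triangular determinant is the Vandermonde
product up to sign. No division is used, so any commutative ring is allowed. -/
theorem prod_sub_dvd_det_eval {n : ℕ} (x : Fin n → R) (P : Fin n → Polynomial R) :
    (∏ i, ∏ j ∈ Ioi i, (x i - x j)) ∣ (Matrix.of fun i j => (P j).eval (x i)).det := by
  set y : ℕ → R := fun l => if h : l < n then x ⟨l, h⟩ else 0 with hy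
  have hyx : ∀ i : Fin n, y i = x i := fun i => by simp [hy]
  choose c r h using fun j => exists_newton_expansion y (P j) n
  set L : Matrix (Fin n) (Fin n) R := Matrix.of fun i k => ∏ l ∈ range k, (x i - y l) with hL
  have hzero : ∀ (i : Fin n) (k : ℕ), (i : ℕ) < k → ∏ l ∈ range k, (x i - y l) = 0 :=
    fun i k hik => prod_eq_zero (mem_range.2 hik) (by rw [hyx, sub_self])
  have hmul : (Matrix.of fun i j => (P j).eval (x i)) = L * Matrix.of fun (k : Fin n) j => c j k := by
    ext i j
    rw [Matrix.mul_apply, Matrix.of_apply, h j]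
    simp only [Polynomial.eval_add, Polynomial.eval_mul, Polynomial.eval_finsetSum,
      Polynomial.eval_prod, Polynomial.eval_sub, Polynomial.eval_X, Polynomial.eval_C, hL,
      Matrix.of_apply]
    rw [hzero i n i.2, mul_zero, add_zero, ← Fin.sum_univ_eq_sum_range
      (fun k => c j k * ∏ l ∈ range k, (x i - y l))]
    exact sum_congr rfl fun k _ => mul_comm _ _
  have htri : L.det = ∏ i : Fin n, ∏ l ∈ Iio i, (x i - x l) := by
    rw [Matrix.det_of_isLowerTriangular]
    · refine prod_congr rfl fun i _ => ?_
      rw [hL, Matrix.of_apply]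
      symm
      refine prod_bij (fun l _ => (l : ℕ)) (fun l hl => mem_range.2 (Fin.lt_def.1 (mem_Iio.1 hl)))
        (fun a _ b _ hab => Fin.ext hab) (fun b hb => ?_) fun l _ => by rw [hyx]
      exact ⟨⟨b, (mem_range.1 hb).trans i.2⟩, mem_Iio.2 (mem_range.1 hb), rfl⟩
    · intro i k hik
      exact hzero i k hik
  have hV : ∏ i : Fin n, ∏ l ∈ Iio i, (x i - x l)
      = (∏ i : Fin n, ∏ j ∈ Ioi i, (-1)) * ∏ i, ∏ j ∈ Ioi i, (x i - x j) := by
    rw [prod_comm' (t' := univ) (s' := fun l => Ioi l) (by simp), ← prod_mul_distrib]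
    refine prod_congr rfl fun i _ => ?_
    rw [← prod_mul_distrib]
    exact prod_congr rfl fun j _ => by ring
  rw [hmul, Matrix.det_mul, htri, hV]
  exact (Dvd.intro_left _ rfl).mul_right _

variable {N : ℕ}

/-- The polynomial `p` evaluated at `1 + X i`. -/
noncomputable def atCoord (i : Fin N) : Polynomial ℂ →ₐ[ℂ] MvPolynomial (Fin N) ℂ :=
  Polynomial.aeval (1 + MvPolynomial.X i)

theorem eval_atCoord (w : Fin N → ℂ) (i : Fin N) (p : Polynomial ℂ) :
    MvPolynomial.eval w (atCoord i p) = p.eval (1 + w i) := by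
  rw [atCoord, ← MvPolynomial.coe_aeval_eq_eval, RingHom.coe_coe, ← Polynomial.aeval_algHom_apply]
  simp [Polynomial.aeval_def, Polynomial.eval₂_eq_eval_map]

theorem rename_atCoord (e : Equiv.Perm (Fin N)) (i : Fin N) (p : Polynomial ℂ) :
    MvPolynomial.rename e (atCoord i p) = atCoord (e i) p := by
  rw [atCoord, atCoord, ← Polynomial.aeval_algHom_apply]
  simp

theorem exists_alternant_factor (P : Fin N → Polynomial ℂ) : ∃ g : MvPolynomial (Fin N) ℂ,
    (Matrix.of fun i j => atCoord i (P j)).det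
      = (∏ i, ∏ j ∈ Ioi i, (MvPolynomial.X i - MvPolynomial.X j)) * g := by
  have h := prod_sub_dvd_det_eval (fun i : Fin N => (1 + MvPolynomial.X i : MvPolynomial (Fin N) ℂ))
    fun j => (P j).map (algebraMap ℂ _)
  simp only [add_sub_add_left_eq_sub, Polynomial.eval_map_algebraMap] at h
  exact h

/-- The symmetric polynomial `det (P j (1 + X i)) / ∏ i < j, (X i - X j)`. -/
noncomputable def alternantQuotient (P : Fin N → Polynomial ℂ) : MvPolynomial (Fin N) ℂ :=
  (exists_alternant_factor P).choose

theorem alternantQuotient_spec (P : Fin N → Polynomial ℂ) :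
    (Matrix.of fun i j => atCoord i (P j)).det
      = (∏ i, ∏ j ∈ Ioi i, (MvPolynomial.X i - MvPolynomial.X j)) * alternantQuotient P :=
  (exists_alternant_factor P).choose_spec

theorem eval_alternantQuotient (P : Fin N → Polynomial ℂ) (w : Fin N → ℂ) :
    (Matrix.of fun i j => (P j).eval (1 + w i)).det
      = (∏ i, ∏ j ∈ Ioi i, (w i - w j)) * MvPolynomial.eval w (alternantQuotient P) := by
  have h := congrArg (MvPolynomial.eval w) (alternantQuotient_spec P)
  rw [RingHom.map_det, map_mul, map_prod] at h
  simp only [map_prod, map_sub, MvPolynomial.eval_X] at h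
  rw [← h]
  congr 1
  ext i j
  simp [eval_atCoord]

/-- A permutation of the variables multiplies both the alternant and the Vandermonde determinant by
its sign. -/
theorem rename_alternantQuotient (P : Fin N → Polynomial ℂ) (e : Equiv.Perm (Fin N)) :
    MvPolynomial.rename e (alternantQuotient P) = alternantQuotient P := by
  set V : MvPolynomial (Fin N) ℂ := (Matrix.vandermonde MvPolynomial.X).det with hV
  set c : MvPolynomial (Fin N) ℂ := ∏ i : Fin N, ∏ j ∈ Ioi i, (-1) with hc
  have hcV : ∏ i : Fin N, ∏ j ∈ Ioi i, (MvPolynomial.X i - MvPolynomial.X j) = c * V := by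
    rw [hV, hc, Matrix.det_vandermonde, ← prod_mul_distrib]
    refine prod_congr rfl fun i _ => ?_
    rw [← prod_mul_distrib]
    exact prod_congr rfl fun j _ => by ring
  have hc0 : c ≠ 0 := prod_ne_zero_iff.2 fun i _ => prod_ne_zero_iff.2 fun j _ => by simp
  have hV0 : V ≠ 0 := Matrix.det_vandermonde_ne_zero_iff.2 (MvPolynomial.X_injective)
  have hrc : MvPolynomial.rename e c = c := by simp [hc]
  have hdet : ∀ M : Matrix (Fin N) (Fin N) (MvPolynomial (Fin N) ℂ),
      (∀ i j, MvPolynomial.rename e (M i j) = M (e i) j) →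
      MvPolynomial.rename e M.det = (Equiv.Perm.sign e : MvPolynomial (Fin N) ℂ) * M.det := by
    intro M hM
    rw [← Matrix.det_permute, AlgHom.map_det]
    congr 1
    ext1 i j
    exact hM i j
  have h1 := hdet (Matrix.vandermonde MvPolynomial.X) fun i j => by simp [Matrix.vandermonde_apply]
  have h2 := hdet (Matrix.of fun i j => atCoord i (P j)) fun i j => rename_atCoord e i (P j)
  rw [alternantQuotient_spec, hcV, map_mul, map_mul, hrc, h1] at h2
  have hs : (Equiv.Perm.sign e : MvPolynomial (Fin N) ℂ) ≠ 0 := by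
    rcases Int.units_eq_one_or (Equiv.Perm.sign e) with h | h <;> simp [h]
  refine mul_left_cancel₀ (mul_ne_zero (mul_ne_zero hc0 hs) hV0) ?_
  linear_combination h2

theorem isSymm_taylor_alternantQuotient (P : Fin N → Polynomial ℂ) :
    IsSymm (taylor 0 fun w => MvPolynomial.eval w (alternantQuotient P)) := by
  refine isSymm_taylor (smooth_eval _ _) fun e x => ?_
  conv_rhs => rw [← rename_alternantQuotient P e]
  rw [MvPolynomial.eval_rename]
  rfl

theorem vandermonde_mul_taylor_alternantQuotient (P : Fin N → Polynomial ℂ) :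
    vandermonde N * taylor 0 (fun w => MvPolynomial.eval w (alternantQuotient P))
      = (Matrix.of fun i j => atVar i (P j)).det := by
  have h := congrArg (MvPolynomial.aeval (fun i : Fin N =>
    (MvPowerSeries.X i : MvPowerSeries (Fin N) ℂ))) (alternantQuotient_spec P)
  rw [AlgHom.map_det, map_mul, map_prod] at h
  simp only [map_prod, map_sub, MvPolynomial.aeval_X] at h
  rw [taylor_eval]
  simp only [Pi.zero_apply, map_zero, add_zero]
  rw [vandermonde, ← h]
  congr 1
  ext1 i j
  simp [atCoord, atVar, ← Polynomial.aeval_algHom_apply]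

end Alternants

/-! ### Chebyshev polynomials and their differential equations. -/

section Chebyshev

open Polynomial.Chebyshev

/-- The recurrence can be run in both directions, so two consecutive values determine a sequence on
ℤ. All expressions of Weyl numerator entries by Chebyshev polynomials are obtained this way. -/
theorem eq_of_int_recurrence {z : ℂ} {a b : ℤ → ℂ} (ha : ∀ n, a (n + 2) = 2 * z * a (n + 1) - a n)
    (hb : ∀ n, b (n + 2) = 2 * z * b (n + 1) - b n) (h0 : a 0 = b 0) (h1 : a 1 = b 1) (n : ℤ) :
    a n = b n := by
  induction n using Polynomial.Chebyshev.induct with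
  | zero => exact h0
  | one => exact h1
  | add_two n h1 h2 => rw [ha, hb, h1, h2]
  | neg_add_one n h1 h2 =>
    have e1 := ha (-n - 1)
    have e2 := hb (-n - 1)
    rw [show (-(n : ℤ) - 1 + 2) = -n + 1 by ring, show (-(n : ℤ) - 1 + 1) = -n by ring] at e1 e2
    rw [h1, h2] at e1
    linear_combination e1 - e2

theorem zpow_recurrence {u : ℂ} (hu : u ≠ 0) (n : ℤ) :
    u ^ (n + 2) = (u + u⁻¹) * u ^ (n + 1) - u ^ n := by
  rw [zpow_add₀ hu, zpow_add₀ hu]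
  simp only [zpow_ofNat]
  field_simp
  ring

theorem zpow_neg_recurrence {u : ℂ} (hu : u ≠ 0) (n : ℤ) :
    u ^ (-(n + 2)) = (u + u⁻¹) * u ^ (-(n + 1)) - u ^ (-n) := by
  simpa only [inv_zpow', inv_inv, add_comm u⁻¹ u] using zpow_recurrence (inv_ne_zero hu) n

theorem zpow_add_zpow_neg {u : ℂ} (hu : u ≠ 0) (n : ℤ) :
    u ^ n + u ^ (-n) = (2 * T ℂ n).eval ((u + u⁻¹) / 2) := by
  refine eq_of_int_recurrence (z := (u + u⁻¹) / 2) (a := fun n => u ^ n + u ^ (-n))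
    (b := fun n => (2 * T ℂ n).eval ((u + u⁻¹) / 2)) (fun n => ?_) (fun n => ?_) ?_ ?_ n
  · linear_combination zpow_recurrence hu n + zpow_neg_recurrence hu n
  · simp [T_add_two]; ring
  · simp; norm_num
  · simp; ring

theorem zpow_sub_zpow_neg {u : ℂ} (hu : u ≠ 0) (n : ℤ) :
    u ^ n - u ^ (-n) = (u - u⁻¹) * (U ℂ (n - 1)).eval ((u + u⁻¹) / 2) := by
  refine eq_of_int_recurrence (z := (u + u⁻¹) / 2) (a := fun n => u ^ n - u ^ (-n))
    (b := fun n => (u - u⁻¹) * (U ℂ (n - 1)).eval ((u + u⁻¹) / 2)) (fun n => ?_) (fun n => ?_) ?_ ?_ n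
  · linear_combination zpow_recurrence hu n - zpow_neg_recurrence hu n
  · have := U_add_two ℂ (n - 1)
    rw [show n + 2 - 1 = n - 1 + 2 by ring, show n + 1 - 1 = n - 1 + 1 by ring, this]
    simp; ring
  · simp
  · simp

theorem zpow_succ_sub_zpow_neg {u : ℂ} (hu : u ≠ 0) (n : ℤ) :
    u ^ (n + 1) - u ^ (-n) = (u - 1) * (U ℂ n + U ℂ (n - 1)).eval ((u + u⁻¹) / 2) := by
  refine eq_of_int_recurrence (z := (u + u⁻¹) / 2) (a := fun n => u ^ (n + 1) - u ^ (-n))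
    (b := fun n => (u - 1) * (U ℂ n + U ℂ (n - 1)).eval ((u + u⁻¹) / 2))
    (fun n => ?_) (fun n => ?_) ?_ ?_ n
  · have := zpow_recurrence hu (n + 1)
    rw [show n + 2 + 1 = n + 1 + 2 by ring]
    linear_combination this - zpow_neg_recurrence hu n
  · have := U_add_two ℂ (n - 1)
    rw [show n + 2 - 1 = n - 1 + 2 by ring, show n + 1 - 1 = n - 1 + 1 by ring, this, U_add_two ℂ n]
    simp; ring
  · simp
  · simp; field_simp; ring

theorem chebyshev_T_ode (n : ℤ) :
    (Polynomial.X ^ 2 - 1) * (2 * T ℂ n).derivative.derivative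
      + Polynomial.X * (2 * T ℂ n).derivative = Polynomial.C ((n : ℂ) ^ 2) * (2 * T ℂ n) := by
  have h := one_sub_X_sq_mul_derivative_derivative_T_eq_poly_in_T (R := ℂ) n
  simp only [Function.iterate_succ, Function.iterate_zero, Function.comp_apply, id] at h
  have e : (2 * T ℂ n).derivative = 2 * (T ℂ n).derivative := by simp [Polynomial.derivative_mul]
  have e' : (2 * (T ℂ n).derivative).derivative = 2 * (T ℂ n).derivative.derivative := by
    simp [Polynomial.derivative_mul]
  rw [e, e']
  simp only [map_pow, map_intCast]
  linear_combination -2 * h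

theorem chebyshev_U_ode (n : ℤ) :
    (Polynomial.X ^ 2 - 1) * (U ℂ n).derivative.derivative
      + 3 * Polynomial.X * (U ℂ n).derivative + U ℂ n
      = Polynomial.C (((n : ℂ) + 1) ^ 2) * U ℂ n := by
  have h := one_sub_X_sq_mul_derivative_derivative_U_eq_poly_in_U (R := ℂ) n
  simp only [Function.iterate_succ, Function.iterate_zero, Function.comp_apply, id] at h
  simp only [map_pow, map_intCast, map_add, map_one]
  linear_combination -h

theorem X_add_one_ne_zero : (Polynomial.X + 1 : Polynomial ℂ) ≠ 0 := by
  simpa using Polynomial.X_add_C_ne_zero (1 : ℂ)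

theorem chebyshev_U_add_U_first_order (n : ℤ) :
    (Polynomial.X - 1) * (U ℂ n + U ℂ (n - 1)).derivative
      = (n : Polynomial ℂ) * U ℂ n - ((n : Polynomial ℂ) + 1) * U ℂ (n - 1) := by
  have h1 := add_one_mul_T_eq_poly_in_U (R := ℂ) n
  have h2 := add_one_mul_T_eq_poly_in_U (R := ℂ) (n - 1)
  have h3 := T_eq_U_sub_X_mul_U ℂ (n + 1)
  have h4 := T_eq_U_sub_X_mul_U ℂ n
  have h5 := U_add_one ℂ n
  rw [show n + 1 - 1 = n by ring] at h3
  rw [show n - 1 + 1 = n by ring] at h2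
  push_cast at h1 h2
  refine mul_left_cancel₀ X_add_one_ne_zero ?_
  rw [Polynomial.derivative_add]
  linear_combination -h1 - h2 + ((n : Polynomial ℂ) + 1) * h3 + (n : Polynomial ℂ) * h4
    + ((n : Polynomial ℂ) + 1) * h5

/-- Differentiate the first-order relation and eliminate the derivatives of the individual U by
means of the relations between T and U. The computation is carried out after multiplication by X -
1, which is then cancelled. -/
theorem chebyshev_U_add_U_ode (n : ℤ) :
    (Polynomial.X ^ 2 - 1) * (U ℂ n + U ℂ (n - 1)).derivative.derivative
      + (2 * Polynomial.X + 1) * (U ℂ n + U ℂ (n - 1)).derivative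
      + Polynomial.C (1 / 4) * (U ℂ n + U ℂ (n - 1))
      = Polynomial.C (((n : ℂ) + 1 / 2) ^ 2) * (U ℂ n + U ℂ (n - 1)) := by
  have h0 := chebyshev_U_add_U_first_order n
  have h := congrArg Polynomial.derivative h0
  have h1 := add_one_mul_T_eq_poly_in_U (R := ℂ) n
  have h2 := add_one_mul_T_eq_poly_in_U (R := ℂ) (n - 1)
  have h3 := T_eq_U_sub_X_mul_U ℂ (n + 1)
  have h4 := T_eq_U_sub_X_mul_U ℂ n
  have h5 := U_add_one ℂ n
  rw [show n + 1 - 1 = n by ring] at h3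
  rw [show n - 1 + 1 = n by ring] at h2
  push_cast at h1 h2
  have hc : Polynomial.C (((n : ℂ) + 1 / 2) ^ 2)
      = (n : Polynomial ℂ) ^ 2 + (n : Polynomial ℂ) + Polynomial.C (1 / 4) := by
    rw [show ((n : ℂ) + 1 / 2) ^ 2 = (n : ℂ) ^ 2 + n + 1 / 4 by ring]
    simp
  rw [hc]
  simp only [Polynomial.derivative_mul, Polynomial.derivative_sub, Polynomial.derivative_add,
    Polynomial.derivative_X, Polynomial.derivative_one, Polynomial.derivative_intCast] at h h0 ⊢
  have hX : (Polynomial.X - 1 : Polynomial ℂ) ≠ 0 := by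
    simpa using Polynomial.X_sub_C_ne_zero (1 : ℂ)
  refine mul_left_cancel₀ hX ?_
  linear_combination (Polynomial.X ^ 2 - 1) * h - (n : Polynomial ℂ) * h1
    + ((n : Polynomial ℂ) + 1) * h2 + Polynomial.X * h0
    + (n : Polynomial ℂ) * ((n : Polynomial ℂ) + 1) * (h3 - h4 + h5)

end Chebyshev

end SymSeries

/-! ### Characters as polynomials in the Joukowski variables. -/

namespace SymSeries

open Finset

section Characters

open Polynomial.Chebyshev

variable {N : ℕ}

/-- The polynomial in `(u + u⁻¹) / 2` attached to the exponent `m` in the Weyl numerator. -/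
noncomputable def basePoly (G : Series) (m : ℤ) : Polynomial ℂ :=
  match G with
  | .B => U ℂ m + U ℂ (m - 1)
  | .C => U ℂ m
  | .D => 2 * T ℂ m

/-- The constant c is the square of the shift; it completes the eigenvalue to the perfect square (m
+ shift)². This is where the shifts 1/2, 1, 0 come from. -/
theorem exists_basePoly_ode (G : Series) : ∃ a b c : ℂ, ∀ m : ℤ,
    (Polynomial.X ^ 2 - 1) * (basePoly G m).derivative.derivative
      + (Polynomial.C a * Polynomial.X + Polynomial.C b) * (basePoly G m).derivative
      + Polynomial.C c * basePoly G m
      = Polynomial.C (((m : ℂ) + (G.shift : ℂ)) ^ 2) * basePoly G m := by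
  cases G
  · refine ⟨2, 1, 1 / 4, fun m => ?_⟩
    have h2 : (Polynomial.C 2 : Polynomial ℂ) = 2 := rfl
    simpa [basePoly, Series.shift, h2] using chebyshev_U_add_U_ode m
  · refine ⟨3, 0, 1, fun m => ?_⟩
    have h3 : (Polynomial.C 3 : Polynomial ℂ) = 3 := rfl
    simpa [basePoly, Series.shift, h3] using chebyshev_U_ode m
  · refine ⟨1, 0, 0, fun m => ?_⟩
    simpa [basePoly, Series.shift] using chebyshev_T_ode m

/-- The symmetric part of the character, as a polynomial in `(u_i + u_i⁻¹) / 2 - 1`. -/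
noncomputable def mainPoly (G : Series) (l : Fin N → ℤ) : MvPolynomial (Fin N) ℂ :=
  alternantQuotient fun j => basePoly G (Series.expo l j)

/-- The quotient by `∏ (u_i - u_i⁻¹)` of the antisymmetric part of the character for series `D`. -/
noncomputable def altPoly (G : Series) (l : Fin N → ℤ) : MvPolynomial (Fin N) ℂ :=
  match G with
  | .B => 0
  | .C => 0
  | .D => alternantQuotient fun j => U ℂ (Series.expo l j - 1)

/-- The factor of the Weyl denominator that is not symmetric under inversion of the variables. -/
noncomputable def weylFactor (G : Series) (u : Fin N → ℂ) : ℂ :=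
  match G with
  | .B => ∏ i, (u i - 1)
  | .C => ∏ i, (u i - (u i)⁻¹)
  | .D => 1

/-- The ratio of the Weyl denominator and its polynomial form. -/
noncomputable def weylConst (G : Series) (N : ℕ) : ℂ :=
  (match G with
  | .B => 1
  | .C => 1
  | .D => 2) * ∏ i : Fin N, ∏ _j ∈ Ioi i, 2

theorem weylConst_ne_zero (G : Series) (N : ℕ) : weylConst G N ≠ 0 := by
  cases G <;> simp [weylConst, prod_ne_zero_iff]

theorem one_add_jou (u : ℂ) : 1 + jou u = (u + u⁻¹) / 2 := by
  rw [jou]; ring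

theorem vand_eq (u : Fin N → ℂ) : Series.vand u
    = (∏ i : Fin N, ∏ _j ∈ Ioi i, 2) * ∏ i, ∏ j ∈ Ioi i, (jouMap u i - jouMap u j) := by
  rw [Series.vand, ← prod_mul_distrib]
  refine prod_congr rfl fun i _ => ?_
  rw [← prod_mul_distrib]
  refine prod_congr rfl fun j _ => ?_
  simp only [jouMap, jou]
  ring

theorem weylDen_eq (G : Series) (u : Fin N → ℂ) : G.weylDen u
    = weylConst G N * (weylFactor G u * ∏ i, ∏ j ∈ Ioi i, (jouMap u i - jouMap u j)) := by
  cases G <;> simp only [Series.weylDen, weylFactor, weylConst, vand_eq] <;> ring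

theorem det_alternant (P : Fin N → Polynomial ℂ) (u : Fin N → ℂ) (v : Fin N → ℂ)
    (M : Matrix (Fin N) (Fin N) ℂ)
    (hM : ∀ i j, M i j = v i * (P j).eval ((u i + (u i)⁻¹) / 2)) :
    M.det = (∏ i, v i) * ((∏ i, ∏ j ∈ Ioi i, (jouMap u i - jouMap u j))
      * MvPolynomial.eval (jouMap u) (alternantQuotient P)) := by
  rw [← eval_alternantQuotient, ← Matrix.det_mul_column]
  congr 1
  ext i j
  rw [hM, Matrix.of_apply, Matrix.of_apply, jouMap, one_add_jou]

theorem weylNum_eq (G : Series) (l : Fin N → ℤ) {u : Fin N → ℂ} (hu : ∀ i, u i ≠ 0) :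
    G.weylNum l u = (weylFactor G u * ∏ i, ∏ j ∈ Ioi i, (jouMap u i - jouMap u j))
      * (MvPolynomial.eval (jouMap u) (mainPoly G l)
        + (∏ i, (u i - (u i)⁻¹)) * MvPolynomial.eval (jouMap u) (altPoly G l)) := by
  cases G
  · rw [Series.weylNum, det_alternant (fun j => basePoly .B (Series.expo l j)) u (fun i => u i - 1)
      _ fun i j => by simpa [basePoly] using zpow_succ_sub_zpow_neg (hu i) (Series.expo l j)]
    simp only [weylFactor, mainPoly, altPoly, map_zero]
    ring
  · rw [Series.weylNum, det_alternant (fun j => basePoly .C (Series.expo l j)) u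
      (fun i => u i - (u i)⁻¹)
      _ fun i j => by simpa [basePoly] using zpow_sub_zpow_neg (hu i) (Series.expo l j + 1)]
    simp only [weylFactor, mainPoly, altPoly, map_zero]
    ring
  · rw [Series.weylNum, det_alternant (fun j => basePoly .D (Series.expo l j)) u
      (fun i => 1) _ fun i j => by simpa [basePoly] using zpow_add_zpow_neg (hu i) (Series.expo l j),
      det_alternant (fun j => U ℂ (Series.expo l j - 1)) u
      (fun i => u i - (u i)⁻¹) _ fun i j => by simpa using zpow_sub_zpow_neg (hu i) (Series.expo l j)]
    simp only [weylFactor, mainPoly, altPoly, prod_const_one]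
    ring

theorem eventually_quadratic_ne_zero {a b c : ℂ} (h : b ≠ 0 ∨ c ≠ 0) :
    ∀ᶠ t in 𝓝[≠] (0 : ℂ), a + b * t + c * t ^ 2 ≠ 0 := by
  set p : Polynomial ℂ := Polynomial.C a + Polynomial.C b * Polynomial.X
    + Polynomial.C c * Polynomial.X ^ 2 with hp
  have h1 : p.coeff 1 = b := by simp [hp, Polynomial.coeff_C]
  have h2 : p.coeff 2 = c := by simp [hp]
  have hp0 : p ≠ 0 := by
    intro h0
    rw [h0, Polynomial.coeff_zero] at h1 h2
    rcases h with h | h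
    · exact h h1.symm
    · exact h h2.symm
  have hfin := Polynomial.finite_setOfPred_isRoot hp0
  have := nhdsNE_le_cofinite (0 : ℂ) hfin.compl_mem_cofinite
  filter_upwards [this] with t ht h0
  exact ht (by simpa [Polynomial.IsRoot, hp] using h0)

/-- Along a suitable line through u every condition for regularity is the nonvanishing of a
nonconstant polynomial in t of degree at most 2, so it fails for finitely many t only. -/
theorem mem_closure_regularSet (G : Series) (u : Fin N → ℂ) :
    u ∈ closure (G.regularSet N) := by
  -- The entries are nonzero and pairwise distinct, so each of the polynomials in t below has a
  -- nonzero coefficient at t or t².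
  set v : Fin N → ℂ := fun i => (i : ℂ) + 1 with hv
  have hv0 : ∀ i, v i ≠ 0 := fun i => Nat.cast_add_one_ne_zero _
  have hvij : ∀ i j, i ≠ j → v i - v j ≠ 0 := by
    intro i j hij h
    apply hij
    rw [hv] at h
    simp only [add_sub_add_right_eq_sub, sub_eq_zero, Nat.cast_inj] at h
    exact Fin.ext h
  have htend : Tendsto (fun t : ℂ => fun i => u i + t * v i) (𝓝[≠] 0) (𝓝 u) := by
    have hc : Continuous (fun t : ℂ => fun i => u i + t * v i) := by fun_prop
    have := hc.tendsto 0
    simp only [zero_mul, add_zero] at this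
    exact this.mono_left nhdsWithin_le_nhds
  refine mem_closure_of_tendsto htend ?_
  have h0 : ∀ᶠ t in 𝓝[≠] (0 : ℂ), ∀ i, u i + t * v i ≠ 0 :=
    eventually_all.2 fun i => (eventually_quadratic_ne_zero (a := u i) (b := v i) (c := 0)
      (Or.inl (hv0 i))).mono fun t ht h => ht (by linear_combination h)
  have h1 : ∀ᶠ t in 𝓝[≠] (0 : ℂ), ∀ i, u i + t * v i - 1 ≠ 0 :=
    eventually_all.2 fun i => (eventually_quadratic_ne_zero (a := u i - 1) (b := v i) (c := 0)
      (Or.inl (hv0 i))).mono fun t ht h => ht (by linear_combination h)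
  have h2 : ∀ᶠ t in 𝓝[≠] (0 : ℂ), ∀ i, u i + t * v i + 1 ≠ 0 :=
    eventually_all.2 fun i => (eventually_quadratic_ne_zero (a := u i + 1) (b := v i) (c := 0)
      (Or.inl (hv0 i))).mono fun t ht h => ht (by linear_combination h)
  have h3 : ∀ᶠ t in 𝓝[≠] (0 : ℂ), ∀ i j, i ≠ j → u i + t * v i - (u j + t * v j) ≠ 0 :=
    eventually_all.2 fun i => eventually_all.2 fun j => eventually_imp_distrib_left.2 fun hij =>
      (eventually_quadratic_ne_zero (a := u i - u j) (b := v i - v j) (c := 0)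
      (Or.inl (hvij i j hij))).mono fun t ht h => ht (by linear_combination h)
  have h4 : ∀ᶠ t in 𝓝[≠] (0 : ℂ), ∀ i j, (u i + t * v i) * (u j + t * v j) - 1 ≠ 0 :=
    eventually_all.2 fun i => eventually_all.2 fun j =>
      (eventually_quadratic_ne_zero (a := u i * u j - 1) (b := u i * v j + u j * v i)
        (c := v i * v j) (Or.inr (mul_ne_zero (hv0 i) (hv0 j)))).mono
        fun t ht h => ht (by linear_combination h)
  filter_upwards [h0, h1, h2, h3, h4] with t h0 h1 h2 h3 h4
  refine ⟨h0, ?_⟩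
  set x : Fin N → ℂ := fun i => u i + t * v i with hx
  rw [weylDen_eq]
  refine mul_ne_zero (weylConst_ne_zero G N) (mul_ne_zero ?_ ?_)
  · cases G
    · exact prod_ne_zero_iff.2 fun i _ => h1 i
    · refine prod_ne_zero_iff.2 fun i _ h => mul_ne_zero (h1 i) (h2 i) ?_
      have h5 : x i * (x i - (x i)⁻¹) = 0 := by rw [h, mul_zero]
      rw [mul_sub, mul_inv_cancel₀ (h0 i)] at h5
      linear_combination h5
    · exact one_ne_zero
  · refine prod_ne_zero_iff.2 fun i _ => prod_ne_zero_iff.2 fun j hj h => ?_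
    refine mul_ne_zero (h3 i j (mem_Ioi.1 hj).ne) (h4 i j) ?_
    -- The left side equals (x i - x j)(x i x j - 1).
    have h5 : 2 * x i * x j * (jouMap x i - jouMap x j) = 0 := by rw [h, mul_zero]
    have hi := mul_inv_cancel₀ (h0 i)
    have hj := mul_inv_cancel₀ (h0 j)
    simp only [jouMap, jou] at h5
    linear_combination h5 - x j * hi + x i * hj

/-- The formula holds at regular points by cancelling the Weyl denominator. Its right side is
continuous wherever no coordinate is 0, so it gives the extension. -/
theorem character_eq (G : Series) (l : G.Sig N) {u : Fin N → ℂ} (hu : ∀ i, u i ≠ 0) :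
    G.character l u = (weylConst G N)⁻¹ * (MvPolynomial.eval (jouMap u) (mainPoly G l.1)
        + (∏ i, (u i - (u i)⁻¹)) * MvPolynomial.eval (jouMap u) (altPoly G l.1)) := by
  refine extendFrom_eq (mem_closure_regularSet G u) ?_
  have hc : ContinuousAt (fun u : Fin N → ℂ => (weylConst G N)⁻¹
      * (MvPolynomial.eval (jouMap u) (mainPoly G l.1)
        + (∏ i, (u i - (u i)⁻¹)) * MvPolynomial.eval (jouMap u) (altPoly G l.1))) u := by
    have hi : ∀ i, ContinuousAt (fun u : Fin N → ℂ => (u i)⁻¹) u := fun i =>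
      (continuous_apply i).continuousAt.inv₀ (hu i)
    have hj : ContinuousAt (jouMap (d := N)) u := by
      refine continuousAt_pi.2 fun i => ?_
      simp only [jouMap, jou]
      exact (((continuous_apply i).continuousAt.add (hi i)).div_const _).sub continuousAt_const
    have he : ∀ p : MvPolynomial (Fin N) ℂ,
        ContinuousAt (fun u : Fin N → ℂ => MvPolynomial.eval (jouMap u) p) u := fun p =>
      ContinuousAt.comp (g := fun x => MvPolynomial.eval x p)
        (MvPolynomial.continuous_eval p).continuousAt hj
    refine continuousAt_const.mul ((he _).add (ContinuousAt.mul ?_ (he _)))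
    exact tendsto_finsetProd _ fun i _ => ((continuous_apply i).continuousAt.sub (hi i))
  refine (hc.tendsto.mono_left nhdsWithin_le_nhds).congr' ?_
  filter_upwards [self_mem_nhdsWithin] with x hx
  have hd := hx.2
  rw [weylDen_eq] at hd
  rw [weylNum_eq G l.1 hx.1, weylDen_eq]
  have h1 := weylConst_ne_zero G N
  have h2 := right_ne_zero_of_mul hd
  generalize weylFactor G x * ∏ i, ∏ j ∈ Ioi i, (jouMap x i - jouMap x j) = d at h2 ⊢
  generalize MvPolynomial.eval (jouMap x) (mainPoly G l.1) + _ = y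
  field_simp

theorem character_one (G : Series) (l : G.Sig N) (i : Fin N) :
    G.character l (fun _ => 1) = (weylConst G N)⁻¹ * MvPolynomial.eval 0 (mainPoly G l.1) := by
  rw [character_eq G l fun _ => one_ne_zero, jouMap_one, prod_eq_zero (mem_univ i) (by simp)]
  ring

/-- The function `ρ(l) g(w) / g(0)` where `g` is the symmetric part of the character. -/
noncomputable def normTerm (G : Series) (ρ : Measure (G.Sig N)) (l : G.Sig N) (w : Fin N → ℂ) : ℂ :=
  (ρ.real {l} : ℂ)
    * (MvPolynomial.eval w (mainPoly G l.1) / MvPolynomial.eval 0 (mainPoly G l.1))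

theorem charTerm_eq_normTerm (G : Series) (ρ : Measure (G.Sig N)) (l : G.Sig N) {u : Fin N → ℂ}
    (hu : ∀ i, u i ≠ 0) {i : Fin N} (hi : u i = 1) :
    G.charTerm ρ l u = normTerm G ρ l (jouMap u) := by
  rw [Series.charTerm, normTerm, character_one G l i, character_eq G l hu,
    prod_eq_zero (mem_univ i) (by simp [hi]), zero_mul, add_zero,
    mul_div_mul_left _ _ (inv_ne_zero (weylConst_ne_zero G N))]

/-- Inverting one coordinate fixes the Joukowski variables and changes the sign of ∏ (u_j - u_j⁻¹),
so the average retains the symmetric part. In all N variables no coordinate need be 1, and this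
replaces `charTerm_eq_normTerm`. -/
theorem charTerm_add_charTerm_update (G : Series) (ρ : Measure (G.Sig N)) (l : G.Sig N)
    {u : Fin N → ℂ} (hu : ∀ i, u i ≠ 0) (i : Fin N) :
    (2 : ℂ)⁻¹ * (G.charTerm ρ l u + G.charTerm ρ l (Function.update u i (u i)⁻¹))
      = normTerm G ρ l (jouMap u) := by
  have hv : ∀ j, Function.update u i (u i)⁻¹ j ≠ 0 := by
    intro j
    rcases eq_or_ne j i with rfl | hj
    · simpa using hu j
    · simpa [hj] using hu j
  have hw : jouMap (Function.update u i (u i)⁻¹) = jouMap u := by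
    funext j
    rcases eq_or_ne j i with rfl | hj
    · simp [jouMap, jou, add_comm]
    · simp [jouMap, hj]
  have hp : ∏ j, (Function.update u i (u i)⁻¹ j - (Function.update u i (u i)⁻¹ j)⁻¹)
      = -∏ j, (u j - (u j)⁻¹) := by
    rw [← mul_prod_erase univ _ (mem_univ i), ← mul_prod_erase univ (fun j => u j - (u j)⁻¹)
      (mem_univ i), Function.update_self, inv_inv, ← neg_mul, neg_sub]
    congr 1
    refine prod_congr rfl fun j hj => ?_
    rw [Function.update_of_ne (ne_of_mem_erase hj)]
  simp only [Series.charTerm]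
  rw [normTerm, character_one G l i, character_eq G l hu, character_eq G l hv, hw, hp]
  have hk := weylConst_ne_zero G N
  rw [← mul_add, ← add_div, ← mul_add, mul_left_comm,
    mul_div_mul_left _ _ (inv_ne_zero hk)]
  ring

end Characters

end SymSeries

/-! ### Uniform convergence in the Joukowski variables and coefficientwise sums. -/

namespace SymSeries

open Finset

section JoukowskiInverse

theorem cpow_half_sq (s : ℂ) : (s ^ ((2 : ℂ)⁻¹)) ^ 2 = s := by
  exact_mod_cast Complex.cpow_nat_inv_pow s two_ne_zero

/-- A right inverse of `jou`. -/
noncomputable def jouInv (w : ℂ) : ℂ := 1 + w + ((1 + w) ^ 2 - 1) ^ ((2 : ℂ)⁻¹)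

theorem jouInv_inv (w : ℂ) : (jouInv w)⁻¹ = 1 + w - ((1 + w) ^ 2 - 1) ^ ((2 : ℂ)⁻¹) := by
  refine inv_eq_of_mul_eq_one_right ?_
  have h := cpow_half_sq ((1 + w) ^ 2 - 1)
  rw [jouInv]
  linear_combination -h

theorem jou_jouInv (w : ℂ) : jou (jouInv w) = w := by
  rw [jou, jouInv_inv, jouInv]; ring

theorem jouInv_ne_zero (w : ℂ) : jouInv w ≠ 0 := by
  intro h
  have h1 := jouInv_inv w
  have h2 := cpow_half_sq ((1 + w) ^ 2 - 1)
  rw [h, inv_zero] at h1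
  rw [jouInv] at h
  have h3 : (1 : ℂ) + w = 0 := by linear_combination (1 / 2) * h - (1 / 2) * h1
  rw [h3] at h h2
  rw [zero_add] at h
  rw [h] at h2
  norm_num at h2

theorem jouInv_zero : jouInv 0 = 1 := by simp [jouInv]

theorem continuousAt_jouInv : ContinuousAt jouInv 0 := by
  unfold jouInv
  refine ContinuousAt.add (by fun_prop) ?_
  have h := Complex.continuousAt_cpow_const_of_re_pos (z := 0) (w := (2 : ℂ)⁻¹) (Or.inl le_rfl)
    (by norm_num)
  refine ContinuousAt.comp (g := fun z : ℂ => z ^ ((2 : ℂ)⁻¹)) (f := fun w : ℂ => (1 + w) ^ 2 - 1)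
    ?_ (by fun_prop)
  simpa using h

end JoukowskiInverse

section UniformSum

variable {N : ℕ}

/-- The sum of the symmetrized normalized characters with weights `ρ`. -/
noncomputable def normSum (G : Series) (ρ : Measure (G.Sig N)) (w : Fin N → ℂ) : ℂ :=
  ∑' l : G.Sig N, normTerm G ρ l w

/-- Uniform convergence is pulled back along two right inverses of `jouMap` that differ by inversion
of one coordinate, and the two pullbacks are averaged. The right inverses are not analytic, but
continuity at 0 suffices for them to map a small ball into U. -/
theorem exists_tendstoUniformlyOn_normTerm (G : Series) (ρ : Measure (G.Sig N)) (i : Fin N)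
    {U : Set (Fin N → ℂ)} (hU : IsOpen U) (h1 : (fun _ => 1) ∈ U)
    (hs : SummableUniformlyOn (fun (l : G.Sig N) u => G.charTerm ρ l u) U) :
    ∃ r, 0 < r ∧ TendstoUniformlyOn (fun (s : Finset (G.Sig N)) w => ∑ l ∈ s, normTerm G ρ l w)
      (normSum G ρ) atTop (Metric.ball 0 r) := by
  obtain ⟨g, hg⟩ := hs.exists
  rw [hasSumUniformlyOn_iff_tendstoUniformlyOn] at hg
  set S : (Fin N → ℂ) → (Fin N → ℂ) := fun w j => jouInv (w j) with hS
  set S' : (Fin N → ℂ) → (Fin N → ℂ) := fun w => Function.update (S w) i (S w i)⁻¹ with hS'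
  have hS0 : S 0 = fun _ => 1 := by funext j; simp [hS, jouInv_zero]
  have hS0' : S' 0 = fun _ => 1 := by
    rw [hS']; simp only [hS0]; funext j
    rcases eq_or_ne j i with rfl | hj <;> simp [*]
  have hSc : ContinuousAt S 0 := continuousAt_pi.2 fun j =>
    ContinuousAt.comp (g := jouInv) (f := fun w : Fin N → ℂ => w j)
      continuousAt_jouInv (continuous_apply j).continuousAt
  have hSc' : ContinuousAt S' 0 := by
    refine ContinuousAt.update hSc i (ContinuousAt.inv₀ (continuousAt_pi.1 hSc i) ?_)
    rw [hS0]; exact one_ne_zero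
  have hN : S ⁻¹' U ∩ S' ⁻¹' U ∈ 𝓝 (0 : Fin N → ℂ) := by
    refine inter_mem (hSc ?_) (hSc' ?_)
    · rw [hS0]; exact hU.mem_nhds h1
    · rw [hS0']; exact hU.mem_nhds h1
  obtain ⟨r, hr, hsub⟩ := Metric.mem_nhds_iff.1 hN
  refine ⟨r, hr, ?_⟩
  have t1 := (hg.comp S).mono fun w hw => (hsub hw).1
  have t2 := (hg.comp S').mono fun w hw => (hsub hw).2
  have t3 := (t1.add t2)
  have t4 := (uniformContinuous_const_smul (M := ℂ) (X := ℂ) ((2 : ℂ)⁻¹)).comp_tendstoUniformlyOn t3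
  have hterm : ∀ l w, normTerm G ρ l w
      = (2 : ℂ)⁻¹ * (G.charTerm ρ l (S w) + G.charTerm ρ l (S' w)) := by
    intro l w
    have hne : ∀ j, S w j ≠ 0 := fun j => jouInv_ne_zero _
    rw [hS', charTerm_add_charTerm_update G ρ l hne]
    congr 1
    funext j
    exact (jou_jouInv _).symm
  have t5 : TendstoUniformlyOn (fun (s : Finset (G.Sig N)) w => ∑ l ∈ s, normTerm G ρ l w)
      (fun w => (2 : ℂ)⁻¹ * (g (S w) + g (S' w))) atTop (Metric.ball 0 r) := by
    refine t4.congr (Eventually.of_forall fun s w _ => ?_)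
    simp only [hterm, Function.comp_apply, Pi.add_apply, mul_add, sum_add_distrib, mul_sum, smul_eq_mul]
  refine t5.congr_right fun w hw => ?_
  have h : HasSum (fun l => normTerm G ρ l w) ((2 : ℂ)⁻¹ * (g (S w) + g (S' w))) :=
    t5.tendsto_at hw
  exact h.tsum_eq.symm

end UniformSum

section CoefficientwiseSums

variable {N : ℕ} {κ : Type*}

/-- The series of power series `f` converges coefficientwise to `A`. -/
def HasSumCoeff (f : κ → MvPowerSeries (Fin N) ℂ) (A : MvPowerSeries (Fin N) ℂ) : Prop :=
  ∀ α, HasSum (fun k => MvPowerSeries.coeff α (f k)) (MvPowerSeries.coeff α A)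

variable {f g : κ → MvPowerSeries (Fin N) ℂ} {A B : MvPowerSeries (Fin N) ℂ}

theorem HasSumCoeff.sum {ι : Type*} (s : Finset ι) {f : ι → κ → MvPowerSeries (Fin N) ℂ}
    {A : ι → MvPowerSeries (Fin N) ℂ} (h : ∀ i ∈ s, HasSumCoeff (f i) (A i)) :
    HasSumCoeff (fun k => ∑ i ∈ s, f i k) (∑ i ∈ s, A i) := by
  intro α
  simp only [map_sum]
  exact hasSum_sum fun i hi => h i hi α

theorem HasSumCoeff.smul (c : ℂ) (h : HasSumCoeff f A) :
    HasSumCoeff (fun k => c • f k) (c • A) := by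
  intro α
  simpa using (h α).mul_left c

theorem HasSumCoeff.const_mul (p : MvPowerSeries (Fin N) ℂ) (h : HasSumCoeff f A) :
    HasSumCoeff (fun k => p * f k) (p * A) := by
  intro α
  simp only [MvPowerSeries.coeff_mul]
  exact hasSum_sum fun x _ => (h x.2).mul_left _

theorem HasSumCoeff.pderiv (i : Fin N) (h : HasSumCoeff f A) :
    HasSumCoeff (fun k => MvPowerSeries.pderiv ℂ i (f k)) (MvPowerSeries.pderiv ℂ i A) := by
  intro α
  simp only [MvPowerSeries.coeff_pderiv]
  exact (h _).mul_right _

theorem HasSumCoeff.ddSum (i : Fin N) (h : HasSumCoeff f A) :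
    HasSumCoeff (fun k => ddSum i (f k)) (ddSum i A) := by
  have hd : ∀ j, HasSumCoeff (fun k => dd i j (f k)) (dd i j A) := fun j α => by
    simp only [coeff_dd]
    exact hasSum_sum fun q _ => (h _).sub (h _)
  simp only [ddSum_apply]
  exact HasSumCoeff.sum _ fun j _ => hd j

theorem HasSumCoeff.radialOp (q : ℕ → Polynomial ℂ) (n : ℕ) (h : HasSumCoeff f A) :
    HasSumCoeff (fun k => radialOp (fun i => MvPowerSeries.pderiv ℂ i) q n (f k))
      (radialOp (fun i => MvPowerSeries.pderiv ℂ i) q n A) := by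
  have hp : ∀ i m, HasSumCoeff (fun k => (MvPowerSeries.pderiv ℂ i)^[m] (f k))
      ((MvPowerSeries.pderiv ℂ i)^[m] A) := by
    intro i m
    induction m with
    | zero => exact h
    | succ m ih => simpa only [Function.iterate_succ_apply'] using ih.pderiv i
  have hq : ∀ i (g : κ → MvPowerSeries (Fin N) ℂ) B, HasSumCoeff g B → ∀ m,
      HasSumCoeff (fun k => (SymSeries.ddSum i)^[m] (g k)) ((SymSeries.ddSum i)^[m] B) := by
    intro i g B hg m
    induction m with
    | zero => exact hg
    | succ m ih => simpa only [Function.iterate_succ_apply'] using ih.ddSum i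
  exact HasSumCoeff.sum _ fun j _ => HasSumCoeff.sum _ fun m _ => HasSumCoeff.smul _ <|
    HasSumCoeff.sum _ fun i _ => hq _ _ _ ((hp _ _).const_mul _) _

end CoefficientwiseSums

section Eigenvalues

variable {N : ℕ}

/-- The power sum `∑ (l_j + N - j + shift) ^ (2 k)`. -/
noncomputable def powerSum (G : Series) (k : ℕ) (l : Fin N → ℤ) : ℝ :=
  ∑ j, (((Series.expo l j : ℝ) + G.shift) ^ 2) ^ k

theorem taylor_normTerm (G : Series) (ρ : Measure (G.Sig N)) (l : G.Sig N) :
    taylor 0 (normTerm G ρ l) = ((ρ.real {l} : ℂ) * (MvPolynomial.eval 0 (mainPoly G l.1))⁻¹) •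
      taylor 0 (fun w => MvPolynomial.eval w (mainPoly G l.1)) := by
  rw [← taylor_const_mul (smooth_eval _ _)]
  congr 1
  funext w
  rw [normTerm]
  ring

theorem isSymm_smul {f : MvPowerSeries (Fin N) ℂ} (hf : IsSymm f) (c : ℂ) : IsSymm (c • f) := by
  intro e
  rw [map_smul, hf e]

/-- There is a differential operator of order `2 k` with leading coefficient `(X ^ 2 - 1) ^ k` such
that the corresponding radial operator is diagonal on normalized characters. -/
theorem exists_radialOp_normTerm (G : Series) (k : ℕ) : ∃ q : ℕ → Polynomial ℂ,
    q (2 * k) = (Polynomial.X ^ 2 - 1) ^ k ∧ ∀ (N : ℕ) (ρ : Measure (G.Sig N)) (l : G.Sig N) (c : ℂ),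
      radialOp (fun i => MvPowerSeries.pderiv ℂ i) q (2 * k) (c • taylor 0 (normTerm G ρ l))
        = (powerSum G k l.1 : ℂ) • c • taylor 0 (normTerm G ρ l) := by
  obtain ⟨a, b, c, hode⟩ := exists_basePoly_ode G
  obtain ⟨q, hq, hg⟩ := exists_iterate_hypOp a b c k
  refine ⟨q, hq, fun N ρ l t => ?_⟩
  have := radialOp_eigen (s := t * ((ρ.real {l} : ℂ) * (MvPolynomial.eval 0 (mainPoly G l.1))⁻¹))
    hg (fun j => basePoly G (Series.expo l.1 j))
    (fun j => ((Series.expo l.1 j : ℂ) + (G.shift : ℂ)) ^ 2) (fun j => hode _)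
    (f := t • taylor 0 (normTerm G ρ l))
    (by rw [taylor_normTerm]
        exact isSymm_smul (isSymm_smul (isSymm_taylor_alternantQuotient _) _) _)
    (by rw [taylor_normTerm, ← vandermonde_mul_taylor_alternantQuotient, smul_smul, mul_smul_comm]
        rfl)
  rw [this]
  congr 1
  simp [powerSum]

theorem smooth_normTerm (G : Series) (ρ : Measure (G.Sig N)) (l : G.Sig N) (w : Fin N → ℂ) :
    ContDiffAt ℂ (⊤ : ℕ∞) (normTerm G ρ l) w := by
  unfold normTerm
  exact contDiffAt_const.mul ((smooth_eval w _).div_const _)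

end Eigenvalues

end SymSeries

/-! ### Reduction to finitely many variables and the logarithm of the generating function. -/

namespace SymSeries

open Finset

section Padding

/-- The point `(w_1, …, w_k, 0, …, 0)` with `N` coordinates (used for `N ≥ k`). -/
noncomputable def padZeros {k : ℕ} (N : ℕ) (w : Fin k → ℂ) : Fin N → ℂ :=
  fun i => if h : (i : ℕ) < k then w ⟨i, h⟩ else 0

theorem padZeros_eq_extendL {k N : ℕ} (h : k ≤ N) (w : Fin k → ℂ) :
    padZeros N w = extendL (Fin.castLE h) w := by
  funext i
  by_cases hi : (i : ℕ) < k
  · have : i = Fin.castLE h ⟨i, hi⟩ := rfl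
    rw [this, extendL_apply_image (Fin.castLE_injective h), ← this, padZeros, dif_pos hi]
  · rw [extendL_apply_of_notMem]
    · simp [padZeros, hi]
    · rintro k rfl
      exact hi k.2

theorem jouMap_padOnes {k : ℕ} (N : ℕ) (u : Fin k → ℂ) :
    jouMap (Series.padOnes N u) = padZeros N (jouMap u) := by
  funext i
  by_cases hi : (i : ℕ) < k <;> simp [jouMap, Series.padOnes, padZeros, hi, jou_one]

theorem padOnes_one {k : ℕ} (N : ℕ) : Series.padOnes N (fun _ : Fin k => (1 : ℂ)) = fun _ => 1 := by
  funext i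
  simp [Series.padOnes]

theorem sum_padZeros {k N : ℕ} (h : k ≤ N) {f : ℂ → ℂ} (hf : f 0 = 0) (w : Fin k → ℂ) :
    ∑ j, f (padZeros N w j) = ∑ i, f (w i) := by
  symm
  refine sum_of_injOn (Fin.castLE h) (Fin.castLE_injective h).injOn (by simp) (fun j _ hj => ?_)
    fun i _ => ?_
  · rw [padZeros, dif_neg, hf]
    intro hjk
    exact hj ⟨⟨j, hjk⟩, by simp, rfl⟩
  · simp [padZeros]

/-- A monomial of degree at most D involves at most D variables, and a permutation moves them to the
first D places. -/
theorem exists_coeff_eq_of_isSymm {D N : ℕ} (h : D ≤ N) {F : MvPowerSeries (Fin N) ℂ}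
    (hF : IsSymm F) {γ : Fin N →₀ ℕ} (hγ : γ.degree ≤ D) :
    ∃ β : Fin D →₀ ℕ, β.degree = γ.degree ∧
      MvPowerSeries.coeff γ F = MvPowerSeries.coeff (β.mapDomain (Fin.castLE h)) F := by
  have hcard : γ.support.card ≤ D := by
    refine le_trans ?_ hγ
    rw [Finsupp.degree_apply, card_eq_sum_ones]
    exact sum_le_sum fun i hi => Nat.one_le_iff_ne_zero.2 (Finsupp.mem_support_iff.1 hi)
  obtain ⟨S, hS, -, hSc⟩ := exists_subsuperset_card_eq (subset_univ γ.support) hcard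
    (by simpa using h)
  -- Multiple transitivity of the symmetric group provides the permutation taking the chosen
  -- D-element set to the initial segment.
  obtain ⟨σ, hσ⟩ := (MulAction.isMultiplyPretransitive_iff (G := Equiv.Perm (Fin N))
    (α := Fin N) (n := D)).1 (Equiv.Perm.isMultiplyPretransitive _ _)
    (S.orderEmbOfFin hSc).toEmbedding (Fin.castLEEmb h)
  have hσ' : σ ∘ (S.orderEmbOfFin hSc) = Fin.castLE h := by
    funext i
    exact DFunLike.congr_fun hσ i
  have hinj := (S.orderEmbOfFin hSc).injective
  have hmap : (γ.comapDomain (S.orderEmbOfFin hSc) hinj.injOn).mapDomain (S.orderEmbOfFin hSc) = γ :=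
    Finsupp.mapDomain_comapDomain _ hinj _ (by rw [range_orderEmbOfFin]; exact_mod_cast hS)
  refine ⟨γ.comapDomain (S.orderEmbOfFin hSc) hinj.injOn, ?_, ?_⟩
  · conv_rhs => rw [← hmap]
    rw [Finsupp.degree_mapDomain]
  · rw [← hσ', Finsupp.mapDomain_comp, hmap]
    conv_rhs => rw [← hF σ]
    rw [coeff_rename_perm, Finsupp.equivMapDomain_eq_mapDomain, ← Finsupp.mapDomain_comp]
    simp

open scoped ContDiff

/-- By symmetry all coefficients of degree at most d + 1 already occur among finitely many
coefficients in d + 1 variables, whatever N is. This turns convergence for each fixed number of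
variables into the uniformity demanded by `Null`. -/
theorem null_pderiv_of_symm {Δ : ∀ N, (Fin N → ℂ) → ℂ}
    (hs : ∀ᶠ N in atTop, ContDiffAt ℂ ∞ (Δ N) 0 ∧
      ∀ (e : Equiv.Perm (Fin N)) x, Δ N (fun i => x (e i)) = Δ N x)
    (h : ∀ (d : ℕ) (β : Fin d →₀ ℕ), Tendsto (fun N =>
      MvPowerSeries.coeff β (taylor 0 fun w => Δ N (padZeros N w))) atTop (𝓝 0)) :
    Null fun N i => MvPowerSeries.pderiv ℂ i (taylor 0 (Δ N)) := by
  intro d ε hε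
  have hfin : {β : Fin (d + 1) →₀ ℕ | β.degree ≤ d + 1}.Finite := Finsupp.finite_of_degree_le _
  have hε' : 0 < ε / (d + 1) := by positivity
  have h1 : ∀ᶠ N in atTop, ∀ β ∈ {β : Fin (d + 1) →₀ ℕ | β.degree ≤ d + 1},
      ‖MvPowerSeries.coeff β (taylor 0 fun w => Δ N (padZeros N w))‖ < ε / (d + 1) := by
    refine (eventually_all_finite hfin).2 fun β _ => ?_
    have := (h (d + 1) β).norm
    rw [norm_zero] at this
    exact this.eventually (gt_mem_nhds hε')
  filter_upwards [h1, hs, eventually_ge_atTop (d + 1)] with N h1 ⟨hsm, hsym⟩ hN i α hα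
  rw [MvPowerSeries.coeff_pderiv]
  have hdeg : (α + Finsupp.single i 1).degree ≤ d + 1 := by
    rw [map_add, Finsupp.degree_single]; omega
  obtain ⟨β, hβ, e⟩ := exists_coeff_eq_of_isSymm hN (isSymm_taylor hsm hsym) hdeg
  rw [e, coeff_taylor_extendL _ (Fin.castLE_injective hN) _ hsm]
  have h2 := h1 β (hβ ▸ hdeg)
  simp only [padZeros_eq_extendL hN] at h2
  have h3 : ‖(α i : ℂ) + 1‖ ≤ d + 1 := by
    have : α i ≤ d := (Finsupp.le_degree i α).trans hα
    have h4 : (α i : ℝ) ≤ d := by exact_mod_cast this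
    calc ‖(α i : ℂ) + 1‖ ≤ ‖(α i : ℂ)‖ + ‖(1 : ℂ)‖ := norm_add_le _ _
      _ ≤ d + 1 := by simpa using h4
  rw [norm_mul]
  calc _ ≤ ε / (d + 1) * (d + 1) := mul_le_mul h2.le h3 (norm_nonneg _) hε'.le
    _ = ε := by field_simp

end Padding

section Logarithm

open scoped ContDiff

variable {N : ℕ}

theorem normTerm_symm (G : Series) (ρ : Measure (G.Sig N)) (l : G.Sig N) (e : Equiv.Perm (Fin N))
    (x : Fin N → ℂ) : normTerm G ρ l (fun i => x (e i)) = normTerm G ρ l x := by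
  rw [normTerm, normTerm]
  congr 2
  conv_rhs => rw [mainPoly, ← rename_alternantQuotient _ e]
  rw [MvPolynomial.eval_rename]
  rfl

theorem normSum_symm (G : Series) (ρ : Measure (G.Sig N)) (e : Equiv.Perm (Fin N))
    (x : Fin N → ℂ) : normSum G ρ (fun i => x (e i)) = normSum G ρ x :=
  tsum_congr fun l => normTerm_symm G ρ l e x

/-- The logarithm of `normSum`, divided by `N`. -/
noncomputable def logSum (G : Series) (ρ : Measure (G.Sig N)) (w : Fin N → ℂ) : ℂ :=
  (N : ℂ)⁻¹ * Complex.log (normSum G ρ w)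

theorem smooth_logSum (G : Series) (ρ : Measure (G.Sig N)) (hs : ContDiffAt ℂ ∞ (normSum G ρ) 0)
    (h1 : normSum G ρ 0 = 1) : ContDiffAt ℂ ∞ (logSum G ρ) 0 := by
  unfold logSum
  refine contDiffAt_const.mul (ContDiffAt.comp (g := Complex.log) 0 (Complex.contDiffAt_log ?_) hs)
  rw [h1]; exact Complex.one_mem_slitPlane

theorem pderiv_taylor_normSum (G : Series) (ρ : Measure (G.Sig N)) (hN : N ≠ 0)
    (hs : ContDiffAt ℂ ∞ (normSum G ρ) 0) (h1 : normSum G ρ 0 = 1) (i : Fin N) :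
    MvPowerSeries.pderiv ℂ i (taylor 0 (normSum G ρ)) = taylor 0 (normSum G ρ)
      * ((N : ℂ) • MvPowerSeries.pderiv ℂ i (taylor 0 (logSum G ρ))) := by
  have hl := smooth_logSum G ρ hs h1
  have hd : ∀ᶠ x in 𝓝 (0 : Fin N → ℂ), ContDiffAt ℂ 1 (normSum G ρ) x :=
    (hs.of_le ENat.LEInfty.out).eventually (by simp)
  have hsl : ∀ᶠ x in 𝓝 (0 : Fin N → ℂ), normSum G ρ x ∈ Complex.slitPlane := by
    refine hs.continuousAt.eventually (Complex.isOpen_slitPlane.mem_nhds ?_)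
    rw [h1]; exact Complex.one_mem_slitPlane
  have key : pd i (normSum G ρ) =ᶠ[𝓝 0] fun x => normSum G ρ x * ((N : ℂ) * pd i (logSum G ρ) x) := by
    filter_upwards [hd, hsl] with x hx hsx
    have hf := (hx.differentiableAt one_ne_zero).hasFDerivAt
    have hlog := (hf.clog hsx).const_mul (N : ℂ)⁻¹
    have hne : normSum G ρ x ≠ 0 := Complex.slitPlane_ne_zero hsx
    have hN' : (N : ℂ) ≠ 0 := Nat.cast_ne_zero.2 hN
    have e : fderiv ℂ (logSum G ρ) x = (N : ℂ)⁻¹ • (normSum G ρ x)⁻¹ • fderiv ℂ (normSum G ρ) x :=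
      hlog.fderiv
    rw [pd, pd, e]
    simp only [_root_.smul_apply, smul_eq_mul]
    field_simp
  rw [← taylor_pd hs, taylor_congr key, taylor_mul hs (contDiffAt_const.mul (smooth_pd hl i)),
    taylor_const_mul (smooth_pd hl i), taylor_pd hl]

end Logarithm

end SymSeries

/-! ### Consequences of the logarithmic limit hypothesis. -/

namespace SymSeries

open Finset

open scoped ContDiff

section LogarithmicLimit

variable {G : Series} {N k : ℕ}

theorem charGenFun_padOnes (ρ : Measure (G.Sig N)) (hk : k < N) {u : Fin k → ℂ}
    (hu : ∀ i, u i ≠ 0) :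
    G.charGenFun ρ (Series.padOnes N u) = normSum G ρ (padZeros N (jouMap u)) := by
  rw [← jouMap_padOnes]
  refine tsum_congr fun l => charTerm_eq_normTerm G ρ l (fun i => ?_) (i := ⟨k, hk⟩) ?_
  · simp only [Series.padOnes]
    split_ifs
    · exact hu _
    · exact one_ne_zero
  · simp [Series.padOnes]

/-- Near (1, …, 1) the number N · L is small, so the principal logarithm inverts the exponential.
The condition k < N leaves a coordinate equal to 1, which removes the antisymmetric part of the
characters. -/
theorem eventually_logSum_eq (ρ : Measure (G.Sig N)) (hk : k < N) {U : Set (Fin k → ℂ)}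
    (hU : IsOpen U) (h1 : (fun _ => 1) ∈ U) {L : (Fin k → ℂ) → ℂ}
    (hL : ContinuousAt L fun _ => 1) (hL1 : L (fun _ => 1) = 0)
    (hexp : ∀ u ∈ U, Complex.exp (N * L u) = G.charGenFun ρ (Series.padOnes N u)) :
    ∀ᶠ u in 𝓝 fun _ => 1, logSum G ρ (padZeros N (jouMap u)) = L u := by
  have h0 : ∀ᶠ u in 𝓝 (fun _ : Fin k => (1 : ℂ)), ∀ i, u i ≠ 0 :=
    eventually_all.2 fun i => (continuous_apply i).continuousAt.eventually_ne one_ne_zero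
  have hsmall : ∀ᶠ u in 𝓝 (fun _ : Fin k => (1 : ℂ)), ‖(N : ℂ) * L u‖ < 1 := by
    have hc : ContinuousAt (fun u => ‖(N : ℂ) * L u‖) fun _ => 1 :=
      (continuousAt_const.mul hL).norm
    refine hc.eventually (gt_mem_nhds ?_)
    simp [hL1]
  filter_upwards [h0, hsmall, hU.mem_nhds h1] with u hu hs huU
  have hN : (N : ℂ) ≠ 0 := Nat.cast_ne_zero.2 (by omega)
  have him := (Complex.abs_im_le_norm ((N : ℂ) * L u)).trans hs.le
  rw [abs_le] at him
  rw [logSum, ← charGenFun_padOnes ρ hk hu, ← hexp u huU, Complex.log_exp, inv_mul_cancel_left₀ hN]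
  · linarith [Real.pi_gt_three]
  · linarith [Real.pi_gt_three]

/-- The logarithms of the character generating functions, divided by `N`, have branches near
`(1, …, 1)` that converge uniformly to `∑ Q (u_i)`. -/
def LogLimit (ρ : ∀ N : ℕ, Measure (G.Sig N)) (Q : ℂ → ℂ) : Prop :=
  ∀ k : ℕ, ∃ U : Set (Fin k → ℂ), IsOpen U ∧ (fun _ => 1) ∈ U ∧
      ∃ L : ℕ → (Fin k → ℂ) → ℂ,
        (∀ᶠ N in atTop, AnalyticOnNhd ℂ (L N) U ∧ L N (fun _ => 1) = 0 ∧
          ∀ u ∈ U, Summable (fun l : G.Sig N => G.charTerm (ρ N) l (Series.padOnes N u)) ∧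
            Complex.exp (N * L N u) = G.charGenFun (ρ N) (Series.padOnes N u)) ∧
        TendstoUniformlyOn L (fun u => ∑ i, Q (u i)) atTop U

variable {ρ : ∀ N : ℕ, Measure (G.Sig N)} {Q : ℂ → ℂ}

theorem LogLimit.apply_one (h : LogLimit ρ Q) : Q 1 = 0 := by
  obtain ⟨U, -, h1, L, hL, hlim⟩ := h 1
  have h2 := hlim.tendsto_at h1
  have h3 : Tendsto (fun N => L N fun _ => 1) atTop (𝓝 0) :=
    tendsto_const_nhds.congr' (hL.mono fun N hN => hN.2.1.symm)
  simpa using tendsto_nhds_unique h2 h3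

theorem LogLimit.eventually_normSum_zero (h : LogLimit ρ Q) :
    ∀ᶠ N in atTop, HasSum (fun l => normTerm G (ρ N) l 0) 1 ∧ normSum G (ρ N) 0 = 1 := by
  -- With no free variables the hypothesis concerns only the point (1, …, 1), and supplies
  -- summability there and the value exp 0 = 1.
  obtain ⟨U, -, h1, L, hL, -⟩ := h 0
  filter_upwards [hL, eventually_gt_atTop 0] with N ⟨_, h2, h3⟩ hN
  obtain ⟨hs, he⟩ := h3 _ h1
  have e : ∀ l, G.charTerm (ρ N) l (Series.padOnes N fun _ : Fin 0 => 1)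
      = normTerm G (ρ N) l 0 := fun l => by
    rw [padOnes_one, charTerm_eq_normTerm G (ρ N) l (fun _ => one_ne_zero) (i := ⟨0, hN⟩) rfl,
      jouMap_one]
  have h4 : normSum G (ρ N) 0 = 1 := by
    rw [h2, mul_zero, Complex.exp_zero] at he
    rw [he]
    exact tsum_congr fun l => (e l).symm
  simp only [e] at hs
  refine ⟨?_, h4⟩
  rw [← h4]
  exact hs.hasSum

/-- For one free variable the logarithm depends on u through u + u⁻¹ only. The invariance passes to
the limit by `eventually_inv_eq_of_tendsto`. -/
theorem LogLimit.eventually_inv (h : LogLimit ρ Q) : ∀ᶠ u in 𝓝 1, Q u⁻¹ = Q u := by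
  obtain ⟨U, hU, h1, L, hL, hlim⟩ := h 1
  set d : ℂ → (Fin 1 → ℂ) := fun u _ => u with hd
  have hdc : Continuous d := continuous_pi fun _ => continuous_id
  obtain ⟨r, hr, hsub⟩ := Metric.mem_nhds_iff.1
    ((hU.preimage hdc).mem_nhds (show (1 : ℂ) ∈ d ⁻¹' U from h1))
  refine eventually_inv_eq_of_tendsto (ℓ := fun N u => L N (d u)) hr ?_ ?_ fun u hu => ?_
  · filter_upwards [hL] with N hN u hu
    have h2 : DifferentiableAt ℂ (L N) (d u) := (hN.1 _ (hsub hu)).differentiableAt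
    have h3 : DifferentiableAt ℂ d u := by
      rw [hd]; exact differentiableAt_pi.2 fun _ => differentiableAt_id
    exact (h2.comp u h3).differentiableWithinAt
  · filter_upwards [hL, eventually_gt_atTop 1] with N hN hN1
    have h2 := eventually_logSum_eq (ρ N) hN1 hU h1 (hN.1 _ h1).continuousAt hN.2.1
      fun u hu => (hN.2.2 u hu).2
    have h3 : ∀ᶠ u in 𝓝 (1 : ℂ), logSum G (ρ N) (padZeros N (jouMap (d u))) = L N (d u) :=
      (hdc.tendsto 1).eventually h2
    have hinv : Tendsto (fun u : ℂ => u⁻¹) (𝓝 1) (𝓝 1) := by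
      simpa using (continuousAt_inv₀ (one_ne_zero (α := ℂ))).tendsto
    filter_upwards [h3, hinv.eventually h3] with u e1 e2
    rw [← e1, ← e2]
    congr 2
    funext i
    simp [jouMap, jou, hd, add_comm]
  · simpa [hd] using hlim.tendsto_at (hsub hu)

theorem taylorOne_comp_add (f : ℂ → ℂ) : taylorOne 0 (fun w => f (1 + w)) = taylorOne 1 f := by
  ext n
  simp [taylorOne, iteratedDeriv_comp_const_add]

theorem pderiv_taylor_sum_comp_coord {q : ℂ → ℂ} (hq : ContDiffAt ℂ ∞ q 0) (i : Fin N) :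
    MvPowerSeries.pderiv ℂ i (taylor 0 fun w => ∑ j, q (w j)) = iota i (taylorOne 0 (deriv q)) := by
  have hs : ∀ j : Fin N, ContDiffAt ℂ ∞ (fun w : Fin N → ℂ => q (w j)) 0 := fun j =>
    smooth_comp_coord (by simpa using hq)
  rw [taylor_sum univ fun j _ => hs j, map_sum, sum_eq_single i]
  · rw [← taylor_pd (hs i), taylor_congr (pd_comp_coord (by simpa using hq) i)]
    simp only [if_true]
    exact taylor_comp_coord i 0 (by simpa using smooth_deriv hq)
  · intro j _ hj
    rw [← taylor_pd (hs j), taylor_congr (pd_comp_coord (by simpa using hq) i)]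
    simp only [if_neg hj]
    simpa using taylor_const (0 : Fin N → ℂ) 0
  · simp

/-- The difference of `logSum` and ∑ Q̂(1 + w_j) is symmetric, so `null_pderiv_of_symm` needs only
its restrictions to finitely many variables. In the variables u these restrictions tend to 0 by
hypothesis, and `tendsto_coeff_of_comp_jouMap` transfers this to the variables w. -/
theorem LogLimit.conv_logSum (h : LogLimit ρ Q)
    (hsm : ∀ᶠ N in atTop, ContDiffAt ℂ ∞ (normSum G (ρ N)) 0) (hQ : AnalyticAt ℂ Q 1)
    {Qhat : ℂ → ℂ} (hQhat : AnalyticAt ℂ Qhat 1)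
    (he : ∀ᶠ u in 𝓝 (1 : ℂ), Qhat ((u + u⁻¹) / 2) = Q u) :
    Conv (fun N i => MvPowerSeries.pderiv ℂ i (taylor 0 (logSum G (ρ N))))
      (taylorOne 1 (deriv Qhat)) := by
  set q : ℂ → ℂ := fun w => Qhat (1 + w) with hqdef
  have hq : ContDiffAt ℂ ∞ q 0 := by
    refine ContDiffAt.comp (g := Qhat) 0 ?_ (by fun_prop)
    simpa using hQhat.contDiffAt
  have hq0 : q 0 = 0 := by
    have := he.self_of_nhds
    simp only [inv_one] at this
    rw [hqdef]
    simp only [add_zero]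
    rw [← h.apply_one, ← this]
    norm_num
  have hsum : ∀ n : ℕ, ContDiffAt ℂ ∞ (fun w : Fin n → ℂ => ∑ j, q (w j)) 0 := fun n =>
    ContDiffAt.sum fun j _ => smooth_comp_coord (by simpa using hq)
  have hlog : ∀ᶠ N in atTop, ContDiffAt ℂ ∞ (logSum G (ρ N)) 0 := by
    filter_upwards [hsm, h.eventually_normSum_zero] with N h1 h2
    exact smooth_logSum G (ρ N) h1 h2.2
  have hnull := null_pderiv_of_symm (Δ := fun N w => logSum G (ρ N) w - ∑ j, q (w j)) ?_ ?_
  · refine hnull.congr ?_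
    filter_upwards [hlog] with N hN i
    rw [taylor_sub hN (hsum N), map_sub, pderiv_taylor_sum_comp_coord hq]
    have : deriv q = fun w => deriv Qhat (1 + w) := by
      funext w; rw [hqdef]; exact deriv_comp_const_add 1 w (f := Qhat)
    rw [this, taylorOne_comp_add]
  · filter_upwards [hlog] with N hN
    refine ⟨hN.sub (hsum N), fun e x => ?_⟩
    simp only [logSum]
    rw [normSum_symm, Equiv.sum_comp e fun j => q (x j)]
  · intro d β
    obtain ⟨U, hU, h1, L, hL, hlim⟩ := h d
    have hQs : ∀ᶠ u in 𝓝 (fun _ : Fin d => (1 : ℂ)),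
        ∀ i, ContDiffAt ℂ ∞ Q (u i) ∧ Qhat ((u i + (u i)⁻¹) / 2) = Q (u i) := by
      have hP : ∀ᶠ z in 𝓝 (1 : ℂ), ContDiffAt ℂ ∞ Q z ∧ Qhat ((z + z⁻¹) / 2) = Q z := by
        filter_upwards [hQ.eventually_analyticAt, he] with u hu h2
        exact ⟨hu.contDiffAt, h2⟩
      exact eventually_all.2 fun i =>
        ((continuous_apply i).tendsto (fun _ : Fin d => (1 : ℂ))).eventually hP
    obtain ⟨r, hr, hsub⟩ := Metric.mem_nhds_iff.1 (inter_mem (hU.mem_nhds h1) hQs)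
    have hQsum : ∀ x ∈ Metric.ball (fun _ : Fin d => (1 : ℂ)) r,
        ContDiffAt ℂ ∞ (fun u : Fin d → ℂ => ∑ i, Q (u i)) x := fun x hx =>
      ContDiffAt.sum fun i _ => smooth_comp_coord ((hsub hx).2 i).1
    have hLs : ∀ᶠ N in atTop, ∀ x ∈ Metric.ball (fun _ : Fin d => (1 : ℂ)) r,
        ContDiffAt ℂ ∞ (L N) x := by
      filter_upwards [hL] with N hN x hx
      exact (hN.1 x (hsub hx).1).contDiffAt
    refine tendsto_coeff_of_comp_jouMap _ ?_ (fun α => ?_) β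
    · filter_upwards [hlog, eventually_ge_atTop d] with N hN hdN
      simp only [padZeros_eq_extendL hdN]
      refine ContDiffAt.comp (g := fun w => logSum G (ρ N) w - ∑ j, q (w j))
        (f := extendL (Fin.castLE hdN)) 0 ?_ (extendL (Fin.castLE hdN)).contDiff.contDiffAt
      rw [map_zero]
      exact hN.sub (hsum N)
    · have ht := (tendsto_coeff_taylor hr hLs hQsum
        (hlim.mono fun x hx => (hsub hx).1) α).sub_const
          (MvPowerSeries.coeff α (taylor (fun _ => 1) fun u : Fin d → ℂ => ∑ i, Q (u i)))
      rw [sub_self] at ht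
      refine ht.congr' ?_
      filter_upwards [hL, hLs, eventually_gt_atTop d] with N hN hNs hdN
      rw [← map_sub, ← taylor_sub (hNs _ (Metric.mem_ball_self hr))
        (hQsum _ (Metric.mem_ball_self hr))]
      congr 1
      refine taylor_congr ?_
      filter_upwards [eventually_logSum_eq (ρ N) hdN hU h1 (hN.1 _ h1).continuousAt hN.2.1
        fun u hu => (hN.2.2 u hu).2, hQs] with u e1 e2
      rw [e1, sum_padZeros hdN.le hq0]
      congr 1
      refine sum_congr rfl fun i _ => ?_
      rw [← (e2 i).2, hqdef]
      simp only [jouMap, one_add_jou]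

end LogarithmicLimit

end SymSeries

/-! ### First and second moments of the power sums. -/

namespace SymSeries

open Finset

section Moments

theorem radialOp_smul {N : ℕ} {D : Fin N → MvPowerSeries (Fin N) ℂ → MvPowerSeries (Fin N) ℂ}
    (hD : ∀ i (c : ℂ) f, D i (c • f) = c • D i f) (q : ℕ → Polynomial ℂ) (n : ℕ) (c : ℂ)
    (f : MvPowerSeries (Fin N) ℂ) : radialOp D q n (c • f) = c • radialOp D q n f := by
  have h1 : ∀ i m, (D i)^[m] (c • f) = c • (D i)^[m] f := by
    intro i m
    induction m with
    | zero => rfl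
    | succ m ih => rw [Function.iterate_succ_apply', ih, hD, Function.iterate_succ_apply']
  have h2 : ∀ i m (g : MvPowerSeries (Fin N) ℂ), (ddSum i)^[m] (c • g) = c • (ddSum i)^[m] g := by
    intro i m g
    induction m with
    | zero => rfl
    | succ m ih => rw [Function.iterate_succ_apply', ih, map_smul, Function.iterate_succ_apply']
  simp only [radialOp, h1, mul_smul_comm, h2, smul_sum]
  exact sum_congr rfl fun j _ => sum_congr rfl fun m _ => sum_congr rfl fun i _ => smul_comm _ _ _

theorem Null.tendsto_coeff_zero {g : ∀ N, MvPowerSeries (Fin N) ℂ} {c : ℂ}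
    (h : Null fun N _ => g N - MvPowerSeries.C c) :
    Tendsto (fun N => MvPowerSeries.coeff 0 (g N)) atTop (𝓝 c) := by
  rw [Metric.tendsto_atTop']
  intro ε hε
  obtain ⟨N₀, h0⟩ := eventually_atTop.1 ((h 0 (ε / 2) (half_pos hε)).and (eventually_gt_atTop 0))
  refine ⟨N₀, fun N hN => ?_⟩
  obtain ⟨h1, h2⟩ := h0 N hN.le
  have := h1 ⟨0, h2⟩ 0 (by simp)
  rw [map_sub, MvPowerSeries.coeff_zero_C] at this
  rw [dist_eq_norm]
  linarith

theorem coeff_zero_mul {N : ℕ} (f g : MvPowerSeries (Fin N) ℂ) : MvPowerSeries.coeff 0 (f * g)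
    = MvPowerSeries.coeff 0 f * MvPowerSeries.coeff 0 g := by
  simp [MvPowerSeries.coeff_zero_eq_constantCoeff_apply]

/-- Write A as A · 1 and pull A out. The conjugated operator acts on the constant series 1, and for
the second limit on the output of the first application, which tends to a constant. -/
theorem tendsto_moments_of_conv {ℓ : Fam} {h : PowerSeries ℂ} (hℓ : Conv ℓ h) (q : ℕ → Polynomial ℂ)
    (n : ℕ) {A : ∀ N, MvPowerSeries (Fin N) ℂ} (hA : ∀ᶠ N in atTop, IsSymm (A N) ∧
      MvPowerSeries.coeff 0 (A N) = 1 ∧ ∀ i, MvPowerSeries.pderiv ℂ i (A N)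
        = A N * ((N : ℂ) • ℓ N i)) :
    Tendsto (fun N : ℕ => ((N : ℂ) ^ (n + 1))⁻¹ * MvPowerSeries.coeff 0
        (radialOp (fun i => MvPowerSeries.pderiv ℂ i) q n (A N))) atTop
        (𝓝 (limitMoment (q n) n h)) ∧
    Tendsto (fun N : ℕ => ((N : ℂ) ^ (n + 1))⁻¹ ^ 2 * MvPowerSeries.coeff 0
        (radialOp (fun i => MvPowerSeries.pderiv ℂ i) q n
          (radialOp (fun i => MvPowerSeries.pderiv ℂ i) q n (A N)))) atTop
        (𝓝 (limitMoment (q n) n h ^ 2)) := by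
  have h0 : Null fun N _ => (1 : MvPowerSeries (Fin N) ℂ) - MvPowerSeries.C 1 := by
    intro d ε hε
    refine Eventually.of_forall fun N i α _ => ?_
    simpa using hε.le
  have n1 := null_radialOp hℓ q n h0
  have n2 := null_radialOp hℓ q n n1
  have t1 := n1.tendsto_coeff_zero
  have t2 := n2.tendsto_coeff_zero
  rw [one_mul] at t1 t2
  rw [← sq] at t2
  constructor
  · refine t1.congr' ?_
    filter_upwards [hA] with N ⟨hs, h1, hd⟩
    have e1 := radialOp_symm_mul hs hd q n 1
    rw [mul_one] at e1
    rw [e1, coeff_zero_mul, h1, one_mul, map_smul, smul_eq_mul]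
  · refine t2.congr' ?_
    filter_upwards [hA] with N ⟨hs, h1, hd⟩
    have e1 := radialOp_symm_mul hs hd q n 1
    rw [mul_one] at e1
    rw [e1, radialOp_symm_mul hs hd, coeff_zero_mul, h1, one_mul, radialOp_smul,
      map_smul, map_smul, smul_eq_mul, smul_eq_mul]
    · ring
    · intro i c f
      rw [Derivation.map_smul, mul_smul_comm, smul_add]

end Moments

/-! ### Chebyshev's inequality on countable probability spaces. -/

section DiscreteProbability

variable {Ω : Type*} [MeasurableSpace Ω] [Countable Ω] [MeasurableSingletonClass Ω]

theorem hasSum_real_singleton (μ : Measure Ω) [IsProbabilityMeasure μ] :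
    HasSum (fun ω => μ.real {ω}) 1 := by
  have h := μ.tsum_indicator_apply_singleton Set.univ MeasurableSet.univ
  simp only [Set.indicator_univ, measure_univ] at h
  have h2 := ENNReal.hasSum_toReal (f := fun ω => μ {ω}) (by rw [h]; simp)
  have h3 : ∑' ω, (μ {ω}).toReal = 1 := by
    rw [← ENNReal.tsum_toReal_eq fun ω => measure_ne_top _ _, h]; simp
  rw [h3] at h2
  exact h2

theorem measure_le_of_hasSum (μ : Measure Ω) [IsProbabilityMeasure μ] {f : Ω → ℝ} (hf : ∀ ω, 0 ≤ f ω)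
    {v : ℝ} (h : HasSum (fun ω => μ.real {ω} * f ω) v) {ε : ℝ} (hε : 0 < ε) :
    μ {ω | ε ≤ f ω} ≤ ENNReal.ofReal (v / ε) := by
  have hm : Measurable fun ω => ENNReal.ofReal (f ω) := (measurable_of_countable f).ennreal_ofReal
  have h1 := meas_ge_le_lintegral_div (μ := μ) hm.aemeasurable
    (ε := ENNReal.ofReal ε) (by simpa using hε) ENNReal.ofReal_ne_top
  have h2 : ∫⁻ ω, ENNReal.ofReal (f ω) ∂μ = ENNReal.ofReal v := by
    rw [lintegral_countable' , ← h.tsum_eq, ENNReal.ofReal_tsum_of_nonneg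
      (fun ω => mul_nonneg measureReal_nonneg (hf ω)) h.summable]
    refine tsum_congr fun ω => ?_
    rw [ENNReal.ofReal_mul measureReal_nonneg, mul_comm, ofReal_measureReal]
  rw [h2, ← ENNReal.ofReal_div_of_pos hε] at h1
  refine le_trans (measure_mono fun ω hω => ?_) h1
  exact ENNReal.ofReal_le_ofReal hω

/-- The limit M is real because the first moments are sums of real terms. The expectation of (y -
M)² is S₂ - 2 M S₁ + M², which tends to 0. -/
theorem tendsto_measure_of_moments {Ω : ℕ → Type*} [∀ N, MeasurableSpace (Ω N)]
    [∀ N, Countable (Ω N)] [∀ N, MeasurableSingletonClass (Ω N)] (μ : ∀ N, Measure (Ω N))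
    [∀ N, IsProbabilityMeasure (μ N)] (y : ∀ N, Ω N → ℝ) {M : ℂ} {S₁ S₂ : ℕ → ℂ}
    (h₁ : Tendsto S₁ atTop (𝓝 M)) (h₂ : Tendsto S₂ atTop (𝓝 (M ^ 2)))
    (hS : ∀ᶠ N in atTop, HasSum (fun ω => (((μ N).real {ω} : ℂ) * (y N ω : ℂ))) (S₁ N) ∧
      HasSum (fun ω => (((μ N).real {ω} : ℂ) * (y N ω : ℂ) ^ 2)) (S₂ N)) :
    ((M.re : ℝ) : ℂ) = M ∧ ∀ ε : ℝ, 0 < ε →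
      Tendsto (fun N => μ N {ω | ε ≤ |y N ω - M.re|}) atTop (𝓝 0) := by
  have hre : ∀ᶠ N in atTop, HasSum (fun ω => (μ N).real {ω} * y N ω) (S₁ N).re ∧
      HasSum (fun ω => (μ N).real {ω} * y N ω ^ 2) (S₂ N).re ∧ (S₁ N).im = 0 := by
    filter_upwards [hS] with N ⟨a, b⟩
    refine ⟨?_, ?_, ?_⟩
    · convert Complex.hasSum_re a using 2 with ω
      rw [← Complex.ofReal_mul, Complex.ofReal_re]
    · convert Complex.hasSum_re b using 2 with ω
      rw [← Complex.ofReal_pow, ← Complex.ofReal_mul, Complex.ofReal_re]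
    · have := Complex.hasSum_im a
      simp only [← Complex.ofReal_mul, Complex.ofReal_im] at this
      exact this.unique hasSum_zero
  have him : M.im = 0 := by
    have t1 := (Complex.continuous_im.tendsto M).comp h₁
    exact tendsto_nhds_unique t1 (tendsto_const_nhds.congr' (hre.mono fun N hN => hN.2.2.symm))
  have hM : ((M.re : ℝ) : ℂ) = M := Complex.ext rfl (by simp [him])
  refine ⟨hM, fun ε hε => ?_⟩
  have r1 := (Complex.continuous_re.tendsto M).comp h₁
  have r2 := (Complex.continuous_re.tendsto (M ^ 2)).comp h₂
  have hM2 : (M ^ 2).re = M.re ^ 2 := by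
    rw [← hM, ← Complex.ofReal_pow, Complex.ofReal_re, Complex.ofReal_re]
  rw [hM2] at r2
  have hv : Tendsto (fun N => ENNReal.ofReal (((S₂ N).re - 2 * M.re * (S₁ N).re + M.re ^ 2) / ε ^ 2))
      atTop (𝓝 0) := by
    have : Tendsto (fun N => ((S₂ N).re - 2 * M.re * (S₁ N).re + M.re ^ 2) / ε ^ 2) atTop
        (𝓝 ((M.re ^ 2 - 2 * M.re * M.re + M.re ^ 2) / ε ^ 2)) :=
      ((r2.sub (r1.const_mul (2 * M.re))).add_const _).div_const _
    rw [show (M.re ^ 2 - 2 * M.re * M.re + M.re ^ 2) / ε ^ 2 = 0 by ring] at this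
    simpa using ENNReal.tendsto_ofReal this
  refine tendsto_of_tendsto_of_tendsto_of_le_of_le' tendsto_const_nhds hv
    (Eventually.of_forall fun _ => zero_le) ?_
  filter_upwards [hre] with N ⟨a, b, _⟩
  have hsum : HasSum (fun ω => (μ N).real {ω} * (y N ω - M.re) ^ 2)
      ((S₂ N).re - 2 * M.re * (S₁ N).re + M.re ^ 2) := by
    have := (b.sub (a.mul_left (2 * M.re))).add ((hasSum_real_singleton (μ N)).mul_right (M.re ^ 2))
    rw [one_mul] at this
    have e : (fun ω => (μ N).real {ω} * (y N ω - M.re) ^ 2) = fun ω =>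
        (μ N).real {ω} * y N ω ^ 2 - 2 * M.re * ((μ N).real {ω} * y N ω)
          + (μ N).real {ω} * M.re ^ 2 := by
      funext ω; ring
    rw [e]
    exact this
  refine le_trans (measure_mono fun ω hω => ?_)
    (measure_le_of_hasSum (μ N) (fun ω => sq_nonneg (y N ω - M.re)) hsum (pow_pos hε 2))
  have : ε ≤ |y N ω - M.re| := hω
  show ε ^ 2 ≤ (y N ω - M.re) ^ 2
  rw [← sq_abs (y N ω - M.re)]
  exact pow_le_pow_left₀ hε.le this 2

end DiscreteProbability

end SymSeries

/-! ### Concentration of the power sums and moments of the symmetrized measures. -/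

namespace SymSeries

open Finset

section PowerSums

variable {G : Series}

instance (N : ℕ) : Countable (G.Sig N) :=
  inferInstanceAs (Countable {l : Fin N → ℤ // G.IsSignature l})

instance (N : ℕ) : DiscreteMeasurableSpace (G.Sig N) := ⟨fun _ => trivial⟩

/-- Nonvanishing of the character at 1 is not used: where the denominator is 0 the term is 0 by
convention. Since the terms nevertheless sum to 1, the total mass of ρ, such signatures carry no
mass. -/
theorem normTerm_zero {N : ℕ} {ρ : Measure (G.Sig N)} [IsProbabilityMeasure ρ]
    (h : HasSum (fun l => normTerm G ρ l 0) 1) (l : G.Sig N) :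
    normTerm G ρ l 0 = (ρ.real {l} : ℂ) := by
  classical
  set t : G.Sig N → ℝ := fun l =>
    if MvPolynomial.eval 0 (mainPoly G l.1) = 0 then 0 else ρ.real {l} with ht
  have e : ∀ l, normTerm G ρ l 0 = (t l : ℂ) := by
    intro l
    simp only [normTerm, ht]
    split_ifs with h0
    · rw [h0, div_zero, mul_zero, Complex.ofReal_zero]
    · rw [div_self h0, mul_one]
  have h1 : HasSum t 1 := by
    simp only [e] at h
    rw [← Complex.ofReal_one] at h
    exact Complex.hasSum_ofReal.1 h
  have h2 := (hasSum_real_singleton ρ).sub h1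
  rw [sub_self] at h2
  have h3 := (hasSum_zero_iff_of_nonneg fun l => ?_).1 h2
  · have := congrFun h3 l
    rw [e, sub_eq_zero.1 this]
  · simp only [ht]
    split_ifs
    · simp
    · simp

variable {ρ : ∀ N : ℕ, Measure (G.Sig N)} {Q : ℂ → ℂ}

theorem normSum_regular {N : ℕ} (ρ : Measure (G.Sig N)) (i : Fin N)
    {U : Set (Fin N → ℂ)} (hU : IsOpen U) (h1 : (fun _ => 1) ∈ U)
    (hs : SummableUniformlyOn (fun (l : G.Sig N) u => G.charTerm ρ l u) U) :
    ContDiffAt ℂ (⊤ : ℕ∞) (normSum G ρ) 0 ∧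
      HasSumCoeff (fun l => taylor 0 (normTerm G ρ l)) (taylor 0 (normSum G ρ)) := by
  obtain ⟨r, hr, ht⟩ := exists_tendstoUniformlyOn_normTerm G ρ i hU h1 hs
  obtain ⟨h2, h3⟩ := hasSum_coeff_taylor hr (fun l x _ => smooth_normTerm G ρ l x) ht
  exact ⟨h2 0 (Metric.mem_ball_self hr), h3⟩

/-- The radial operator commutes with the coefficientwise sum over signatures and multiplies each
term by its power sum. Constant coefficients then give the first two moments under ρ N, and their
asymptotics come from `tendsto_moments_of_conv`. -/
theorem LogLimit.tendsto_powerSum [∀ N, IsProbabilityMeasure (ρ N)]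
    (hconv : ∀ N : ℕ, 1 ≤ N → ∃ U : Set (Fin N → ℂ), IsOpen U ∧ (fun _ => 1) ∈ U ∧
      SummableUniformlyOn (fun (l : G.Sig N) u => G.charTerm (ρ N) l u) U)
    (h : LogLimit ρ Q) (hQ : AnalyticAt ℂ Q 1) {Qhat : ℂ → ℂ} (hQhat : AnalyticAt ℂ Qhat 1)
    (he : ∀ᶠ u in 𝓝 (1 : ℂ), Qhat ((u + u⁻¹) / 2) = Q u) (k : ℕ) {M : ℂ}
    (hM : M = limitMoment ((Polynomial.X ^ 2 - 1) ^ k) (2 * k) (taylorOne 1 (deriv Qhat))) :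
    ((M.re : ℝ) : ℂ) = M ∧ ∀ ε : ℝ, 0 < ε → Tendsto (fun N => ρ N
      {l | ε ≤ |powerSum G k l.1 / (N : ℝ) ^ (2 * k + 1) - M.re|}) atTop (𝓝 0) := by
  have hreg : ∀ᶠ N in atTop, ContDiffAt ℂ (⊤ : ℕ∞) (normSum G (ρ N)) 0 ∧
      HasSumCoeff (fun l => taylor 0 (normTerm G (ρ N) l)) (taylor 0 (normSum G (ρ N))) := by
    filter_upwards [eventually_ge_atTop 1] with N hN
    obtain ⟨U, hU, h1, hs⟩ := hconv N hN
    exact normSum_regular (ρ N) ⟨0, hN⟩ hU h1 hs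
  have hc := h.conv_logSum (hreg.mono fun N hN => hN.1) hQ hQhat he
  obtain ⟨q, hq, heig⟩ := exists_radialOp_normTerm G k
  obtain ⟨t1, t2⟩ := tendsto_moments_of_conv hc q (2 * k) (A := fun N => taylor 0 (normSum G (ρ N)))
    (by
      filter_upwards [hreg, h.eventually_normSum_zero, eventually_ne_atTop 0] with N ⟨hs, _⟩ ⟨_, h0⟩ hN
      refine ⟨isSymm_taylor hs (normSum_symm G (ρ N)), ?_, pderiv_taylor_normSum G (ρ N) hN hs h0⟩
      rw [coeff_zero_taylor, h0])
  rw [hq, ← hM] at t1 t2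
  refine tendsto_measure_of_moments ρ (fun N l => powerSum G k l.1 / (N : ℝ) ^ (2 * k + 1)) t1 t2 ?_
  filter_upwards [hreg, h.eventually_normSum_zero] with N ⟨_, hs⟩ ⟨h0, _⟩
  have hs1 := hs.radialOp q (2 * k)
  have e1 : ∀ l, radialOp (fun i => MvPowerSeries.pderiv ℂ i) q (2 * k) (taylor 0 (normTerm G (ρ N) l))
      = (powerSum G k l.1 : ℂ) • taylor 0 (normTerm G (ρ N) l) := fun l => by
    simpa using heig N (ρ N) l 1
  simp only [e1] at hs1
  have hs2 := hs1.radialOp q (2 * k)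
  simp only [heig] at hs2
  have a1 := (hs1 0).mul_left (((N : ℂ) ^ (2 * k + 1))⁻¹)
  have a2 := (hs2 0).mul_left (((N : ℂ) ^ (2 * k + 1))⁻¹ ^ 2)
  simp only [map_smul, coeff_zero_taylor, normTerm_zero h0, smul_eq_mul] at a1 a2
  constructor
  · refine Eq.subst (motive := fun f => HasSum f _) (funext fun l => ?_) a1
    push_cast
    ring
  · refine Eq.subst (motive := fun f => HasSum f _) (funext fun l => ?_) a2
    push_cast
    ring

end PowerSums

section SymmetrizedMeasure

variable {G : Series} {N : ℕ}

theorem integrable_symMeasure (l : G.Sig N) (f : ℝ → ℝ) : Integrable f (G.symMeasure l) := by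
  refine Integrable.smul_measure ?_ ENNReal.ofReal_ne_top
  refine integrable_finsetSum_measure.2 fun i _ => ?_
  exact (integrable_dirac (by simp)).add_measure (integrable_dirac (by simp))

theorem integral_symMeasure (l : G.Sig N) (f : ℝ → ℝ) : ∫ x, f x ∂(G.symMeasure l)
    = 1 / (2 * N) * ∑ i, (f (G.atom l.1 i) + f (-G.atom l.1 i)) := by
  have hd : ∀ a, Integrable f (Measure.dirac a) := fun a => integrable_dirac (by simp)
  rw [Series.symMeasure, integral_smul_measure, ENNReal.toReal_ofReal (by positivity),
    integral_finsetSum_measure fun i _ => (hd _).add_measure (hd _), smul_eq_mul]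
  congr 1
  refine sum_congr rfl fun i _ => ?_
  rw [integral_add_measure (hd _) (hd _), integral_dirac, integral_dirac]

theorem isProbabilityMeasure_symMeasure (hN : N ≠ 0) (l : G.Sig N) :
    IsProbabilityMeasure (G.symMeasure l) := by
  constructor
  have h : (0 : ℝ) < 2 * N := by positivity
  simp only [Series.symMeasure, Measure.smul_apply, Measure.finsetSum_apply, Measure.add_apply,
    measure_univ, sum_const, card_univ, Fintype.card_fin, smul_eq_mul, nsmul_eq_mul]
  rw [show (N : ENNReal) * (1 + 1) = ENNReal.ofReal (2 * N) by
    rw [mul_comm, ENNReal.ofReal_mul (by norm_num)]; norm_num, ← ENNReal.ofReal_mul (by positivity),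
    one_div_mul_cancel h.ne', ENNReal.ofReal_one]

theorem integral_odd_pow_symMeasure (l : G.Sig N) {n : ℕ} (hn : Odd n) :
    ∫ x, x ^ n ∂(G.symMeasure l) = 0 := by
  rw [integral_symMeasure]
  simp [hn.neg_pow]

theorem integral_even_pow_symMeasure (l : G.Sig N) (k : ℕ) :
    ∫ x, x ^ (2 * k) ∂(G.symMeasure l)
      = (2 ^ (2 * k))⁻¹ * (powerSum G k l.1 / (N : ℝ) ^ (2 * k + 1)) := by
  rw [integral_symMeasure, powerSum, sum_div, mul_sum, mul_sum]
  refine sum_congr rfl fun i _ => ?_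
  rw [(even_two_mul k).neg_pow, Series.atom, div_pow, mul_pow, pow_mul (_ + _), pow_succ]
  rcases Nat.eq_zero_or_pos N with rfl | hN
  · exact i.elim0
  · have : (N : ℝ) ≠ 0 := by positivity
    field_simp
    ring

end SymmetrizedMeasure

end SymSeries

/-! ### Existence of a measure with the limiting moments. -/

namespace SymSeries

open Finset

section MomentMeasures

/-- The projection of the real line to `[-R, R]`. -/
noncomputable def clip (R x : ℝ) : ℝ := max (-R) (min R x)

theorem abs_clip_le {R : ℝ} (hR : 0 ≤ R) (x : ℝ) : |clip R x| ≤ R := by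
  rw [abs_le, clip]
  exact ⟨le_max_left _ _, max_le (by linarith) (min_le_left _ _)⟩

theorem clip_of_abs_le {R x : ℝ} (h : |x| ≤ R) : clip R x = x := by
  rw [abs_le] at h
  rw [clip, min_eq_right h.2, max_eq_right h.1]

theorem continuous_clip (R : ℝ) : Continuous (clip R) := by
  unfold clip
  fun_prop

/-- Where clipping changes x one has |x| > R, so missing powers of R may be replaced by powers of
|x|. The exponent 2(n + 1) is even, so the bound is itself a moment. -/
theorem abs_pow_sub_clip_pow_le {R : ℝ} (hR : 0 < R) (n : ℕ) (x : ℝ) :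
    |x ^ n - clip R x ^ n| ≤ x ^ (2 * (n + 1)) / R ^ (n + 2) := by
  have hnn : 0 ≤ x ^ (2 * (n + 1)) := (even_two_mul _).pow_nonneg x
  rcases le_or_gt |x| R with h | h
  · rw [clip_of_abs_le h, sub_self, abs_zero]
    positivity
  · have h1 : |x ^ n - clip R x ^ n| ≤ |x| ^ n := by
      rcases le_or_gt 0 x with hx | hx
      · rw [abs_of_nonneg hx] at h ⊢
        have hc : clip R x = R := by
          rw [clip, min_eq_left h.le, max_eq_right (by linarith)]
        rw [hc, abs_of_nonneg (sub_nonneg.2 (pow_le_pow_left₀ hR.le h.le n))]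
        linarith [pow_pos hR n]
      · rw [abs_of_neg hx] at h ⊢
        have hc : clip R x = -R := by
          rw [clip, min_eq_right (by linarith), max_eq_left (by linarith)]
        have e : x ^ n - (-R) ^ n = (-1) ^ n * ((-x) ^ n - R ^ n) := by
          rw [mul_sub, ← mul_pow, ← mul_pow]; ring
        rw [hc, e, abs_mul, abs_pow, abs_neg, abs_one, one_pow, one_mul,
          abs_of_nonneg (sub_nonneg.2 (pow_le_pow_left₀ hR.le h.le n))]
        linarith [pow_pos hR n]
    refine h1.trans ?_
    rw [le_div_iff₀ (by positivity)]
    calc |x| ^ n * R ^ (n + 2) ≤ |x| ^ n * |x| ^ (n + 2) := by gcongr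
      _ = |x| ^ (2 * (n + 1)) := by ring
      _ = x ^ (2 * (n + 1)) := (even_two_mul _).pow_abs x

theorem integrable_clip_pow (μ : Measure ℝ) [IsFiniteMeasure μ] {R : ℝ} (hR : 0 ≤ R) (n : ℕ) :
    Integrable (fun x => clip R x ^ n) μ := by
  refine Integrable.of_bound ((continuous_clip R).pow n).aestronglyMeasurable (R ^ n)
    (Eventually.of_forall fun x => ?_)
  rw [norm_pow, Real.norm_eq_abs]
  exact pow_le_pow_left₀ (abs_nonneg _) (abs_clip_le hR x) n

theorem abs_integral_sub_integral_clip_le (μ : Measure ℝ) [IsFiniteMeasure μ] {R : ℝ} (hR : 0 < R)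
    (n : ℕ) (h1 : Integrable (fun x => x ^ n) μ) (h2 : Integrable (fun x => x ^ (2 * (n + 1))) μ) :
    |∫ x, x ^ n ∂μ - ∫ x, clip R x ^ n ∂μ| ≤ (∫ x, x ^ (2 * (n + 1)) ∂μ) / R ^ (n + 2) := by
  rw [← integral_sub h1 (integrable_clip_pow μ hR.le n), ← integral_div]
  exact norm_integral_le_of_norm_le (f := fun x => x ^ n - clip R x ^ n) (h2.div_const _)
    (Eventually.of_forall fun x => abs_pow_sub_clip_pow_le hR n x)

theorem integrable_pow_of_even (μ : Measure ℝ) [IsFiniteMeasure μ] (n : ℕ)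
    (h : Integrable (fun x => x ^ (2 * n)) μ) : Integrable (fun x => x ^ n) μ := by
  refine Integrable.mono' ((integrable_const (1 : ℝ)).add h)
    (continuous_pow n).aestronglyMeasurable (Eventually.of_forall fun x => ?_)
  rw [Real.norm_eq_abs, abs_pow, Pi.add_apply, ← (even_two_mul n).pow_abs x, two_mul, pow_add]
  nlinarith [sq_nonneg (|x| ^ n - 1), sq_nonneg (|x| ^ n)]

/-- Fatou's lemma for the clipped powers as the clipping level tends to infinity. -/
theorem integral_even_pow_le_of_clip (μ : Measure ℝ) [IsFiniteMeasure μ] (n : ℕ) {M : ℝ}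
    (h : ∀ j : ℕ, ∫ x, clip (j + 1) x ^ (2 * n) ∂μ ≤ M) :
    Integrable (fun x => x ^ (2 * n)) μ ∧ ∫ x, x ^ (2 * n) ∂μ ≤ M := by
  have hnn : ∀ x : ℝ, 0 ≤ x ^ (2 * n) := fun x => (even_two_mul n).pow_nonneg x
  have hM : 0 ≤ M := (integral_nonneg fun x => hnn _).trans (h 0)
  have hl : ∫⁻ x, ENNReal.ofReal (x ^ (2 * n)) ∂μ ≤ ENNReal.ofReal M := by
    have hlim : ∀ x : ℝ, Tendsto (fun j : ℕ => ENNReal.ofReal (clip (j + 1) x ^ (2 * n))) atTop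
        (𝓝 (ENNReal.ofReal (x ^ (2 * n)))) := by
      intro x
      obtain ⟨j₀, hj₀⟩ := exists_nat_ge |x|
      refine tendsto_const_nhds.congr' ?_
      filter_upwards [eventually_ge_atTop j₀] with j hj
      rw [clip_of_abs_le]
      have : (j₀ : ℝ) ≤ j := by exact_mod_cast hj
      linarith
    calc ∫⁻ x, ENNReal.ofReal (x ^ (2 * n)) ∂μ
        = ∫⁻ x, liminf (fun j : ℕ => ENNReal.ofReal (clip (j + 1) x ^ (2 * n))) atTop ∂μ :=
          lintegral_congr fun x => (hlim x).liminf_eq.symm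
      _ ≤ liminf (fun j : ℕ => ∫⁻ x, ENNReal.ofReal (clip (j + 1) x ^ (2 * n)) ∂μ) atTop :=
          lintegral_liminf_le fun j =>
            (((continuous_clip _).pow _).measurable).ennreal_ofReal
      _ ≤ ENNReal.ofReal M := by
          refine liminf_le_of_le (by isBoundedDefault) fun b hb => ?_
          obtain ⟨j, hj⟩ := hb.exists
          refine hj.trans ?_
          rw [← ofReal_integral_eq_lintegral_ofReal (integrable_clip_pow μ (by positivity) _)
            (Eventually.of_forall fun x => hnn _)]
          exact ENNReal.ofReal_le_ofReal (h j)
  have hint : Integrable (fun x : ℝ => x ^ (2 * n)) μ := by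
    refine ⟨(continuous_pow _).aestronglyMeasurable, ?_⟩
    rw [hasFiniteIntegral_iff_ofReal (Eventually.of_forall hnn)]
    exact hl.trans_lt ENNReal.ofReal_lt_top
  refine ⟨hint, ?_⟩
  rw [← ofReal_integral_eq_lintegral_ofReal hint (Eventually.of_forall hnn)] at hl
  exact (ENNReal.ofReal_le_ofReal_iff hM).1 hl

/-- Bounded second moments give the tail bound C/(n + 1)² outside the ball of radius n + 1. Measures
with this tail bound form a compact set, so the sequence converges along an ultrafilter. -/
theorem exists_ultrafilter_tendsto (ν : ℕ → ProbabilityMeasure ℝ)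
    (hint : ∀ j, Integrable (fun x => x ^ 2) (ν j : Measure ℝ)) {C : ℝ}
    (hC : ∀ j, ∫ x, x ^ 2 ∂(ν j : Measure ℝ) ≤ C) :
    ∃ (V : Ultrafilter ℕ) (μ : ProbabilityMeasure ℝ), (V : Filter ℕ) ≤ atTop ∧
      Tendsto ν V (𝓝 μ) := by
  have hC0 : 0 ≤ C := (integral_nonneg fun x => sq_nonneg x).trans (hC 0)
  set u : ℕ → NNReal := fun n => ⟨C / ((n : ℝ) + 1) ^ 2, by positivity⟩ with hu
  have hu0 : Tendsto u atTop (𝓝 0) := by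
    rw [← NNReal.tendsto_coe]
    have h1 : Tendsto (fun n : ℕ => (n : ℝ) + 1) atTop atTop :=
      tendsto_atTop_add_const_right _ _ tendsto_natCast_atTop_atTop
    exact ((tendsto_pow_atTop two_ne_zero).comp h1).const_div_atTop C
  have hcomp := isCompact_setOfPred_probabilityMeasure_mass_eq_compl_isCompact_le
    (E := ℝ) (K := fun n => Metric.closedBall 0 ((n : ℝ) + 1)) hu0
    (fun n => isCompact_closedBall _ _) (Or.inl inferInstance)
  have hmem : ∀ j, ν j ∈ {μ : ProbabilityMeasure ℝ |
      ∀ n : ℕ, μ (Metric.closedBall 0 ((n : ℝ) + 1))ᶜ ≤ u n} := by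
    intro j n
    have h1 := mul_meas_ge_le_integral_of_nonneg (Eventually.of_forall fun x => sq_nonneg x)
      (hint j) (((n : ℝ) + 1) ^ 2)
    have h2 : (ν j : Measure ℝ).real (Metric.closedBall 0 ((n : ℝ) + 1))ᶜ
        ≤ (ν j : Measure ℝ).real {x | ((n : ℝ) + 1) ^ 2 ≤ x ^ 2} := by
      refine measureReal_mono fun x hx => ?_
      simp only [Set.mem_compl_iff, Metric.mem_closedBall, dist_zero_right, not_le,
        Real.norm_eq_abs] at hx
      show ((n : ℝ) + 1) ^ 2 ≤ x ^ 2
      rw [← sq_abs x]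
      exact pow_le_pow_left₀ (by positivity) hx.le 2
    have h3 : (ν j : Measure ℝ).real (Metric.closedBall 0 ((n : ℝ) + 1))ᶜ
        ≤ C / ((n : ℝ) + 1) ^ 2 := by
      rw [le_div_iff₀ (by positivity), mul_comm]
      exact (mul_le_mul_of_nonneg_left h2 (by positivity)).trans (h1.trans (hC j))
    exact h3
  set V := Ultrafilter.of (atTop : Filter ℕ)
  obtain ⟨μ, -, hμ⟩ := isCompact_iff_ultrafilter_le_nhds.1 hcomp (V.map ν)
    (by
      rw [le_principal_iff]
      exact Filter.mem_map.2 (Filter.univ_mem' hmem))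
  exact ⟨V, μ, Ultrafilter.of_le _, hμ⟩

/-- Weak convergence handles the bounded clipped powers. The truncation error is controlled by a
higher even moment, uniformly along the sequence, and it tends to 0 as the clipping level grows. -/
theorem exists_measure_of_tendsto_moments (ν : ℕ → ProbabilityMeasure ℝ)
    (hint : ∀ j n, Integrable (fun x => x ^ n) (ν j : Measure ℝ)) {m : ℕ → ℝ}
    (hm : ∀ n, Tendsto (fun j => ∫ x, x ^ n ∂(ν j : Measure ℝ)) atTop (𝓝 (m n))) :
    ∃ μ : Measure ℝ, IsProbabilityMeasure μ ∧ (∀ n : ℕ, Integrable (fun x => x ^ n) μ) ∧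
      ∀ n : ℕ, ∫ x, x ^ n ∂μ = m n := by
  obtain ⟨C, hC⟩ := (hm 2).bddAbove_range
  obtain ⟨V, μ, hV, hμ⟩ := exists_ultrafilter_tendsto ν (fun j => hint j 2)
    fun j => hC (Set.mem_range_self j)
  have hclip : ∀ (R : ℝ), 0 ≤ R → ∀ n, Tendsto (fun j => ∫ x, clip R x ^ n ∂(ν j : Measure ℝ)) V
      (𝓝 (∫ x, clip R x ^ n ∂(μ : Measure ℝ))) := by
    intro R hR n
    exact ProbabilityMeasure.tendsto_iff_forall_integral_tendsto.1 hμ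
      (BoundedContinuousFunction.ofNormedAddCommGroup (fun x => clip R x ^ n)
        ((continuous_clip R).pow n) (R ^ n) fun x => by
          rw [norm_pow, Real.norm_eq_abs]
          exact pow_le_pow_left₀ (abs_nonneg _) (abs_clip_le hR x) n)
  have hmV : ∀ n, Tendsto (fun j => ∫ x, x ^ n ∂(ν j : Measure ℝ)) V (𝓝 (m n)) := fun n =>
    (hm n).mono_left hV
  have heven : ∀ n, Integrable (fun x => x ^ (2 * n)) (μ : Measure ℝ) ∧
      ∫ x, x ^ (2 * n) ∂(μ : Measure ℝ) ≤ m (2 * n) := by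
    intro n
    refine integral_even_pow_le_of_clip _ n fun j => ?_
    refine le_of_tendsto_of_tendsto (hclip (j + 1) (by positivity) (2 * n)) (hmV (2 * n))
      (Eventually.of_forall fun i => ?_)
    refine integral_mono (integrable_clip_pow _ (by positivity) _) (hint i _) fun x => ?_
    show clip (j + 1) x ^ (2 * n) ≤ x ^ (2 * n)
    rw [← (even_two_mul n).pow_abs (clip _ x), ← (even_two_mul n).pow_abs x]
    refine pow_le_pow_left₀ (abs_nonneg _) ?_ _
    rcases le_or_gt |x| ((j : ℝ) + 1) with h | h
    · rw [clip_of_abs_le h]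
    · exact (abs_clip_le (by positivity) x).trans h.le
  have hintμ : ∀ n, Integrable (fun x => x ^ n) (μ : Measure ℝ) := fun n =>
    integrable_pow_of_even _ n (heven n).1
  refine ⟨μ, inferInstance, hintμ, fun n => ?_⟩
  -- The factor 2 accounts for one truncation error in the limit measure and one in the
  -- approximating measures.
  have hbound : ∀ j : ℕ, |∫ x, x ^ n ∂(μ : Measure ℝ) - m n|
      ≤ 2 * m (2 * (n + 1)) / ((j : ℝ) + 1) ^ (n + 2) := by
    intro j
    have hR : (0 : ℝ) < (j : ℝ) + 1 := by positivity
    have h1 := abs_integral_sub_integral_clip_le (μ : Measure ℝ) hR n (hintμ n) (hintμ _)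
    have h2 : |m n - ∫ x, clip (j + 1) x ^ n ∂(μ : Measure ℝ)|
        ≤ m (2 * (n + 1)) / ((j : ℝ) + 1) ^ (n + 2) :=
      le_of_tendsto_of_tendsto ((hmV n).sub (hclip _ hR.le n)).abs
        ((hmV (2 * (n + 1))).div_const _) (Eventually.of_forall fun i =>
          abs_integral_sub_integral_clip_le _ hR n (hint i n) (hint i _))
    have h3 : (∫ x, x ^ (2 * (n + 1)) ∂(μ : Measure ℝ)) / ((j : ℝ) + 1) ^ (n + 2)
        ≤ m (2 * (n + 1)) / ((j : ℝ) + 1) ^ (n + 2) :=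
      div_le_div_of_nonneg_right (heven (n + 1)).2 (by positivity)
    have h4 := abs_sub_le (∫ x, x ^ n ∂(μ : Measure ℝ))
      (∫ x, clip (j + 1) x ^ n ∂(μ : Measure ℝ)) (m n)
    rw [abs_sub_comm (∫ x, clip (j + 1) x ^ n ∂(μ : Measure ℝ)) (m n)] at h4
    rw [two_mul, add_div]
    linarith
  have hlim : Tendsto (fun j : ℕ => 2 * m (2 * (n + 1)) / ((j : ℝ) + 1) ^ (n + 2)) atTop (𝓝 0) := by
    have h1 : Tendsto (fun n : ℕ => (n : ℝ) + 1) atTop atTop :=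
      tendsto_atTop_add_const_right _ _ tendsto_natCast_atTop_atTop
    exact ((tendsto_pow_atTop (by omega)).comp h1).const_div_atTop _
  have := ge_of_tendsto' hlim hbound
  exact sub_eq_zero.1 (abs_nonpos_iff.1 this)

/-- For each j the exceptional events for the first j + 1 moments have total probability below 1 for
some N, so a point outside all of them exists. Letting the tolerance 1/(j + 1) shrink gives one
sequence that works for every moment. -/
theorem exists_sequence_of_tendsto_measure {Ω : ℕ → Type*} [∀ N, MeasurableSpace (Ω N)]
    (μ : ∀ N, Measure (Ω N)) [∀ N, IsProbabilityMeasure (μ N)] (y : ℕ → ∀ N, Ω N → ℝ) (m : ℕ → ℝ)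
    (h : ∀ n : ℕ, ∀ ε : ℝ, 0 < ε →
      Tendsto (fun N => μ N {ω | ε ≤ |y n N ω - m n|}) atTop (𝓝 0)) :
    ∃ (N : ℕ → ℕ) (ω : ∀ j, Ω (N j)), (∀ j, N j ≠ 0) ∧
      ∀ n, Tendsto (fun j => y n (N j) (ω j)) atTop (𝓝 (m n)) := by
  have key : ∀ j : ℕ, ∃ N : ℕ, N ≠ 0 ∧ ∃ ω : Ω N, ∀ n ∈ range (j + 1),
      |y n N ω - m n| < 1 / ((j : ℝ) + 1) := by
    intro j
    have hpos : 0 < 1 / ((j : ℝ) + 1) := by positivity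
    have hs : Tendsto (fun N => ∑ n ∈ range (j + 1),
        μ N {ω | 1 / ((j : ℝ) + 1) ≤ |y n N ω - m n|}) atTop (𝓝 0) := by
      simpa using tendsto_finsetSum (range (j + 1)) fun n _ => h n _ hpos
    obtain ⟨N, hN, hN0⟩ := ((hs.eventually (gt_mem_nhds one_pos)).and (eventually_ne_atTop 0)).exists
    refine ⟨N, hN0, ?_⟩
    by_contra hcon
    push Not at hcon
    have huniv : (Set.univ : Set (Ω N)) ⊆ ⋃ n ∈ range (j + 1),
        {ω | 1 / ((j : ℝ) + 1) ≤ |y n N ω - m n|} := by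
      intro ω _
      obtain ⟨n, hn, hle⟩ := hcon ω
      exact Set.mem_biUnion (by exact_mod_cast hn) hle
    have := (measure_mono huniv).trans (measure_biUnion_finset_le (μ := μ N) _ _)
    rw [measure_univ] at this
    exact absurd hN (not_lt.2 this)
  choose N hN ω hω using key
  refine ⟨N, ω, hN, fun n => ?_⟩
  rw [tendsto_iff_norm_sub_tendsto_zero]
  refine squeeze_zero' (Eventually.of_forall fun _ => norm_nonneg _) ?_
    tendsto_one_div_add_atTop_nhds_zero_nat
  filter_upwards [eventually_ge_atTop n] with j hj
  exact (hω j n (mem_range.2 (by omega))).le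

end MomentMeasures

end SymSeries

/-! ### Convergence in probability of the moments and the final statement. -/

namespace SymSeries

open Finset

section LimitMeasure

variable {G : Series} {ρ : ∀ N : ℕ, Measure (G.Sig N)} {Q : ℂ → ℂ}

/-- The limit of the `n`-th moment of the symmetrized measures. -/
noncomputable def momentLimit (h : ℂ → ℂ) (n : ℕ) : ℝ :=
  if Odd n then 0 else (2 ^ n)⁻¹ *
    (limitMoment ((Polynomial.X ^ 2 - 1) ^ (n / 2)) n (taylorOne 1 h)).re

theorem LogLimit.tendsto_moment [∀ N, IsProbabilityMeasure (ρ N)]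
    (hconv : ∀ N : ℕ, 1 ≤ N → ∃ U : Set (Fin N → ℂ), IsOpen U ∧ (fun _ => 1) ∈ U ∧
      SummableUniformlyOn (fun (l : G.Sig N) u => G.charTerm (ρ N) l u) U)
    (h : LogLimit ρ Q) (hQ : AnalyticAt ℂ Q 1) {Qhat : ℂ → ℂ} (hQhat : AnalyticAt ℂ Qhat 1)
    (he : ∀ᶠ u in 𝓝 (1 : ℂ), Qhat ((u + u⁻¹) / 2) = Q u) (n : ℕ) {ε : ℝ} (hε : 0 < ε) :
    Tendsto (fun N => ρ N
      {l | ε ≤ |∫ x, x ^ n ∂(G.symMeasure l) - momentLimit (deriv Qhat) n|}) atTop (𝓝 0) := by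
  by_cases hn : Odd n
  · simp [integral_odd_pow_symMeasure _ hn, momentLimit, hn, hε.not_ge]
  · obtain ⟨k, rfl⟩ := (Nat.not_odd_iff_even.1 hn).two_dvd
    have h2 : (0 : ℝ) < 2 ^ (2 * k) := by positivity
    refine ((h.tendsto_powerSum hconv hQ hQhat he k rfl).2 (2 ^ (2 * k) * ε)
      (by positivity)).congr fun N => ?_
    congr 1
    ext l
    simp only [Set.mem_ofPred_eq]
    rw [integral_even_pow_symMeasure, momentLimit, if_neg hn, Nat.mul_div_cancel_left k two_pos,
      ← mul_sub, abs_mul, abs_of_pos (inv_pos.2 h2), inv_mul_eq_div, le_div_iff₀ h2, mul_comm ε]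

end LimitMeasure

end SymSeries

theorem theorem5p2 (G : Series) (ρ : ∀ N : ℕ, Measure (G.Sig N))
    (hprob : ∀ N, IsProbabilityMeasure (ρ N))
    -- the series of each character generating function converges uniformly near `(1, …, 1)`
    (hconv : ∀ N : ℕ, 1 ≤ N → ∃ U : Set (Fin N → ℂ), IsOpen U ∧ (fun _ => 1) ∈ U ∧
      SummableUniformlyOn (fun (l : G.Sig N) u => G.charTerm (ρ N) l u) U)
    (Q : ℂ → ℂ) (hQ : AnalyticAt ℂ Q 1)
    -- `L N u` is `1 / N` times the analytic branch, vanishing at `(1, …, 1)`, of the logarithm of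
    -- the character generating function at `(u_1, …, u_k, 1, …, 1)`
    (hlim : ∀ k : ℕ, ∃ U : Set (Fin k → ℂ), IsOpen U ∧ (fun _ => 1) ∈ U ∧
      ∃ L : ℕ → (Fin k → ℂ) → ℂ,
        (∀ᶠ N in atTop, AnalyticOnNhd ℂ (L N) U ∧ L N (fun _ => 1) = 0 ∧
          ∀ u ∈ U, Summable (fun l : G.Sig N => G.charTerm (ρ N) l (Series.padOnes N u)) ∧
            Complex.exp (N * L N u) = G.charGenFun (ρ N) (Series.padOnes N u)) ∧
        TendstoUniformlyOn L (fun u => ∑ i, Q (u i)) atTop U) :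
    ∃ Qhat : ℂ → ℂ, AnalyticAt ℂ Qhat 1 ∧ (∀ᶠ u in 𝓝 (1 : ℂ), Qhat ((u + u⁻¹) / 2) = Q u) ∧
      ∃ m : Measure ℝ, IsProbabilityMeasure m ∧ (∀ n : ℕ, Integrable (fun x => x ^ n) m) ∧
        (∀ n : ℕ, ∀ ε : ℝ, 0 < ε →
          Tendsto (fun N => ρ N {l | ε ≤ |∫ x, x ^ n ∂(G.symMeasure l) - ∫ x, x ^ n ∂m|})
            atTop (𝓝 0)) ∧
        (∀ n : ℕ, Odd n → ∫ x, x ^ n ∂m = 0) ∧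
        ∀ k : ℕ, ((∫ x, x ^ (2 * k) ∂m : ℝ) : ℂ) =
          (2 ^ (2 * k))⁻¹ * ∑ l ∈ Finset.range (2 * k + 1),
            ((2 * k).factorial : ℂ) /
                ((l.factorial : ℂ) * ((l + 1).factorial : ℂ) * ((2 * k - l).factorial : ℂ)) *
              iteratedDeriv l (fun z => (z ^ 2 - 1) ^ k * deriv Qhat z ^ (2 * k - l)) 1 := by
  have h : SymSeries.LogLimit ρ Q := hlim
  obtain ⟨Qhat, hQhat, he⟩ := SymSeries.exists_analytic_joukowski hQ h.eventually_inv
  have hmom := fun n ε hε => h.tendsto_moment hconv hQ hQhat he n (ε := ε) hε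
  -- Concentration is already known around certain numbers. A deterministic sequence of signatures
  -- realizes them as limits of moments of probability measures, hence as the moments of a
  -- probability measure.
  obtain ⟨N, l, hN, hl⟩ := SymSeries.exists_sequence_of_tendsto_measure ρ
    (fun n N l => ∫ x, x ^ n ∂(G.symMeasure l)) _ hmom
  obtain ⟨m, hm, hint, hmeq⟩ := SymSeries.exists_measure_of_tendsto_moments
    (fun j => ⟨G.symMeasure (l j), SymSeries.isProbabilityMeasure_symMeasure (hN j) (l j)⟩)
    (fun j n => SymSeries.integrable_symMeasure (l j) _) hl
  refine ⟨Qhat, hQhat, he, m, hm, hint, fun n ε hε => ?_, fun n hn => ?_, fun k => ?_⟩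
  · simp only [hmeq]
    exact hmom n ε hε
  · rw [hmeq, SymSeries.momentLimit, if_pos hn]
  · rw [hmeq, SymSeries.momentLimit, if_neg (Nat.not_odd_iff_even.2 (even_two_mul k)),
      Nat.mul_div_cancel_left k two_pos, Complex.ofReal_mul,
      (h.tendsto_powerSum hconv hQ hQhat he k rfl).1,
      SymSeries.limitMoment_eq k (SymSeries.smooth_deriv hQhat.contDiffAt)]
    push_cast
    rfl
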